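/- **Setting.** Let $n\ge 1$, $m>0$. All functions are complex valued; $\mathcal S(\mathbb R^k)$ is the Schwartz space and $\mathcal S'(\mathbb R^k)$ its dual. Write $x=(x^0,\mathbf x)=(x^0,x^1,\dots,x^n)\in\mathbb R^{1+n}$ and let $\tilde x=\kappa(x)=(x^+,x_\perp,x^-)$ be the light-cone coordinates $x^+=(x^0+x^n)/\sqrt2$, $x_\perp=(x^1,\dots,x^{n-1})$, $x^-=(x^0-x^n)/\sqrt2$. Put $\tilde{\mathbf x}=(x_\perp,x^-)\in\mathbb R^n$ and $\tilde{\mathbf p}=(p^+,p_\perp)\in\mathbb R^n$. Let $\Box=\partial_0^2-\sum_{i=1}^n\partial_i^2$, $\widetilde\Box=2\partial_+\partial_--\sum_{i=1}^{n-1}\partial_i^2$, $\omega(\mathbf p)=\sqrt{\mathbf p^2+m^2}$, $\tilde\omega(\tilde{\mathbf p})=(p_\perp^2+m^2)/(2p^+)$. **Tame and squeezed generalized functions.** $\mathcal S_{\partial_-}(\mathbb R^k)=\bigcap_{j\ge0}\partial_-^j\mathcal S(\mathbb R^k)$ ($\partial_-$ the derivative in the last coordinate $x^-$) carries the subspace topology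 of $\mathcal S(\mathbb R^k)$; $\mathcal S'_{\partial_-}(\mathbb R^k)$ is its dual, and the relaxation $u^*\in\mathcal S'_{\partial_-}(\mathbb R^k)$ of $u\in\mathcal S'(\mathbb R^k)$ is the restriction of $u$ to $\mathcal S_{\partial_-}(\mathbb R^k)$. $\mathcal S_{p^+}(\mathbb R^n)$ is the space of all $f\in C^\infty(\mathbb R^n)$ with $\sup_{p^+\ne0}|(p^+)^kp_\perp^\beta\partial^\alpha f|<\infty$ for all $k\in\mathbb Z$ and multi-indices $\alpha,\beta$, topologized by these seminorms, and $\mathcal S'_{p^+}(\mathbb R^n)$ is its dual. If $M$ is a multiplicator of $\mathcal S_{p^+}(\mathbb R^n)$, such as $|p^+|^k$ ($k\in\mathbb Z$) or $\Theta(\pm p^+)$ ($\Theta$ the Heaviside function), then $(Mb,f)=(b,Mf)$ for $b\in\mathcal S'_{p^+}(\mathbb R^n)$. **Fourier transforms.** $u^\wedge$ is the Fourier transform on $\mathcal S'(\mathbb R^n)$ extending $f^\wedge(\mathbf p)=\int f(\mathbf x)e^{-i\mathbf x\cdot\mathbf p}\,d\mathbf x$, and $v^{\wedge_{L}}\in\mathcal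 S'_{p^+}(\mathbb R^n)$, for $v\in\mathcal S'_{\partial_-}(\mathbb R^n)$, is given by $(v^{\wedge_L},g)=(v,h)$ with $h(\tilde{\mathbf x})=\int g(\tilde{\mathbf p})e^{i(x^-p^+-x_\perp\cdot p_\perp)}\,d\tilde{\mathbf p}$. **Squeezing maps.** Let $\nu_{\gtrless0}:\{\pm p^+>0\}\to\mathbb R^n$, $\nu_{\gtrless0}(\tilde{\mathbf p})=\bigl(p_\perp,(p^+-\tilde\omega(\tilde{\mathbf p}))/\sqrt2\bigr)$, a diffeomorphism with inverse $\mu_{\gtrless0}(\mathbf p)=\bigl((p^n\pm\omega(\mathbf p))/\sqrt2,p^1,\dots,p^{n-1}\bigr)$. The pullbacks $\nu^*_{\gtrless0}:\mathcal S'(\mathbb R^n)\to\mathcal S'_{p^+}(\mathbb R^n)$ and $\mu^*_{\gtrless0}$ from $\{b\in\mathcal S'_{p^+}(\mathbb R^n): b \text{ vanishes on the } f\in\mathcal S_{p^+}(\mathbb R^n) \text{ with } f=0 \text{ on } \{\pm p^+>0\}\}$ to $\mathcal S'(\mathbb R^n)$ are $(\nu^*_{\gtrless0}a,f)=(a,|\det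 D\mu_{\gtrless0}|\,f\circ\mu_{\gtrless0})$ and $(\mu^*_{\gtrless0}b,g)=(b,|\det D\nu_{\gtrless0}|\,g\circ\nu_{\gtrless0})$, where the last test function is extended by zero. **Restrictions.** For $u\in\mathcal S'(\mathbb R^{1+n})$ and $v\in\mathcal S'(\mathbb R^n)$, $u|_{x^0=0}=v$ means: there is a family $(u_t)_{t\in\mathbb R}$ in $\mathcal S'(\mathbb R^n)$ such that $t\mapsto(u_t,g)$ is $C^\infty$ and $(u,f\otimes g)=\int(u_t,g)f(t)\,dt$ (absolutely convergent) for all $f\in\mathcal S(\mathbb R)$, $g\in\mathcal S(\mathbb R^n)$, and $u_0=v$. For $w\in\mathcal S'(\mathbb R^{1+n})$ and $v\in\mathcal S'_{\partial_-}(\mathbb R^n)$, the tame restriction satisfies $w|^*_{x^+=0}=v$ if there are an open neighbourhood $\Omega$ of $0\in\mathbb R$ and a family $(w_t)_{t\in\Omega}$ in $\mathcal S'_{\partial_-}(\mathbb R^n)$ such that $t\mapsto(w_t,g)$ is $C^\infty$ on $\Omega$ and $(w^*,f\otimes g)=\int_\Omega(w_t,g)f(t)\,dt$ for all $f\in C_c^\infty(\Omega)$,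 $g\in\mathcal S_{\partial_-}(\mathbb R^n)$, and $w_0=v$. **Statement.** Let $u_0,u_1\in\mathcal S'(\mathbb R^n)$ and $\tilde u_0\in\mathcal S'_{\partial_-}(\mathbb R^n)$. The transformation law $$(1)\qquad \tilde u_0^{\wedge_L}=\frac1{2|p^+|}\Bigl(\nu^*_{>0}(\omega u_0^\wedge+iu_1^\wedge)+\nu^*_{<0}(\omega u_0^\wedge-iu_1^\wedge)\Bigr)$$ holds if and only if both $$(2)\qquad u_0^\wedge=\frac1\omega\Bigl(\mu^*_{>0}(|p^+|\Theta(p^+)\tilde u_0^{\wedge_L})+\mu^*_{<0}(|p^+|\Theta(-p^+)\tilde u_0^{\wedge_L})\Bigr),$$ $$(3)\qquad u_1^\wedge=\frac1i\Bigl(\mu^*_{>0}(|p^+|\Theta(p^+)\tilde u_0^{\wedge_L})-\mu^*_{<0}(|p^+|\Theta(-p^+)\tilde u_0^{\wedge_L})\Bigr)$$ hold. If these laws hold then, for every $u\in\mathcal S'(\mathbb R^{1+n})$, $u$ is a solution of the non-characteristic Cauchy problem $$(\Box+m^2)u=0,\qquad u|_{x^0=0}=u_0,\qquad \partial_0u|_{x^0=0}=u_1$$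 if and only if $\tilde u=u\circ\kappa^{-1}$ is a solution of the characteristic Cauchy problem $$(\widetilde\Box+m^2)\tilde u=0,\qquad \tilde u|^*_{x^+=0}=\tilde u_0 .$$ Moreover, each problem has at most one solution in $\mathcal S'(\mathbb R^{1+n})$: $u$ is uniquely determined by $(u_0,u_1)$, and $\tilde u$ is uniquely determined by $\tilde u_0$. -/

import Mathlib

open SchwartzMap LineDeriv MeasureTheory
open scoped FourierTransform ContDiff

noncomputable section

namespace CharCauchy

/-- `ℝⁿ` with `n = d + 1 ≥ 1`.  Position vectors on the characteristic hyperplane have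
coordinates `(x_⊥, x⁻)`, where `x⁻` is the last coordinate; light-cone momenta have coordinates
`(p⁺, p_⊥)`, where `p⁺` is the coordinate with index `0`. -/
abbrev Sp (d : ℕ) : Type := EuclideanSpace ℝ (Fin (d + 1))

/-- `ℝ¹⁺ⁿ` with `n = d + 1`: coordinates `(x⁰, x¹, …, xⁿ)`, or `(x⁺, x_⊥, x⁻)`. -/
abbrev ST (d : ℕ) : Type := EuclideanSpace ℝ (Fin (d + 2))

/-- The standard basis vectors. -/
def e {k : ℕ} (i : Fin k) : EuclideanSpace ℝ (Fin k) := EuclideanSpace.single i 1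

/-- `(x⁰, x¹, …, xᵏ) ↦ (x¹, …, xᵏ)`. -/
def tail {k : ℕ} : EuclideanSpace ℝ (Fin (k + 1)) →L[ℝ] EuclideanSpace ℝ (Fin k) :=
  LinearMap.toContinuousLinearMap
    { toFun := fun x => WithLp.toLp 2 (fun i => x i.succ)
      map_add' := fun x y => by ext i; simp
      map_smul' := fun c x => by ext i; simp }

@[simp] theorem tail_apply {k : ℕ} (x : EuclideanSpace ℝ (Fin (k + 1))) (i : Fin k) :
    tail x i = x i.succ := rfl

/-! ### Continuous linear maps determined by a pointwise formula -/

/-- `X` and `Y` are spaces of functions (on `E₁` and `E₂`) via `cX` and the injective map `cY`,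
and `A` is an operation on functions.  If `A` maps `X` into `Y` and the resulting map is linear and
continuous, then `inducedCLM cX cY A` is this map.  (As with `SchwartzMap.smulLeftCLM`, the
value is `0` otherwise; below it is used only for operations that do induce such a map.) -/
def inducedCLM {E₁ E₂ X Y : Type*} [AddCommGroup X] [Module ℂ X] [TopologicalSpace X]
    [AddCommGroup Y] [Module ℂ Y] [TopologicalSpace Y]
    (cX : X → E₁ → ℂ) (cY : Y → E₂ → ℂ) (A : (E₁ → ℂ) → E₂ → ℂ) : X →L[ℂ] Y :=
  open Classical in
  if h : ∃ T : X →L[ℂ] Y, ∀ f : X, cY (T f) = A (cX f) then h.choose else 0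

theorem inducedCLM_eq {E₁ E₂ X Y : Type*} [AddCommGroup X] [Module ℂ X] [TopologicalSpace X]
    [AddCommGroup Y] [Module ℂ Y] [TopologicalSpace Y]
    {cX : X → E₁ → ℂ} {cY : Y → E₂ → ℂ} {A : (E₁ → ℂ) → E₂ → ℂ}
    (hY : Function.Injective cY) (T : X →L[ℂ] Y) (hT : ∀ f : X, cY (T f) = A (cX f)) :
    inducedCLM cX cY A = T := by
  have h : ∃ T : X →L[ℂ] Y, ∀ f : X, cY (T f) = A (cX f) := ⟨T, hT⟩
  rw [inducedCLM, dif_pos h]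
  ext f
  exact hY ((h.choose_spec f).trans (hT f).symm)

/-! ### Tame generalized functions -/

/-- `𝓢_{∂₋}(ℝᵏ⁺¹) = ⋂ₘ ∂₋ᵐ 𝓢(ℝᵏ⁺¹)`, where `∂₋` is the derivative in the direction of the last
coordinate, with the subspace topology of `𝓢(ℝᵏ⁺¹)`. -/
def tameSpace (k : ℕ) : Submodule ℂ 𝓢(EuclideanSpace ℝ (Fin (k + 1)), ℂ) where
  carrier := {g | ∀ m : ℕ, ∃ h : 𝓢(EuclideanSpace ℝ (Fin (k + 1)), ℂ),
    g = ∂^{fun _ : Fin m => e (Fin.last k)} h}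
  add_mem' {g₁ g₂} h₁ h₂ m := by
    obtain ⟨a, rfl⟩ := h₁ m
    obtain ⟨b, rfl⟩ := h₂ m
    exact ⟨a + b, (iteratedLineDerivOp_add _ _ _).symm⟩
  zero_mem' m := ⟨0, (iteratedLineDerivOp_zero _).symm⟩
  smul_mem' c g h m := by
    obtain ⟨a, rfl⟩ := h m
    exact ⟨c • a, (iteratedLineDerivOp_smul _ _ _).symm⟩

/-- `𝓢'_{∂₋}(ℝᵏ⁺¹)`, the tame generalized functions. -/
abbrev TameDist (k : ℕ) : Type := tameSpace k →Lₚₜ[ℂ] ℂ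

/-- The relaxation `u ↦ u*`: restriction of a tempered distribution to `𝓢_{∂₋}`. -/
def relax {k : ℕ} (u : 𝓢'(EuclideanSpace ℝ (Fin (k + 1)), ℂ)) : TameDist k :=
  PointwiseConvergenceCLM.precomp ℂ (tameSpace k).subtypeL u

/-! ### Squeezed generalized functions -/

/-- The vector space underlying `𝓢_{p⁺}(ℝⁿ)`: smooth functions `f` on `ℝⁿ` such that
`sup_{p⁺ ≠ 0} |p⁺|ᵃ ‖p‖ˡ ‖Dʲ f(p)‖ < ∞` for all `a ∈ ℤ` and all `l, j ∈ ℕ`. -/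
def squeezedSubmodule (d : ℕ) : Submodule ℂ (Sp d → ℂ) where
  carrier := {f | ContDiff ℝ ∞ f ∧ ∀ (a : ℤ) (l j : ℕ), ∃ C : ℝ, ∀ p : Sp d, p 0 ≠ 0 →
    |p 0| ^ a * ‖p‖ ^ l * ‖iteratedFDeriv ℝ j f p‖ ≤ C}
  add_mem' {f g} hf hg := by
    refine ⟨hf.1.add hg.1, fun a l j => ?_⟩
    obtain ⟨C₁, h₁⟩ := hf.2 a l j
    obtain ⟨C₂, h₂⟩ := hg.2 a l j
    refine ⟨C₁ + C₂, fun p hp => ?_⟩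
    rw [iteratedFDeriv_add_apply (hf.1.contDiffAt.of_le (by exact_mod_cast le_top))
      (hg.1.contDiffAt.of_le (by exact_mod_cast le_top))]
    calc _ ≤ |p 0| ^ a * ‖p‖ ^ l * (‖iteratedFDeriv ℝ j f p‖ + ‖iteratedFDeriv ℝ j g p‖) := by
          gcongr; exact norm_add_le _ _
      _ ≤ C₁ + C₂ := by rw [mul_add]; exact add_le_add (h₁ p hp) (h₂ p hp)
  zero_mem' := ⟨contDiff_const, fun a l j => ⟨0, fun p _ => by
    simp⟩⟩
  smul_mem' c f hf := by
    refine ⟨contDiff_const.smul hf.1, fun a l j => ?_⟩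
    obtain ⟨C, h⟩ := hf.2 a l j
    refine ⟨‖c‖ * C, fun p hp => ?_⟩
    rw [iteratedFDeriv_const_smul_apply (hf.1.contDiffAt.of_le (by exact_mod_cast le_top)),
      norm_smul, mul_left_comm]
    exact mul_le_mul_of_nonneg_left (h p hp) (norm_nonneg c)

theorem squeezed_bddAbove {d : ℕ} (i : ℤ × ℕ × ℕ) (f : squeezedSubmodule d) :
    BddAbove (Set.range fun p : {p : Sp d // p 0 ≠ 0} =>
      |p.1 0| ^ i.1 * ‖p.1‖ ^ i.2.1 * ‖iteratedFDeriv ℝ i.2.2 (f : Sp d → ℂ) p.1‖) := by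
  obtain ⟨C, hC⟩ := f.2.2 i.1 i.2.1 i.2.2
  exact ⟨C, by rintro _ ⟨p, rfl⟩; exact hC p.1 p.2⟩

/-- The seminorms `f ↦ sup_{p⁺ ≠ 0} |p⁺|ᵃ ‖p‖ˡ ‖Dʲ f(p)‖`, `a ∈ ℤ`, `l, j ∈ ℕ`, on
`𝓢_{p⁺}(ℝⁿ)`. -/
def squeezedSeminorm (d : ℕ) (i : ℤ × ℕ × ℕ) : Seminorm ℂ (squeezedSubmodule d) :=
  Seminorm.of
    (fun f => ⨆ p : {p : Sp d // p 0 ≠ 0},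
      |p.1 0| ^ i.1 * ‖p.1‖ ^ i.2.1 * ‖iteratedFDeriv ℝ i.2.2 (f : Sp d → ℂ) p.1‖)
    (fun f g => by
      refine Real.iSup_le (fun p => ?_) (add_nonneg ?_ ?_)
      · refine le_trans ?_ (add_le_add (le_ciSup (squeezed_bddAbove i f) p)
          (le_ciSup (squeezed_bddAbove i g) p))
        rw [Submodule.coe_add, iteratedFDeriv_add_apply
          (f.2.1.contDiffAt.of_le (by exact_mod_cast le_top))
          (g.2.1.contDiffAt.of_le (by exact_mod_cast le_top)), ← mul_add]
        gcongr
        exact norm_add_le _ _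
      all_goals exact Real.iSup_nonneg fun p => by positivity)
    (fun c f => by
      rw [Real.mul_iSup_of_nonneg (norm_nonneg c)]
      congr 1
      ext p
      rw [Submodule.coe_smul, iteratedFDeriv_const_smul_apply
        (f.2.1.contDiffAt.of_le (by exact_mod_cast le_top)), norm_smul, mul_left_comm])

/-- The squeezed Schwartz space `𝓢_{p⁺}(ℝⁿ)`. -/
def SqueezedSpace (d : ℕ) : Type := squeezedSubmodule d

instance (d : ℕ) : AddCommGroup (SqueezedSpace d) :=
  inferInstanceAs (AddCommGroup (squeezedSubmodule d))

instance (d : ℕ) : Module ℂ (SqueezedSpace d) :=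
  inferInstanceAs (Module ℂ (squeezedSubmodule d))

/-- The locally convex topology of `𝓢_{p⁺}(ℝⁿ)`, generated by these seminorms. -/
instance squeezedTopology (d : ℕ) : TopologicalSpace (SqueezedSpace d) :=
  (SeminormFamily.moduleFilterBasis (𝕜 := ℂ) (F := SqueezedSpace d) (squeezedSeminorm d)).topology

/-- `𝓢'_{p⁺}(ℝⁿ)`, the squeezed generalized functions. -/
abbrev SqueezedDist (d : ℕ) : Type := SqueezedSpace d →Lₚₜ[ℂ] ℂ

/-- The function underlying an element of `𝓢(ℝⁿ)`. -/
def cSchwartz {d : ℕ} (f : 𝓢(Sp d, ℂ)) : Sp d → ℂ := f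

/-- The function underlying an element of `𝓢_{∂₋}(ℝⁿ)`. -/
def cTame {d : ℕ} (f : tameSpace d) : Sp d → ℂ := (f : 𝓢(Sp d, ℂ))

/-- The function underlying an element of `𝓢_{p⁺}(ℝⁿ)`. -/
def cSqueezed {d : ℕ} (f : SqueezedSpace d) : Sp d → ℂ := Subtype.val f

/-- The product `M b ∈ 𝓢'_{p⁺}(ℝⁿ)` of `b ∈ 𝓢'_{p⁺}(ℝⁿ)` with a multiplicator `M`:
`(M b, f) = (b, M f)`.  The values of `M` on `{p⁺ = 0}`, where every `f ∈ 𝓢_{p⁺}(ℝⁿ)` vanishes,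
are irrelevant.  Multiplicators (functions `M` with `M f ∈ 𝓢_{p⁺}` for all `f ∈ 𝓢_{p⁺}`) include
`|p⁺|ᵏ` for `k ∈ ℤ` and the Heaviside functions `Θ(±p⁺)`. -/
def sqMul {d : ℕ} (M : Sp d → ℂ) (b : SqueezedDist d) : SqueezedDist d :=
  PointwiseConvergenceCLM.precomp ℂ
    (inducedCLM cSqueezed cSqueezed fun f p => M p * f p : SqueezedSpace d →L[ℂ] SqueezedSpace d) b

/-! ### Fourier transforms -/

/-- Multiplication by `(2π)⁻¹` on `ℝⁿ`. -/
def scale (d : ℕ) : Sp d ≃L[ℝ] Sp d :=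
  ContinuousLinearEquiv.smulLeft (Units.mk0 (2 * Real.pi)⁻¹ (by positivity))

/-- The Fourier transform `f^(p) = ∫ f(x) exp(-i x·p) dx` on `𝓢(ℝⁿ)`. -/
def fourierS {d : ℕ} : 𝓢(Sp d, ℂ) →L[ℂ] 𝓢(Sp d, ℂ) :=
  SchwartzMap.compCLMOfContinuousLinearEquiv ℂ (scale d) ∘L
    FourierTransform.fourierCLM ℂ 𝓢(Sp d, ℂ)

theorem fourierS_apply {d : ℕ} (f : 𝓢(Sp d, ℂ)) (p : Sp d) :
    fourierS f p = ∫ x : Sp d, Complex.exp (-Complex.I * (∑ i, x i * p i : ℝ)) * f x := by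
  change 𝓕 f (scale d p) = _
  rw [SchwartzMap.fourier_coe, Real.fourier_eq']
  refine integral_congr_ae (Filter.Eventually.of_forall fun x => ?_)
  have h1 : inner ℝ x (scale d p) = (2 * Real.pi)⁻¹ * ∑ i, x i * p i := by
    change inner ℝ x ((2 * Real.pi)⁻¹ • p) = _
    rw [real_inner_smul_right, PiLp.inner_apply]
    simp [mul_comm]
  simp only [smul_eq_mul, h1]
  congr 2
  push_cast
  have : (Real.pi : ℂ) ≠ 0 := by exact_mod_cast Real.pi_ne_zero
  field_simp

/-- The Fourier transform on `𝓢'(ℝⁿ)`: `(u^, f) = (u, f^)`. -/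
def fourierT {d : ℕ} (u : 𝓢'(Sp d, ℂ)) : 𝓢'(Sp d, ℂ) :=
  PointwiseConvergenceCLM.precomp ℂ fourierS u

/-- `x⁻ p⁺ - x_⊥ · p_⊥` for `x = (x_⊥, x⁻)` and `p = (p⁺, p_⊥)`. -/
def lcPairing {d : ℕ} (x p : Sp d) : ℝ :=
  x (Fin.last d) * p 0 - ∑ i : Fin d, x i.castSucc * p i.succ

/-- The transposed light-cone Fourier transform
`g ↦ (x ↦ ∫ g(p) exp(i (x⁻ p⁺ - x_⊥ · p_⊥)) dp)`, which maps `𝓢_{p⁺}(ℝⁿ)` to `𝓢_{∂₋}(ℝⁿ)`. -/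
def lcFourierTranspose (d : ℕ) : SqueezedSpace d →L[ℂ] tameSpace d :=
  inducedCLM cSqueezed cTame fun g x =>
    ∫ p : Sp d, Complex.exp (Complex.I * (lcPairing x p : ℝ)) * g p

/-- The light-cone Fourier transform `𝓢'_{∂₋}(ℝⁿ) → 𝓢'_{p⁺}(ℝⁿ)`: the canonical extension of
`f ↦ (p ↦ ∫ f(x) exp(i (x⁻ p⁺ - x_⊥ · p_⊥)) dx)`. -/
def lcFourier {d : ℕ} (u : TameDist d) : SqueezedDist d :=
  PointwiseConvergenceCLM.precomp ℂ (lcFourierTranspose d) u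

/-! ### Mass hyperboloid, light-cone coordinates and the squeezing maps -/

/-- `ω(p) = √(p² + m²)`. -/
def omega {d : ℕ} (m : ℝ) (p : Sp d) : ℝ := √(‖p‖ ^ 2 + m ^ 2)

theorem omega_pos {d : ℕ} {m : ℝ} (hm : 0 < m) (p : Sp d) : 0 < omega m p :=
  Real.sqrt_pos.2 (by positivity)

theorem omega_rpow_hasTemperateGrowth {d : ℕ} {m : ℝ} (hm : 0 < m) (r : ℝ) :
    (fun p : Sp d => ((omega m p ^ r : ℝ) : ℂ)).HasTemperateGrowth := by
  have h1 : (fun p : Sp d => (1 + ‖(m⁻¹ • ContinuousLinearMap.id ℝ (Sp d)) p‖ ^ 2) ^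
      (r / 2)).HasTemperateGrowth :=
    (Function.hasTemperateGrowth_one_add_norm_sq_rpow (Sp d) (r / 2)).comp
      (m⁻¹ • ContinuousLinearMap.id ℝ (Sp d)).hasTemperateGrowth
  have h2 := Function.HasTemperateGrowth.comp Function.Complex.hasTemperateGrowth_ofReal
    ((Function.HasTemperateGrowth.const (E := Sp d) (m ^ r)).mul h1)
  have key : (fun p : Sp d => ((omega m p ^ r : ℝ) : ℂ)) = Complex.ofReal ∘ ((fun _ => m ^ r) *
      fun p : Sp d => (1 + ‖(m⁻¹ • ContinuousLinearMap.id ℝ (Sp d)) p‖ ^ 2) ^ (r / 2)) := by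
    ext p
    have : omega m p = m * (1 + ‖m⁻¹ • p‖ ^ 2) ^ (1 / 2 : ℝ) := by
      rw [omega, ← Real.sqrt_eq_rpow]
      have h : ‖p‖ ^ 2 + m ^ 2 = m ^ 2 * (1 + ‖m⁻¹ • p‖ ^ 2) := by
        rw [norm_smul, Real.norm_of_nonneg (by positivity)]
        field_simp
        ring
      rw [h, Real.sqrt_mul (by positivity), Real.sqrt_sq hm.le]
    simp only [this, Function.comp]
    rw [Real.mul_rpow hm.le (by positivity), ← Real.rpow_mul (by positivity)]
    congr 2
    change _ = (1 + ‖m⁻¹ • p‖ ^ 2) ^ (r / 2)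
    congr 1
    ring
  rw [key]
  exact h2

theorem omega_hasTemperateGrowth {d : ℕ} {m : ℝ} (hm : 0 < m) :
    (fun p : Sp d => (omega m p : ℂ)).HasTemperateGrowth := by
  simpa using omega_rpow_hasTemperateGrowth (d := d) hm 1

theorem one_div_omega_hasTemperateGrowth {d : ℕ} {m : ℝ} (hm : 0 < m) :
    (fun p : Sp d => ((1 / omega m p : ℝ) : ℂ)).HasTemperateGrowth := by
  simpa [Real.rpow_neg_one] using omega_rpow_hasTemperateGrowth (d := d) hm (-1)

/-- `ω̃(p) = (p_⊥² + m²) / (2 p⁺)` for `p = (p⁺, p_⊥)`, `p⁺ ≠ 0`. -/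
def omegaLC {d : ℕ} (m : ℝ) (p : Sp d) : ℝ :=
  (∑ i : Fin d, p i.succ ^ 2 + m ^ 2) / (2 * p 0)

/-- `Ω̃(p) = (p, ω̃(p)) = (p⁺, p_⊥, p⁻)`, the parametrization of the light-cone mass hyperboloid
`2 p⁺ p⁻ - p_⊥² = m²` by `{p⁺ ≠ 0}`. -/
def OmegaLC {d : ℕ} (m : ℝ) (p : Sp d) : ST d :=
  WithLp.toLp 2 (Fin.snoc (α := fun _ => ℝ) (fun i => p i) (omegaLC m p))

/-- The transformation to light-cone coordinates:
`x⁺ = (x⁰ + xⁿ)/√2`, `x_⊥ = (x¹, …, xⁿ⁻¹)`, `x⁻ = (x⁰ - xⁿ)/√2`. -/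
def kappaFun {d : ℕ} (x : ST d) : ST d :=
  WithLp.toLp 2 fun i =>
    if i = 0 then (x 0 + x (Fin.last _)) / √2
    else if i = Fin.last _ then (x 0 - x (Fin.last _)) / √2
    else x i

theorem kappaFun_involutive {d : ℕ} : Function.Involutive (kappaFun (d := d)) := by
  intro x
  have h2 : √(2 : ℝ) * √2 = 2 := Real.mul_self_sqrt (by norm_num)
  have h0 : √(2 : ℝ) ≠ 0 := by positivity
  have hl : Fin.last (d + 1) ≠ 0 := Fin.last_pos.ne'
  ext i
  by_cases hi : i = 0
  · subst hi
    simp only [kappaFun, if_true, hl, if_false]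
    field_simp
    linear_combination (-x 0) * h2
  · by_cases hi' : i = Fin.last _
    · subst hi'
      simp only [kappaFun, if_true, hl, if_false]
      field_simp
      linear_combination (-x (Fin.last _)) * h2
    · simp [kappaFun, hi, hi']

/-- The transformation to light-cone coordinates `κ : ℝ¹⁺ⁿ → ℝ¹⁺ⁿ` as a linear equivalence. -/
def kappa (d : ℕ) : ST d ≃L[ℝ] ST d :=
  LinearEquiv.toContinuousLinearEquiv <|
    LinearEquiv.ofInvolutive
      { toFun := kappaFun
        map_add' := fun x y => by
          ext i
          simp only [kappaFun, PiLp.add_apply]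
          split_ifs <;> ring
        map_smul' := fun c x => by
          ext i
          simp only [kappaFun, PiLp.smul_apply, smul_eq_mul, RingHom.id_apply]
          split_ifs <;> ring }
      kappaFun_involutive

@[simp] theorem kappa_apply {d : ℕ} (x : ST d) : kappa d x = kappaFun x := rfl

/-- The squeezing mapping `ν = Ω_±⁻¹ ∘ κ⁻¹ ∘ Ω̃`: it sends `p = (p⁺, p_⊥)`, `±p⁺ > 0`, to the
spatial part of the point `κ⁻¹(p, ω̃(p))` of the mass hyperboloid `{p⁰ = ±ω}`. -/
def nu {d : ℕ} (m : ℝ) (p : Sp d) : Sp d := tail ((kappa d).symm (OmegaLC m p))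

/-- The inverses `μ_{≷0} : ℝⁿ → {±p⁺ > 0}` (`σ = ±1`) of the squeezing mappings:
`p ↦ (p⁺, p_⊥) = ((pⁿ ± ω(p))/√2, p¹, …, pⁿ⁻¹)`. -/
def mu {d : ℕ} (m σ : ℝ) (p : Sp d) : Sp d :=
  WithLp.toLp 2 (Fin.cons (α := fun _ => ℝ) ((p (Fin.last d) + σ * omega m p) / √2)
    (fun i => p i.castSucc))

/-- The pullback `ν*_{≷0} : 𝓢'(ℝⁿ) → 𝓢'_{p⁺≷0}(ℝⁿ) ⊆ 𝓢'_{p⁺}(ℝⁿ)` (`σ = ±1`), the extension of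
`a ↦ a ∘ ν` (extended by zero): `(ν* a, f) = (a, |det Dμ| (f ∘ μ))` with `μ = ν⁻¹`. -/
def nuPull {d : ℕ} (m σ : ℝ) (a : 𝓢'(Sp d, ℂ)) : SqueezedDist d :=
  PointwiseConvergenceCLM.precomp ℂ
    (inducedCLM cSqueezed cSchwartz fun f p =>
      (|(fderiv ℝ (mu m σ) p).det| : ℝ) * f (mu m σ p) : SqueezedSpace d →L[ℂ] 𝓢(Sp d, ℂ)) a

open Classical in
/-- The pullback `μ*_{≷0} : 𝓢'_{p⁺≷0}(ℝⁿ) → 𝓢'(ℝⁿ)` (`σ = ±1`), the extension of `b ↦ b ∘ μ`: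
`(μ* b, g) = (b, |det Dν| (g ∘ ν))`, where `|det Dν| (g ∘ ν)` on `{±p⁺ > 0}` is extended by zero. -/
def muPull {d : ℕ} (m σ : ℝ) (b : SqueezedDist d) : 𝓢'(Sp d, ℂ) :=
  PointwiseConvergenceCLM.precomp ℂ
    (inducedCLM cSchwartz cSqueezed fun g p =>
      if 0 < σ * p 0 then (|(fderiv ℝ (nu m) p).det| : ℝ) * g (nu m p) else 0 :
      𝓢(Sp d, ℂ) →L[ℂ] SqueezedSpace d) b

/-! ### Tensor products of test functions -/

theorem norm_le_tail {k : ℕ} (x : EuclideanSpace ℝ (Fin (k + 1))) :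
    ‖x‖ ≤ (1 + ‖x 0‖) * (1 + ‖tail x‖) := by
  have h : ‖x‖ ^ 2 = ‖x 0‖ ^ 2 + ‖tail x‖ ^ 2 := by
    rw [EuclideanSpace.norm_sq_eq, EuclideanSpace.norm_sq_eq, Fin.sum_univ_succ]
    simp
  have h0 := norm_nonneg (x 0)
  have h1 := norm_nonneg (tail x)
  refine le_of_sq_le_sq ?_ (by positivity)
  rw [h]
  nlinarith [mul_nonneg h0 h1, mul_nonneg (mul_nonneg h0 h1) (mul_nonneg h0 h1),
    mul_nonneg (mul_nonneg h0 h1) h0, mul_nonneg (mul_nonneg h0 h1) h1]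

/-- A Schwartz function composed with a linear map `L`, weighted by `(1 + ‖L x‖)ᵏ`. -/
theorem comp_bound {D E : Type*} [NormedAddCommGroup D] [NormedSpace ℝ D] [NormedAddCommGroup E]
    [NormedSpace ℝ E] (f : 𝓢(E, ℂ)) (L : D →L[ℝ] E) (k j : ℕ) :
    ∃ C : ℝ, 0 ≤ C ∧ ∀ x : D, (1 + ‖L x‖) ^ k * ‖iteratedFDeriv ℝ j (fun y => f (L y)) x‖ ≤ C := by
  refine ⟨2 ^ k * ((Finset.Iic (k, j)).sup (fun m => SchwartzMap.seminorm ℝ m.1 m.2) f) *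
    ‖L‖ ^ j, by positivity, fun x => ?_⟩
  have h1 := SchwartzMap.one_add_le_sup_seminorm_apply (𝕜 := ℝ) (m := (k, j)) le_rfl le_rfl f (L x)
  have h2 : ‖iteratedFDeriv ℝ j (fun y => f (L y)) x‖ ≤ ‖iteratedFDeriv ℝ j f (L x)‖ * ‖L‖ ^ j := by
    have := L.iteratedFDeriv_comp_right (f := f) (f.smooth ⊤) x (i := j) (by exact_mod_cast le_top)
    change ‖iteratedFDeriv ℝ j (f ∘ L) x‖ ≤ _
    rw [this]
    refine (ContinuousMultilinearMap.norm_compContinuousLinearMap_le _ _).trans ?_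
    simp
  calc _ ≤ (1 + ‖L x‖) ^ k * (‖iteratedFDeriv ℝ j f (L x)‖ * ‖L‖ ^ j) := by gcongr
    _ = ((1 + ‖L x‖) ^ k * ‖iteratedFDeriv ℝ j f (L x)‖) * ‖L‖ ^ j := by ring
    _ ≤ _ := by gcongr

/-- `(f ⊗ g)(x⁰, x¹, …, xᵏ) = f(x⁰) g(x¹, …, xᵏ)`. -/
def tensor {k : ℕ} (f : 𝓢(ℝ, ℂ)) (g : 𝓢(EuclideanSpace ℝ (Fin k), ℂ)) :
    𝓢(EuclideanSpace ℝ (Fin (k + 1)), ℂ) where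
  toFun x := f (x 0) * g (tail x)
  smooth' := ((f.smooth ⊤).comp (EuclideanSpace.proj (𝕜 := ℝ) (0 : Fin (k + 1))).contDiff).mul
    ((g.smooth ⊤).comp tail.contDiff)
  decay' l n := by
    let P : EuclideanSpace ℝ (Fin (k + 1)) →L[ℝ] ℝ := EuclideanSpace.proj 0
    choose A hA0 hA using comp_bound f P l
    choose B hB0 hB using comp_bound g (tail (k := k)) l
    refine ⟨∑ i ∈ Finset.range (n + 1), (n.choose i : ℝ) * A i * B (n - i), fun x => ?_⟩
    have hf : ContDiff ℝ ∞ (fun y => f (P y)) := (f.smooth ⊤).comp P.contDiff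
    have hg : ContDiff ℝ ∞ (fun y : EuclideanSpace ℝ (Fin (k + 1)) => g (tail y)) :=
      (g.smooth ⊤).comp tail.contDiff
    have h1 := norm_iteratedFDeriv_mul_le hf hg x (n := n) (by exact_mod_cast le_top)
    have h2 : ‖x‖ ^ l ≤ (1 + ‖P x‖) ^ l * (1 + ‖tail x‖) ^ l := by
      rw [← mul_pow]
      exact pow_le_pow_left₀ (norm_nonneg _) (norm_le_tail x) l
    refine (mul_le_mul h2 h1 (norm_nonneg _) (by positivity)).trans ?_
    rw [Finset.mul_sum]
    refine Finset.sum_le_sum fun i _ => ?_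
    calc _ = (n.choose i : ℝ) * ((1 + ‖P x‖) ^ l * ‖iteratedFDeriv ℝ i (fun y => f (P y)) x‖) *
          ((1 + ‖tail x‖) ^ l * ‖iteratedFDeriv ℝ (n - i) (fun y => g (tail y)) x‖) := by ring
      _ ≤ _ := by
        gcongr
        · exact mul_nonneg (by positivity) (hA0 i)
        · exact hA i x
        · exact hB (n - i) x

@[simp] theorem tensor_apply {k : ℕ} (f : 𝓢(ℝ, ℂ)) (g : 𝓢(EuclideanSpace ℝ (Fin k), ℂ))
    (x : EuclideanSpace ℝ (Fin (k + 1))) : tensor f g x = f (x 0) * g (tail x) := rfl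

theorem lineDeriv_tensor {k : ℕ} (f : 𝓢(ℝ, ℂ)) (h : 𝓢(EuclideanSpace ℝ (Fin (k + 1)), ℂ)) :
    ∂_{e (Fin.last (k + 1))} (tensor f h) = tensor f (∂_{e (Fin.last k)} h) := by
  ext x
  rw [SchwartzMap.lineDerivOp_apply_eq_fderiv, tensor_apply,
    SchwartzMap.lineDerivOp_apply_eq_fderiv]
  let P : EuclideanSpace ℝ (Fin (k + 2)) →L[ℝ] ℝ := EuclideanSpace.proj 0
  have hf : HasFDerivAt (fun y => f (P y)) ((fderiv ℝ f (P x)).comp P) x :=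
    (f.hasFDerivAt (P x)).comp x P.hasFDerivAt
  have hh : HasFDerivAt (fun y : EuclideanSpace ℝ (Fin (k + 2)) => h (tail y))
      ((fderiv ℝ h (tail x)).comp tail) x :=
    (h.hasFDerivAt (tail x)).comp x tail.hasFDerivAt
  have hP : P (e (Fin.last (k + 1))) = 0 := by
    simp [P, e]
  have ht : tail (e (Fin.last (k + 1))) = e (Fin.last k) := by
    ext i
    simp [e, ← Fin.succ_last]
  have := (hf.mul hh).fderiv
  change fderiv ℝ ((fun y => f (P y)) * fun y => h (tail y)) x _ = _
  rw [this]
  simp [hP, ht, P]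

theorem tensor_mem_tameSpace {k : ℕ} (f : 𝓢(ℝ, ℂ)) (g : tameSpace k) :
    tensor f (g : 𝓢(EuclideanSpace ℝ (Fin (k + 1)), ℂ)) ∈ tameSpace (k + 1) := by
  intro m
  obtain ⟨h, hh⟩ := g.2 m
  refine ⟨tensor f h, ?_⟩
  rw [hh]
  clear hh
  induction m with
  | zero => simp
  | succ m ih =>
    rw [iteratedLineDerivOp_succ_left, iteratedLineDerivOp_succ_left, ← lineDeriv_tensor]
    exact congrArg _ ih

/-- `f ⊗ g ∈ 𝓢_{∂₋}(ℝ¹⁺ⁿ)` for `g ∈ 𝓢_{∂₋}(ℝⁿ)`. -/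
def tameTensor {k : ℕ} (f : 𝓢(ℝ, ℂ)) (g : tameSpace k) : tameSpace (k + 1) :=
  ⟨tensor f g, tensor_mem_tameSpace f g⟩

/-! ### Restrictions to hyperplanes -/

/-- `u|_{x⁰ = 0} = v`: the tempered distribution `u` on `ℝ¹⁺ⁿ` depends smoothly on the parameter
`x⁰ ∈ ℝ`, i.e. there is a family `(U_t)_{t ∈ ℝ}` in `𝓢'(ℝⁿ)` such that `t ↦ (U_t, g)` is `C^∞` and
`(u, f ⊗ g) = ∫ (U_t, g) f(t) dt`, and `v = U_0`. -/
def IsRestriction {d : ℕ} (u : 𝓢'(ST d, ℂ)) (v : 𝓢'(Sp d, ℂ)) : Prop :=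
  ∃ U : ℝ → 𝓢'(Sp d, ℂ),
    (∀ g : 𝓢(Sp d, ℂ), ContDiff ℝ ∞ fun t => U t g) ∧
    (∀ (f : 𝓢(ℝ, ℂ)) (g : 𝓢(Sp d, ℂ)), Integrable (fun t => U t g * f t) ∧
      u (tensor f g) = ∫ t, U t g * f t) ∧
    U 0 = v

/-- The tame generalized function `u` on `ℝ¹⁺ⁿ` is `C^∞`-dependent on the parameter `x⁺ ∈ Ω`, with
family `(U_t)_{t ∈ Ω}` in `𝓢'_{∂₋}(ℝⁿ)`. -/
def IsSmoothFamilyOn {d : ℕ} (u : TameDist (d + 1)) (Ω : Set ℝ) (U : ℝ → TameDist d) : Prop :=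
  (∀ g : tameSpace d, ContDiffOn ℝ ∞ (fun t => U t g) Ω) ∧
  ∀ (f : 𝓢(ℝ, ℂ)) (g : tameSpace d), HasCompactSupport f → tsupport f ⊆ Ω →
    u (tameTensor f g) = ∫ t in Ω, U t g * f t

/-- `u|*_{x⁺ = 0} = v`: the relaxation of `u` is `C^∞`-dependent on `x⁺` in an open neighbourhood of
`0`, and `v` is the member at `x⁺ = 0` of the corresponding family. -/
def IsTameRestriction {d : ℕ} (u : 𝓢'(ST d, ℂ)) (v : TameDist d) : Prop :=
  ∃ (Ω : Set ℝ) (U : ℝ → TameDist d), IsOpen Ω ∧ 0 ∈ Ω ∧ IsSmoothFamilyOn (relax u) Ω U ∧ U 0 = v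

/-! ### The two Cauchy problems -/

/-- The Klein–Gordon operator `□ + m²`, `□ = ∂₀² - ∑_{i=1}^n ∂ᵢ²`. -/
def kleinGordon {d : ℕ} (m : ℝ) (u : 𝓢'(ST d, ℂ)) : 𝓢'(ST d, ℂ) :=
  ∂_{(e 0 : ST d)} (∂_{(e 0 : ST d)} u)
    - ∑ i : Fin (d + 1), ∂_{(e i.succ : ST d)} (∂_{(e i.succ : ST d)} u) + ((m ^ 2 : ℝ) : ℂ) • u

/-- The light-cone Klein–Gordon operator `□̃ + m²`, `□̃ = 2 ∂₊ ∂₋ - ∑_{i=1}^{n-1} ∂ᵢ²`. -/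
def lcKleinGordon {d : ℕ} (m : ℝ) (u : 𝓢'(ST d, ℂ)) : 𝓢'(ST d, ℂ) :=
  (2 : ℂ) • ∂_{(e 0 : ST d)} (∂_{(e (Fin.last (d + 1)) : ST d)} u)
    - ∑ i : Fin d, ∂_{(e i.castSucc.succ : ST d)} (∂_{(e i.castSucc.succ : ST d)} u)
    + ((m ^ 2 : ℝ) : ℂ) • u

/-- `u` solves `(□ + m²) u = 0`, `u|_{x⁰=0} = u₀`, `∂₀ u|_{x⁰=0} = u₁`. -/
structure SolvesCauchy {d : ℕ} (m : ℝ) (u₀ u₁ : 𝓢'(Sp d, ℂ)) (u : 𝓢'(ST d, ℂ)) : Prop where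
  equation : kleinGordon m u = 0
  initial : IsRestriction u u₀
  initial_deriv : IsRestriction (∂_{(e 0 : ST d)} u) u₁

/-- `u` solves `(□̃ + m²) u = 0`, `u|*_{x⁺=0} = v₀`. -/
structure SolvesCharCauchy {d : ℕ} (m : ℝ) (v₀ : TameDist d) (u : 𝓢'(ST d, ℂ)) : Prop where
  equation : lcKleinGordon m u = 0
  initial : IsTameRestriction u v₀

/-- `u ∘ A` for a distribution `u` and a linear isomorphism `A`:
`(u ∘ A, f) = |det A|⁻¹ (u, f ∘ A⁻¹)`. -/
def distComp {d : ℕ} (u : 𝓢'(ST d, ℂ)) (A : ST d ≃L[ℝ] ST d) : 𝓢'(ST d, ℂ) :=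
  ((|(A : ST d →L[ℝ] ST d).det|⁻¹ : ℝ) : ℂ) •
    PointwiseConvergenceCLM.precomp ℂ (SchwartzMap.compCLMOfContinuousLinearEquiv ℂ A.symm) u

/-! ### The transformation laws between the initial data -/

/-- The product of `u ∈ 𝓢'(ℝⁿ)` with a smooth function `M` of temperate growth. -/
def tMul {d : ℕ} (M : Sp d → ℂ) (u : 𝓢'(Sp d, ℂ)) : 𝓢'(Sp d, ℂ) :=
  TemperedDistribution.smulLeftCLM ℂ M u

/-- `v₀^ = (1/(2|p⁺|)) (ν*_{>0}(ω u₀^ + i u₁^) + ν*_{<0}(ω u₀^ - i u₁^))`. -/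
def LawToTame {d : ℕ} (m : ℝ) (u₀ u₁ : 𝓢'(Sp d, ℂ)) (v₀ : TameDist d) : Prop :=
  lcFourier v₀ = sqMul (fun p => ((1 / (2 * |p 0|) : ℝ) : ℂ))
    (nuPull m 1 (tMul (fun p => (omega m p : ℂ)) (fourierT u₀) + Complex.I • fourierT u₁) +
      nuPull m (-1) (tMul (fun p => (omega m p : ℂ)) (fourierT u₀) - Complex.I • fourierT u₁))

open Classical in
/-- The function `|p⁺| Θ(σ p⁺)`. -/
def absTheta {d : ℕ} (σ : ℝ) (p : Sp d) : ℂ := if 0 < σ * p 0 then (|p 0| : ℝ) else 0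

/-- `u₀^ = (1/ω) (μ*_{>0}(|p⁺| Θ(p⁺) v₀^) + μ*_{<0}(|p⁺| Θ(-p⁺) v₀^))`. -/
def LawFromTame₀ {d : ℕ} (m : ℝ) (u₀ : 𝓢'(Sp d, ℂ)) (v₀ : TameDist d) : Prop :=
  fourierT u₀ = tMul (fun p => ((1 / omega m p : ℝ) : ℂ))
    (muPull m 1 (sqMul (absTheta 1) (lcFourier v₀)) +
      muPull m (-1) (sqMul (absTheta (-1)) (lcFourier v₀)))

/-- `u₁^ = (1/i) (μ*_{>0}(|p⁺| Θ(p⁺) v₀^) - μ*_{<0}(|p⁺| Θ(-p⁺) v₀^))`. -/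
def LawFromTame₁ {d : ℕ} (m : ℝ) (u₁ : 𝓢'(Sp d, ℂ)) (v₀ : TameDist d) : Prop :=
  fourierT u₁ = (1 / Complex.I) •
    (muPull m 1 (sqMul (absTheta 1) (lcFourier v₀)) -
      muPull m (-1) (sqMul (absTheta (-1)) (lcFourier v₀)))

end CharCauchy

end

/-! Everything reduces to a pair of amplitudes. Taking the Fourier transform with phase `exp(-i(k⁰x⁰
- 𝐤·𝐱))`, the Klein–Gordon operator becomes multiplication by `ω² - (k⁰)²`. A Schwartz function
vanishing on both mass shells `k⁰ = ±ω` is this symbol times a Schwartz function, so a tempered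
solution `u` only sees the restrictions of the transformed test function to the shells: `u F = a (F̂
on the upper shell) + b (F̂ on the lower shell)` with `a, b ∈ 𝓢'(ℝⁿ)` (`exists_amplitudes`).
Divisibility by the symbol rests on two facts: a Schwartz function whose integrals along all
parallel lines vanish has a Schwartz primitive in that direction (`exists_lineDeriv_eq`), and shears
straighten the shells into hyperplanes.

Restricting to `x⁰ = t` multiplies the amplitudes by `exp(∓iωt)`. At `t = 0` this gives `û₀ = a + b`
and `û₁ = -iω(a - b)`, an invertible linear system whose solution is `amplitude`
(`initial_iff_amplitude`). Restricting to `x⁺ = t` in light-cone coordinates multiplies them by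
`exp(-itp⁻)`, where `p⁻ = (±ω - pⁿ)/√2`, and at `t = 0` the light-cone transform of the tame datum
is `f ↦ a (f ∘ μ₊) + b (f ∘ μ₋)` (`isTameRestriction_iff`).

The map `f ↦ (f ∘ μ₊, f ∘ μ₋)` is an isomorphism from the squeezed space onto two copies of `𝓢(ℝⁿ)`,
with inverse given by `ν` on the half-spaces `±p⁺ > 0` (`compMu_compNu`, `compMu_compNu_neg`,
`compNu_compMu_add`). Because `m > 0`, the weight `(1 + ‖q‖)(1 + 1/|q⁺|)` and `1 + ‖ν q‖` are
bounded by powers of each other, so the two notions of rapid decay correspond. Hence the single tame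
datum encodes both amplitudes. Since `|det Dμ| = |p⁺|/ω`, the factors `ω` and `|p⁺|` in the
transformation laws are exactly those that turn them into this encoding of `amplitude` and its
inverse.

Equivalence of the problems and both uniqueness claims follow by comparing amplitudes. The
light-cone transform itself causes no loss: it exchanges `∂₋` with `ip⁺`, so tame functions
correspond to Schwartz functions flat on `p⁺ = 0`, which are the squeezed ones. -/

noncomputable section

namespace CharCauchy

/-! ### Primitives of Schwartz functions along a line -/

section Primitive

variable {E F : Type} [NormedAddCommGroup E] [InnerProductSpace ℝ E]
  [NormedAddCommGroup F] [NormedSpace ℝ F]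

theorem schwartz_decay_one_add (H : 𝓢(E, F)) (k j : ℕ) :
    ∃ C : ℝ, 0 ≤ C ∧ ∀ x, (1 + ‖x‖) ^ k * ‖iteratedFDeriv ℝ j H x‖ ≤ C :=
  ⟨_, by positivity,
    fun x => SchwartzMap.one_add_le_sup_seminorm_apply (𝕜 := ℝ) (m := (k, j)) le_rfl le_rfl H x⟩

/-- The bound is uniform for `x` in a ball, so it serves as an integrable majorant when
differentiating line integrals in `x`. Decay of order two suffices, because `1 + |s| ≤ (1 + r)(1 +
‖x + s • v‖)`. -/
theorem schwartz_line_bound (H : 𝓢(E, F)) {v : E} (hv : ‖v‖ = 1) (r : ℝ) :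
    ∃ C : ℝ, ∀ x : E, ‖x‖ ≤ r → ∀ s : ℝ, ‖H (x + s • v)‖ ≤ C * (1 + s ^ 2)⁻¹ := by
  obtain ⟨C, hC0, hC⟩ := schwartz_decay_one_add H 2 0
  refine ⟨C * (1 + r) ^ 2, fun x hx s => ?_⟩
  have h1 := hC (x + s • v)
  rw [norm_iteratedFDeriv_zero] at h1
  have hs : ‖s • v‖ = |s| := by rw [norm_smul, hv, mul_one, Real.norm_eq_abs]
  have h2 : |s| ≤ ‖x + s • v‖ + ‖x‖ := by
    rw [← hs]
    simpa using norm_sub_le (x + s • v) x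
  have h3 : 1 + s ^ 2 ≤ ((1 + r) * (1 + ‖x + s • v‖)) ^ 2 := by
    have : 1 + |s| ≤ (1 + r) * (1 + ‖x + s • v‖) := by
      nlinarith [norm_nonneg x, norm_nonneg (x + s • v),
        mul_nonneg ((norm_nonneg x).trans hx) (norm_nonneg (x + s • v))]
    calc 1 + s ^ 2 ≤ (1 + |s|) ^ 2 := by nlinarith [abs_nonneg s, sq_abs s]
      _ ≤ _ := by gcongr
  rw [← div_eq_mul_inv, le_div_iff₀ (by positivity)]
  calc _ ≤ ‖H (x + s • v)‖ * ((1 + r) * (1 + ‖x + s • v‖)) ^ 2 := by gcongr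
    _ = (1 + r) ^ 2 * ((1 + ‖x + s • v‖) ^ 2 * ‖H (x + s • v)‖) := by ring
    _ ≤ (1 + r) ^ 2 * C := by gcongr
    _ = _ := by ring

theorem schwartz_line_integrable (H : 𝓢(E, F)) {v : E} (hv : ‖v‖ = 1) (x : E) :
    Integrable fun s : ℝ => H (x + s • v) := by
  obtain ⟨C, hC⟩ := schwartz_line_bound H hv ‖x‖
  refine (integrable_inv_one_add_sq.const_mul C).mono' ?_ (Filter.Eventually.of_forall (hC x le_rfl))
  exact (H.continuous.comp (by fun_prop)).aestronglyMeasurable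

theorem hasFDerivAt_line_integral (H : 𝓢(E, F)) {v : E} (hv : ‖v‖ = 1)
    (S : Set ℝ) (x : E) :
    HasFDerivAt (fun x => ∫ s in S, H (x + s • v))
      (∫ s in S, fderivCLM ℝ E F H (x + s • v)) x := by
  obtain ⟨C, hC⟩ := schwartz_line_bound (fderivCLM ℝ E F H) hv (‖x‖ + 1)
  refine hasFDerivAt_integral_of_dominated_of_fderiv_le (Metric.ball_mem_nhds x one_pos)
    (F := fun x s => H (x + s • v)) (F' := fun x s => fderivCLM ℝ E F H (x + s • v))
    (bound := fun s => C * (1 + s ^ 2)⁻¹) (Filter.Eventually.of_forall fun y => ?_)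
    (schwartz_line_integrable H hv x).integrableOn ?_ ?_
    (integrable_inv_one_add_sq.const_mul C).integrableOn ?_
  · exact (H.continuous.comp (by fun_prop)).aestronglyMeasurable
  · exact ((fderivCLM ℝ E F H).continuous.comp (by fun_prop)).aestronglyMeasurable
  · refine Filter.Eventually.of_forall fun s y hy => hC y ?_ s
    have := norm_le_norm_add_norm_sub x y
    rw [Metric.mem_ball, dist_comm, dist_eq_norm] at hy
    linarith
  · refine Filter.Eventually.of_forall fun s y _ => ?_
    exact (hasFDerivAt_comp_add_right (s • v)).2 (H.hasFDerivAt (y + s • v))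

/-- The derivative of a line integral is the line integral of `fderivCLM ℝ E F H`, which takes
values in a new space; the codomain is therefore generalized in the induction. -/
theorem contDiff_line_integral (n : ℕ) {F : Type} [NormedAddCommGroup F] [NormedSpace ℝ F]
    (H : 𝓢(E, F)) {v : E} (hv : ‖v‖ = 1) (S : Set ℝ) :
    ContDiff ℝ n fun x => ∫ s in S, H (x + s • v) := by
  induction n generalizing F with
  | zero =>
    exact contDiff_zero.2 (continuous_iff_continuousAt.2 fun x =>
      (hasFDerivAt_line_integral H hv S x).continuousAt)
  | succ n ih =>
    rw [Nat.cast_succ, contDiff_succ_iff_fderiv]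
    refine ⟨fun x => (hasFDerivAt_line_integral H hv S x).differentiableAt, by simp, ?_⟩
    convert ih (fderivCLM ℝ E F H) using 1
    ext1 x
    exact (hasFDerivAt_line_integral H hv S x).fderiv

/-- Where `s⟨x, v⟩ ≥ 0` one has `‖x + s • v‖ ≥ ‖x‖`, so the integral over that half-line inherits
the decay of `H`. If `⟨x, v⟩ > 0` the half-line `s ≤ 0` is the wrong one, and the vanishing of the
full integral replaces it, up to sign, by `s > 0`. -/
theorem line_integral_decay_zero (H : 𝓢(E, F)) {v : E} (hv : ‖v‖ = 1)
    (h0 : ∀ x, ∫ s : ℝ, H (x + s • v) = 0) (l : ℕ) :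
    ∃ C : ℝ, ∀ x, ‖x‖ ^ l * ‖∫ s in Set.Iic (0 : ℝ), H (x + s • v)‖ ≤ C := by
  obtain ⟨C, hC0, hC⟩ := schwartz_decay_one_add H (l + 2) 0
  refine ⟨C * ∫ s : ℝ, (1 + s ^ 2)⁻¹, fun x => ?_⟩
  have key : ∀ s : ℝ, 0 ≤ s * inner ℝ x v →
      ‖x‖ ^ l * ‖H (x + s • v)‖ ≤ C * (1 + s ^ 2)⁻¹ := by
    intro s hs
    have hn : ‖x + s • v‖ ^ 2 = ‖x‖ ^ 2 + 2 * (s * inner ℝ x v) + s ^ 2 := by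
      rw [norm_add_sq_real, real_inner_smul_right, norm_smul, hv, mul_one, Real.norm_eq_abs,
        sq_abs]
    have hx : ‖x‖ ≤ 1 + ‖x + s • v‖ := by
      have : ‖x‖ ≤ ‖x + s • v‖ := by
        refine le_of_sq_le_sq ?_ (norm_nonneg _)
        nlinarith [sq_nonneg s]
      linarith
    have hs2 : 1 + s ^ 2 ≤ (1 + ‖x + s • v‖) ^ 2 := by
      nlinarith [sq_nonneg ‖x‖, norm_nonneg (x + s • v)]
    have h1 := hC (x + s • v)
    rw [norm_iteratedFDeriv_zero] at h1
    rw [← div_eq_mul_inv, le_div_iff₀ (by positivity)]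
    calc _ ≤ (1 + ‖x + s • v‖) ^ l * ‖H (x + s • v)‖ * (1 + ‖x + s • v‖) ^ 2 := by gcongr
      _ = (1 + ‖x + s • v‖) ^ (l + 2) * ‖H (x + s • v)‖ := by ring
      _ ≤ C := h1
  have fin : ∀ S : Set ℝ, MeasurableSet S → (∀ s ∈ S, 0 ≤ s * inner ℝ x v) →
      ‖x‖ ^ l * ‖∫ s in S, H (x + s • v)‖ ≤ C * ∫ s : ℝ, (1 + s ^ 2)⁻¹ := by
    intro S hS hSx
    have hi := (schwartz_line_integrable H hv x).norm
    calc _ ≤ ‖x‖ ^ l * ∫ s in S, ‖H (x + s • v)‖ := by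
          gcongr; exact norm_integral_le_integral_norm _
      _ = ∫ s in S, ‖x‖ ^ l * ‖H (x + s • v)‖ := (integral_const_mul _ _).symm
      _ ≤ ∫ s in S, C * (1 + s ^ 2)⁻¹ :=
          setIntegral_mono_on (hi.const_mul _).integrableOn
            (integrable_inv_one_add_sq.const_mul C).integrableOn hS fun s hs => key s (hSx s hs)
      _ ≤ ∫ s : ℝ, C * (1 + s ^ 2)⁻¹ :=
          setIntegral_le_integral (integrable_inv_one_add_sq.const_mul C)
            (Filter.Eventually.of_forall fun s => by positivity)
      _ = _ := integral_const_mul _ _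
  rcases le_total (inner ℝ x v) 0 with h | h
  · exact fin _ measurableSet_Iic fun s hs => mul_nonneg_of_nonpos_of_nonpos hs h
  · have h2 := integral_add_compl (μ := volume) (measurableSet_Iic (a := (0 : ℝ)))
      (schwartz_line_integrable H hv x)
    rw [h0 x] at h2
    rw [eq_neg_of_add_eq_zero_left h2, norm_neg, Set.compl_Iic]
    exact fin _ measurableSet_Ioi fun s hs => mul_nonneg (le_of_lt hs) h

/-- The vanishing of all line integrals passes to `fderivCLM ℝ E F H` by differentiation under the
integral, so the estimate of order zero can be applied to every derivative. -/
theorem line_integral_decay (j : ℕ) {F : Type} [NormedAddCommGroup F] [NormedSpace ℝ F]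
    (H : 𝓢(E, F)) {v : E} (hv : ‖v‖ = 1)
    (h0 : ∀ x, ∫ s : ℝ, H (x + s • v) = 0) (l : ℕ) :
    ∃ C : ℝ, ∀ x, ‖x‖ ^ l *
      ‖iteratedFDeriv ℝ j (fun x => ∫ s in Set.Iic (0 : ℝ), H (x + s • v)) x‖ ≤ C := by
  induction j generalizing F with
  | zero => simpa only [norm_iteratedFDeriv_zero] using line_integral_decay_zero H hv h0 l
  | succ j ih =>
    have hz : ∀ x, ∫ s : ℝ, fderivCLM ℝ E F H (x + s • v) = 0 := by
      intro x
      have h1 := hasFDerivAt_line_integral H hv Set.univ x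
      simp only [setIntegral_univ, h0] at h1
      exact h1.unique (hasFDerivAt_const _ _)
    obtain ⟨C, hC⟩ := ih (fderivCLM ℝ E F H) hz
    refine ⟨C, fun x => ?_⟩
    rw [← norm_iteratedFDeriv_fderiv]
    convert hC x using 4
    ext1 y
    exact (hasFDerivAt_line_integral H hv _ y).fderiv

/-- A Schwartz function whose integrals along all lines in the direction `v` vanish is the
derivative in the direction `v` of a Schwartz function. -/
theorem exists_lineDeriv_eq [CompleteSpace F] (H : 𝓢(E, F)) {v : E} (hv : ‖v‖ = 1)
    (h0 : ∀ x, ∫ s : ℝ, H (x + s • v) = 0) : ∃ G : 𝓢(E, F), ∂_{v} G = H := by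
  let G : 𝓢(E, F) :=
    { toFun := fun x => ∫ s in Set.Iic (0 : ℝ), H (x + s • v)
      smooth' := contDiff_infty.2 fun n => contDiff_line_integral n H hv _
      decay' := fun l j => line_integral_decay j H hv h0 l }
  refine ⟨G, ?_⟩
  ext x
  have hG : fderiv ℝ G x = _ := (hasFDerivAt_line_integral H hv (Set.Iic 0) x).fderiv
  rw [SchwartzMap.lineDerivOp_apply_eq_fderiv, hG,
    ContinuousLinearMap.integral_apply
      (schwartz_line_integrable (fderivCLM ℝ E F H) hv x).integrableOn]
  have hd : ∀ s ∈ Set.Iic (0 : ℝ), HasDerivAt (fun s : ℝ => H (x + s • v))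
      (fderivCLM ℝ E F H (x + s • v) v) s := by
    intro s _
    have := ((hasDerivAt_id s).smul_const v).const_add x
    simpa [Function.comp_def] using (H.hasFDerivAt (x + s • v)).comp_hasDerivAt s this
  have ht : Filter.Tendsto (fun s : ℝ => H (x + s • v)) Filter.atBot (nhds 0) := by
    obtain ⟨C, hC⟩ := schwartz_line_bound H hv ‖x‖
    refine squeeze_zero_norm (hC x le_rfl) ?_
    have : Filter.Tendsto (fun s : ℝ => 1 + s ^ 2) Filter.atBot Filter.atTop := by
      refine Filter.tendsto_atTop_add_const_left _ _ ?_
      simpa [Function.comp_def] using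
        (Filter.tendsto_pow_atTop (α := ℝ) two_ne_zero).comp Filter.tendsto_abs_atBot_atTop
    simpa using this.inv_tendsto_atTop.const_mul C
  rw [integral_Iic_of_hasDerivAt_of_tendsto' hd ?_ ht]
  · simp
  · exact ((ContinuousLinearMap.apply ℝ F v).integrable_comp
      (schwartz_line_integrable (fderivCLM ℝ E F H) hv x)).integrableOn

end Primitive

/-! ### Translations and slices of Schwartz functions -/

section Translation

variable {E : Type} [NormedAddCommGroup E] [InnerProductSpace ℝ E]

theorem lineDeriv_comm (v w : E) (H : 𝓢(E, ℂ)) : ∂_{v} (∂_{w} H) = ∂_{w} (∂_{v} H) := by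
  ext x
  have h : ∀ a b : E, ∂_{a} (∂_{b} H) x = fderiv ℝ (fderiv ℝ H) x a b := by
    intro a b
    rw [SchwartzMap.lineDerivOp_apply_eq_fderiv]
    have hd : DifferentiableAt ℝ (fderiv ℝ H) x := (fderivCLM ℝ E ℂ H).differentiableAt
    have : ⇑(∂_{b} H : 𝓢(E, ℂ)) = fun y => fderiv ℝ H y b := by
      ext y; exact SchwartzMap.lineDerivOp_apply_eq_fderiv b H y
    rw [this]
    rw [(hd.hasFDerivAt.clm_apply (hasFDerivAt_const b x)).fderiv]
    simp
  rw [h, h]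
  exact (((H.smooth ⊤).contDiffAt.isSymmSndFDerivAt
    (by simpa using WithTop.coe_le_coe.2 (le_top : (2 : ℕ∞) ≤ ⊤))) v w)

/-- By symmetry of second derivatives the direction `v` moves past all others. Seminorms of
difference quotients of `H` can then be compared with those of the Schwartz function `∂_{v} H`. -/
theorem fderiv_iteratedFDeriv_apply (j : ℕ) (H : 𝓢(E, ℂ)) (x v : E) :
    fderiv ℝ (iteratedFDeriv ℝ j H) x v = iteratedFDeriv ℝ j (∂_{v} H : 𝓢(E, ℂ)) x := by
  ext m
  have h1 : fderiv ℝ (iteratedFDeriv ℝ j H) x v m = iteratedFDeriv ℝ (j + 1) H x (Fin.cons v m) := by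
    rw [iteratedFDeriv_succ_apply_left]
    simp
  rw [h1, ← SchwartzMap.iteratedLineDerivOp_eq_iteratedFDeriv,
    ← SchwartzMap.iteratedLineDerivOp_eq_iteratedFDeriv, iteratedLineDerivOp_succ_left]
  simp only [Fin.cons_zero]
  have ht : Fin.tail (Fin.cons v m : Fin (j + 1) → E) = m := Fin.tail_cons _ _
  rw [ht]
  congr 1
  clear h1 ht
  induction j with
  | zero => simp
  | succ j ih =>
    rw [iteratedLineDerivOp_succ_left, iteratedLineDerivOp_succ_left, lineDeriv_comm, ih]

theorem hasDerivAt_iteratedFDeriv_line (j : ℕ) (H : 𝓢(E, ℂ)) (x v : E) (s : ℝ) :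
    HasDerivAt (fun s : ℝ => iteratedFDeriv ℝ j H (x + s • v))
      (iteratedFDeriv ℝ j (∂_{v} H : 𝓢(E, ℂ)) (x + s • v)) s := by
  have h1 := ((hasDerivAt_id s).smul_const v).const_add x
  have h2 : DifferentiableAt ℝ (iteratedFDeriv ℝ j H) (x + s • v) :=
    (H.smooth ⊤).differentiable_iteratedFDeriv (by exact_mod_cast WithTop.coe_lt_top j) _
  have h3 := h2.hasFDerivAt.comp_hasDerivAt s h1
  rw [← fderiv_iteratedFDeriv_apply]
  simpa [Function.comp_def] using h3

/-- Mean value inequality in `r`. A shift by at most `‖v‖` changes the polynomial weight by a factor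
of at most `(1 + ‖v‖) ^ l`. -/
theorem translation_bound_one (G : 𝓢(E, ℂ)) (v : E) (l j : ℕ) :
    ∃ K : ℝ, 0 ≤ K ∧ ∀ (x : E) (r : ℝ), |r| ≤ 1 →
      ‖x‖ ^ l * ‖iteratedFDeriv ℝ j G (x + r • v) - iteratedFDeriv ℝ j G x‖ ≤ K * |r| := by
  obtain ⟨C, hC0, hC⟩ := schwartz_decay_one_add (∂_{v} G) l j
  refine ⟨(1 + ‖v‖) ^ l * C, by positivity, fun x r hr => ?_⟩
  have hb : ∀ ρ ∈ Set.uIcc 0 r,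
      ‖‖x‖ ^ l • iteratedFDeriv ℝ j (∂_{v} G : 𝓢(E, ℂ)) (x + ρ • v)‖ ≤ (1 + ‖v‖) ^ l * C := by
    intro ρ hρ
    have hρ1 : |ρ| ≤ 1 := by
      have := Set.abs_sub_left_of_mem_uIcc hρ
      simp only [sub_zero] at this
      linarith
    have hx : ‖x‖ ≤ (1 + ‖v‖) * (1 + ‖x + ρ • v‖) := by
      have h1 : ‖x‖ ≤ ‖x + ρ • v‖ + ‖ρ • v‖ := by simpa using norm_sub_le (x + ρ • v) (ρ • v)
      rw [norm_smul, Real.norm_eq_abs] at h1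
      nlinarith [norm_nonneg v, norm_nonneg (x + ρ • v), mul_nonneg (norm_nonneg v)
        (norm_nonneg (x + ρ • v))]
    rw [norm_smul, norm_pow, norm_norm]
    calc _ ≤ ((1 + ‖v‖) * (1 + ‖x + ρ • v‖)) ^ l *
          ‖iteratedFDeriv ℝ j (∂_{v} G : 𝓢(E, ℂ)) (x + ρ • v)‖ := by gcongr
      _ = (1 + ‖v‖) ^ l * ((1 + ‖x + ρ • v‖) ^ l *
          ‖iteratedFDeriv ℝ j (∂_{v} G : 𝓢(E, ℂ)) (x + ρ • v)‖) := by rw [mul_pow]; ring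
      _ ≤ _ := by gcongr; exact hC _
  have := (convex_uIcc 0 r).norm_image_sub_le_of_norm_hasDerivWithin_le
    (f := fun ρ : ℝ => ‖x‖ ^ l • iteratedFDeriv ℝ j G (x + ρ • v))
    (fun ρ _ => ((hasDerivAt_iteratedFDeriv_line j G x v ρ).const_smul
      (‖x‖ ^ l)).hasDerivWithinAt) hb Set.left_mem_uIcc Set.right_mem_uIcc
  simpa [← smul_sub, norm_smul] using this

/-- The function `ρ ↦ H(x + ρ • v) - ρ ∂_v H(x)` has as derivative an increment of `∂_{v} H`, which
is of first order in `r` by the previous bound. A second use of the mean value inequality gives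
second order. -/
theorem translation_bound_two (H : 𝓢(E, ℂ)) (v : E) (l j : ℕ) :
    ∃ K : ℝ, 0 ≤ K ∧ ∀ (x : E) (r : ℝ), |r| ≤ 1 →
      ‖x‖ ^ l * ‖iteratedFDeriv ℝ j H (x + r • v) - iteratedFDeriv ℝ j H x -
        r • iteratedFDeriv ℝ j (∂_{v} H : 𝓢(E, ℂ)) x‖ ≤ K * |r| ^ 2 := by
  obtain ⟨K, hK0, hK⟩ := translation_bound_one (∂_{v} H) v l j
  refine ⟨K, hK0, fun x r hr => ?_⟩
  have hb : ∀ ρ ∈ Set.uIcc 0 r,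
      ‖‖x‖ ^ l • (iteratedFDeriv ℝ j (∂_{v} H : 𝓢(E, ℂ)) (x + ρ • v) -
        (1 : ℝ) • iteratedFDeriv ℝ j (∂_{v} H : 𝓢(E, ℂ)) x)‖ ≤ K * |r| := by
    intro ρ hρ
    have hρ1 : |ρ| ≤ |r| := by simpa using Set.abs_sub_left_of_mem_uIcc hρ
    rw [norm_smul, norm_pow, norm_norm, one_smul]
    exact (hK x ρ (hρ1.trans hr)).trans (by gcongr)
  have := (convex_uIcc 0 r).norm_image_sub_le_of_norm_hasDerivWithin_le
    (f := fun ρ : ℝ => ‖x‖ ^ l • (iteratedFDeriv ℝ j H (x + ρ • v) -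
      ρ • iteratedFDeriv ℝ j (∂_{v} H : 𝓢(E, ℂ)) x))
    (fun ρ _ => (((hasDerivAt_iteratedFDeriv_line j H x v ρ).sub
      ((hasDerivAt_id ρ).smul_const _)).const_smul (‖x‖ ^ l)).hasDerivWithinAt) hb
    Set.left_mem_uIcc Set.right_mem_uIcc
  rw [← smul_sub, norm_smul, norm_pow, norm_norm] at this
  rw [sub_right_comm, sq, ← mul_assoc]
  simpa using this

/-- A continuous linear functional on `𝓢(E)` is bounded by finitely many seminorms. -/
theorem exists_seminorm_bound {E : Type*} [NormedAddCommGroup E] [NormedSpace ℝ E]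
    (A : 𝓢(E, ℂ) →L[ℂ] ℂ) : ∃ (s : Finset (ℕ × ℕ)) (C : ℝ), 0 ≤ C ∧
      ∀ f, ‖A f‖ ≤ C * s.sup (schwartzSeminormFamily ℂ E ℂ) f := by
  obtain ⟨s, C, _, h⟩ := Seminorm.bound_of_continuous (schwartz_withSeminorms ℂ E ℂ)
    (A.toSeminorm) (A.continuous.norm)
  exact ⟨s, C, C.2, h⟩

/-- The free weight `w` serves two purposes: `|r| ^ 2` for Taylor remainders and `1` for bounds
uniform in a parameter. -/
theorem finset_sup_seminorm_le {ι V : Type*} [AddCommGroup V] [Module ℂ V]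
    (p : ι → Seminorm ℂ V) (s : Finset ι) {P : ℝ → V} {T : Set ℝ} {w : ℝ → ℝ} (hw : ∀ t, 0 ≤ w t)
    (h : ∀ i, ∃ K : ℝ, 0 ≤ K ∧ ∀ t ∈ T, p i (P t) ≤ K * w t) :
    ∃ K : ℝ, 0 ≤ K ∧ ∀ t ∈ T, s.sup p (P t) ≤ K * w t := by
  choose K hK0 hK using h
  refine ⟨∑ i ∈ s, K i, Finset.sum_nonneg fun i _ => hK0 i, fun t ht => ?_⟩
  refine Seminorm.finset_sup_apply_le (mul_nonneg (Finset.sum_nonneg fun i _ => hK0 i) (hw t)) ?_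
  intro i hi
  refine (hK i t ht).trans ?_
  gcongr
  · exact hw t
  · exact Finset.single_le_sum (fun i _ => hK0 i) hi

theorem iteratedFDeriv_sub_sub_smul_apply {f₁ f₂ f₃ : E → ℂ} (h₁ : ContDiff ℝ ∞ f₁)
    (h₂ : ContDiff ℝ ∞ f₂) (h₃ : ContDiff ℝ ∞ f₃) (r : ℝ) (j : ℕ) (x : E) :
    iteratedFDeriv ℝ j (f₁ - f₂ - r • f₃) x =
      iteratedFDeriv ℝ j f₁ x - iteratedFDeriv ℝ j f₂ x - r • iteratedFDeriv ℝ j f₃ x := by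
  have hj : (j : ℕ∞ω) ≤ ∞ := by exact_mod_cast le_top
  have a₁ : ContDiffAt ℝ j f₁ x := h₁.contDiffAt.of_le hj
  have a₂ : ContDiffAt ℝ j f₂ x := h₂.contDiffAt.of_le hj
  have a₃ : ContDiffAt ℝ j f₃ x := h₃.contDiffAt.of_le hj
  have a₁₂ : ContDiffAt ℝ j (f₁ - f₂) x := a₁.sub a₂
  have a₃' : ContDiffAt ℝ j (r • f₃) x := contDiffAt_const.smul a₃
  rw [iteratedFDeriv_sub_apply a₁₂ a₃', iteratedFDeriv_sub_apply a₁ a₂,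
    iteratedFDeriv_const_smul_apply a₃]

/-- The first-order Taylor remainder of a translation is `O(r²)` in every Schwartz seminorm, and `A`
is controlled by finitely many of them. -/
theorem hasDerivAt_translation_zero (A : 𝓢(E, ℂ) →L[ℂ] ℂ) (H : 𝓢(E, ℂ)) (v : E) :
    HasDerivAt (fun s : ℝ => A (compSubConstCLM ℂ (-(s • v)) H)) (A (∂_{v} H)) 0 := by
  obtain ⟨s, C, hC0, hC⟩ := exists_seminorm_bound A
  obtain ⟨K, hK0, hK⟩ := finset_sup_seminorm_le (schwartzSeminormFamily ℂ E ℂ) s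
    (P := fun r => compSubConstCLM ℂ (-(r • v)) H - H - (r : ℂ) • ∂_{v} H) (T := {r | |r| ≤ 1})
    (w := fun r => |r| ^ 2) (fun t => by positivity) (by
      rintro ⟨l, j⟩
      obtain ⟨K, hK0, hK⟩ := translation_bound_two H v l j
      refine ⟨K, hK0, fun r hr => ?_⟩
      refine SchwartzMap.seminorm_le_bound ℂ l j _ (by positivity) fun x => ?_
      refine le_trans (le_of_eq ?_) (hK x r hr)
      congr 2
      have he : ((compSubConstCLM ℂ (-(r • v)) H - H - (r : ℂ) • ∂_{v} H : 𝓢(E, ℂ)) : E → ℂ) =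
          ((fun y => H (y + r • v)) - (H : E → ℂ)) - r • ⇑(∂_{v} H : 𝓢(E, ℂ)) := by
        ext y; simp
      have c1 : ContDiff ℝ ∞ fun y => H (y + r • v) :=
        (H.smooth ⊤).comp (contDiff_id.add contDiff_const)
      have c2 : ContDiff ℝ ∞ H := H.smooth ⊤
      have c3 : ContDiff ℝ ∞ (∂_{v} H : 𝓢(E, ℂ)) := (∂_{v} H).smooth ⊤
      rw [he, iteratedFDeriv_sub_sub_smul_apply c1 c2 c3, iteratedFDeriv_comp_add_right])
  rw [hasDerivAt_iff_isLittleO]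
  have hO : (fun r : ℝ => A (compSubConstCLM ℂ (-(r • v)) H) -
      A (compSubConstCLM ℂ (-((0 : ℝ) • v)) H) - (r - 0) • A (∂_{v} H)) =O[nhds 0]
      fun r : ℝ => r ^ 2 := by
    refine Asymptotics.IsBigO.of_bound (C * K) ?_
    filter_upwards [Metric.closedBall_mem_nhds (0 : ℝ) one_pos] with r hr
    have hr1 : |r| ≤ 1 := by simpa using hr
    have : A (compSubConstCLM ℂ (-(r • v)) H) -
      A (compSubConstCLM ℂ (-((0 : ℝ) • v)) H) - (r - 0) • A (∂_{v} H) =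
      A (compSubConstCLM ℂ (-(r • v)) H - H - (r : ℂ) • ∂_{v} H) := by
      simp
    rw [this]
    refine (hC _).trans ?_
    rw [mul_assoc]
    gcongr
    simpa using hK r hr1
  refine hO.trans_isLittleO ?_
  simpa using Asymptotics.isLittleO_pow_id (𝕜 := ℝ) (n := 2) (by norm_num)

/-- Group property of translations: the derivative at `t` is the derivative at `0` for the
functional `A` composed with the translation by `t`. -/
theorem hasDerivAt_translation (A : 𝓢(E, ℂ) →L[ℂ] ℂ) (H : 𝓢(E, ℂ)) (v : E) (t : ℝ) :
    HasDerivAt (fun s : ℝ => A (compSubConstCLM ℂ (-(s • v)) H))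
      (A (compSubConstCLM ℂ (-(t • v)) (∂_{v} H))) t := by
  have h1 := hasDerivAt_translation_zero (A ∘L compSubConstCLM ℂ (-(t • v))) H v
  rw [← sub_self t] at h1
  have h2 := HasDerivAt.comp_sub_const t t h1
  have hf : (fun s : ℝ => A (compSubConstCLM ℂ (-(s • v)) H)) = fun x =>
      (A ∘L compSubConstCLM ℂ (-(t • v))) (compSubConstCLM ℂ (-((x - t) • v)) H) := by
    ext s
    rw [ContinuousLinearMap.comp_apply, compSubConstCLM_comp]
    congr 3
    module
  rw [hf]
  exact h2

end Translation

/-! ### Splitting off the first coordinate -/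

section Splitting

variable {k : ℕ}

/-- `(x¹, …, xᵏ) ↦ (0, x¹, …, xᵏ)`. -/
def emb : EuclideanSpace ℝ (Fin k) →L[ℝ] EuclideanSpace ℝ (Fin (k + 1)) :=
  LinearMap.toContinuousLinearMap
    { toFun := fun x => WithLp.toLp 2 (Fin.cons (α := fun _ => ℝ) 0 fun i => x i)
      map_add' := fun x y => by ext i; refine Fin.cases ?_ (fun i => ?_) i <;> simp
      map_smul' := fun c x => by ext i; refine Fin.cases ?_ (fun i => ?_) i <;> simp }

@[simp] theorem emb_zero_coord (p : EuclideanSpace ℝ (Fin k)) : emb p 0 = 0 := rfl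

@[simp] theorem emb_succ (p : EuclideanSpace ℝ (Fin k)) (i : Fin k) : emb p i.succ = p i := rfl

@[simp] theorem tail_emb (p : EuclideanSpace ℝ (Fin k)) : tail (emb p) = p := by
  ext i; simp

@[simp] theorem e_self (i : Fin k) : (e i : EuclideanSpace ℝ (Fin k)) i = 1 := by
  simp [e]

@[simp] theorem tail_e_zero : tail (e 0 : EuclideanSpace ℝ (Fin (k + 1))) = 0 := by
  ext i; simp [e]

@[simp] theorem norm_e (i : Fin k) : ‖(e i : EuclideanSpace ℝ (Fin k))‖ = 1 := by
  simp [e]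

theorem inner_e (x : EuclideanSpace ℝ (Fin k)) (i : Fin k) : inner ℝ x (e i) = x i := by
  simp [e, EuclideanSpace.inner_single_right]

/-- `(t, p) ↦ (t, p¹, …, pᵏ)`. -/
def cons (t : ℝ) (p : EuclideanSpace ℝ (Fin k)) : EuclideanSpace ℝ (Fin (k + 1)) :=
  t • e 0 + emb p

@[simp] theorem cons_zero (t : ℝ) (p : EuclideanSpace ℝ (Fin k)) : cons t p 0 = t := by
  simp [cons]

@[simp] theorem tail_cons (t : ℝ) (p : EuclideanSpace ℝ (Fin k)) : tail (cons t p) = p := by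
  simp [cons]

@[simp] theorem cons_succ (t : ℝ) (p : EuclideanSpace ℝ (Fin k)) (i : Fin k) :
    cons t p i.succ = p i := by
  rw [← tail_apply, tail_cons]

theorem cons_tail (x : EuclideanSpace ℝ (Fin (k + 1))) : cons (x 0) (tail x) = x := by
  ext i; refine Fin.cases ?_ (fun i => ?_) i <;> simp

theorem cons_add_smul (t s : ℝ) (p : EuclideanSpace ℝ (Fin k)) :
    cons t p + s • e 0 = cons (t + s) p := by
  simp only [cons]; module

theorem norm_cons_sq (t : ℝ) (p : EuclideanSpace ℝ (Fin k)) :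
    ‖cons t p‖ ^ 2 = t ^ 2 + ‖p‖ ^ 2 := by
  rw [EuclideanSpace.norm_sq_eq, EuclideanSpace.norm_sq_eq, Fin.sum_univ_succ]
  simp

theorem norm_le_norm_cons (t : ℝ) (p : EuclideanSpace ℝ (Fin k)) : ‖p‖ ≤ ‖cons t p‖ := by
  refine le_of_sq_le_sq ?_ (norm_nonneg _)
  rw [norm_cons_sq]
  nlinarith [sq_nonneg t]

theorem continuous_cons :
    Continuous fun z : ℝ × EuclideanSpace ℝ (Fin k) => cons z.1 z.2 := by
  unfold cons; fun_prop

theorem measurePreserving_cons :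
    MeasurePreserving (fun z : ℝ × EuclideanSpace ℝ (Fin k) => cons z.1 z.2) := by
  have h1 := ((volume_preserving_piFinSuccAbove (fun _ : Fin (k + 1) => ℝ) 0).symm)
  have h2 := (MeasurePreserving.id (volume : Measure ℝ)).prod (PiLp.volume_preserving_ofLp (Fin k))
  have h3 := (PiLp.volume_preserving_toLp (Fin (k + 1))).comp (h1.comp h2)
  rw [Measure.volume_eq_prod]
  convert h3 using 1
  ext z i
  refine Fin.cases ?_ (fun i => ?_) i
  · simp [MeasurableEquiv.piFinSuccAbove]
  · simp [MeasurableEquiv.piFinSuccAbove]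

theorem measurableEmbedding_cons :
    MeasurableEmbedding fun z : ℝ × EuclideanSpace ℝ (Fin k) => cons z.1 z.2 := by
  refine continuous_cons.measurableEmbedding fun z w h => Prod.ext ?_ ?_
  · simpa using congrArg (fun x : EuclideanSpace ℝ (Fin (k + 1)) => x 0) h
  · simpa using congrArg tail h

theorem integrable_cons {F : EuclideanSpace ℝ (Fin (k + 1)) → ℂ} (hF : Integrable F) :
    Integrable fun z : ℝ × EuclideanSpace ℝ (Fin k) => F (cons z.1 z.2) :=
  (measurePreserving_cons.integrable_comp_emb measurableEmbedding_cons).2 hF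

theorem integral_eq_integral_cons {F : EuclideanSpace ℝ (Fin (k + 1)) → ℂ} (hF : Integrable F) :
    ∫ x, F x = ∫ p : EuclideanSpace ℝ (Fin k), ∫ t : ℝ, F (cons t p) := by
  rw [← measurePreserving_cons.integral_comp measurableEmbedding_cons]
  exact integral_prod_symm _ (integrable_cons hF)

theorem integral_mul_tail (φ : ℝ → ℂ) (ψ : EuclideanSpace ℝ (Fin k) → ℂ) :
    ∫ x : EuclideanSpace ℝ (Fin (k + 1)), φ (x 0) * ψ (tail x) = (∫ t, φ t) * ∫ p, ψ p := by
  rw [← measurePreserving_cons.integral_comp measurableEmbedding_cons]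
  simp only [cons_zero, tail_cons]
  exact integral_prod_mul φ ψ

/-! ### Restriction to graphs and shears -/

theorem hasTemperateGrowth_cons {D : Type*} [NormedAddCommGroup D] [NormedSpace ℝ D] {θ : D → ℝ}
    {g : D → EuclideanSpace ℝ (Fin k)} (hθ : θ.HasTemperateGrowth) (hg : g.HasTemperateGrowth) :
    (fun p => cons (θ p) (g p)).HasTemperateGrowth :=
  (hθ.smul (.const _)).add (emb.hasTemperateGrowth.comp hg)

/-- The restriction of a Schwartz function to the graph `{x⁰ = θ(x¹, …, xᵏ)}`. -/
def graphCLM {θ : EuclideanSpace ℝ (Fin k) → ℝ} (hθ : θ.HasTemperateGrowth) :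
    𝓢(EuclideanSpace ℝ (Fin (k + 1)), ℂ) →L[ℂ] 𝓢(EuclideanSpace ℝ (Fin k), ℂ) :=
  compCLM ℂ (hasTemperateGrowth_cons hθ .id') ⟨1, 1, fun p => by
    have := norm_le_norm_cons (θ p) p
    simp only [pow_one, one_mul]
    linarith⟩

theorem hasTemperateGrowth_coord_zero :
    (fun x : EuclideanSpace ℝ (Fin (k + 1)) => x 0).HasTemperateGrowth :=
  (EuclideanSpace.proj (𝕜 := ℝ) (0 : Fin (k + 1))).hasTemperateGrowth

theorem hasTemperateGrowth_shear {θ : EuclideanSpace ℝ (Fin k) → ℝ} (hθ : θ.HasTemperateGrowth) :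
    (fun x : EuclideanSpace ℝ (Fin (k + 1)) =>
      cons (x 0 + θ (tail x)) (tail x)).HasTemperateGrowth :=
  hasTemperateGrowth_cons
    (hasTemperateGrowth_coord_zero.add (hθ.comp tail.hasTemperateGrowth)) tail.hasTemperateGrowth

/-- The composition of a Schwartz function with the shear `(x⁰, x) ↦ (x⁰ + θ(x), x)`. -/
def shearCLM {θ : EuclideanSpace ℝ (Fin k) → ℝ} (hθ : θ.HasTemperateGrowth) :
    𝓢(EuclideanSpace ℝ (Fin (k + 1)), ℂ) →L[ℂ] 𝓢(EuclideanSpace ℝ (Fin (k + 1)), ℂ) :=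
  compCLM ℂ (hasTemperateGrowth_shear hθ) (by
    -- The inverse shear also has temperate growth; at order zero, evaluated on the image point,
    -- this bounds `‖x‖` by a power of the norm of its image, as composition with Schwartz functions
    -- requires.
    obtain ⟨l, C, hC⟩ := (hasTemperateGrowth_shear hθ.neg).2 0
    refine ⟨l, C, fun x => ?_⟩
    have := hC (cons (x 0 + θ (tail x)) (tail x))
    simpa [cons_tail] using this)

@[simp] theorem shearCLM_apply {θ : EuclideanSpace ℝ (Fin k) → ℝ} (hθ : θ.HasTemperateGrowth)
    (H : 𝓢(EuclideanSpace ℝ (Fin (k + 1)), ℂ)) (x : EuclideanSpace ℝ (Fin (k + 1))) :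
    shearCLM hθ H x = H (cons (x 0 + θ (tail x)) (tail x)) := rfl

/-- `g ↦ f ⊗ g` as a continuous linear map. -/
def tensorCLM (f : 𝓢(ℝ, ℂ)) :
    𝓢(EuclideanSpace ℝ (Fin k), ℂ) →L[ℂ] 𝓢(EuclideanSpace ℝ (Fin (k + 1)), ℂ) :=
  mkCLM (fun g x => f (x 0) * g (tail x)) (fun g h x => by simp [mul_add])
    (fun a g x => by simp [mul_left_comm]) (fun g => (tensor f g).smooth ⊤) <| by
  rintro ⟨l, n⟩
  let P : EuclideanSpace ℝ (Fin (k + 1)) →L[ℝ] ℝ := EuclideanSpace.proj 0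
  choose A hA0 hA using comp_bound f P l
  refine ⟨Finset.Iic (l, n), ∑ i ∈ Finset.range (n + 1), (n.choose i : ℝ) * A i *
    (2 ^ l * ‖tail (k := k)‖ ^ (n - i)), Finset.sum_nonneg fun i _ => by have := hA0 i; positivity,
    fun g x => ?_⟩
  have hB : ∀ i ≤ n, (1 + ‖tail x‖) ^ l *
      ‖iteratedFDeriv ℝ i (fun y : EuclideanSpace ℝ (Fin (k + 1)) => g (tail y)) x‖ ≤
      2 ^ l * ‖tail (k := k)‖ ^ i * (Finset.Iic (l, n)).sup (schwartzSeminormFamily ℂ _ ℂ) g := by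
    intro i hi
    have h1 : (1 + ‖tail x‖) ^ l * ‖iteratedFDeriv ℝ i g (tail x)‖ ≤
        2 ^ l * (Finset.Iic (l, n)).sup (schwartzSeminormFamily ℂ _ ℂ) g :=
      SchwartzMap.one_add_le_sup_seminorm_apply (𝕜 := ℂ) (m := (l, n)) le_rfl hi g (tail x)
    have h2 : ‖iteratedFDeriv ℝ i (fun y : EuclideanSpace ℝ (Fin (k + 1)) => g (tail y)) x‖ ≤
        ‖iteratedFDeriv ℝ i g (tail x)‖ * ‖tail (k := k)‖ ^ i := by
      have := tail.iteratedFDeriv_comp_right (f := g) (g.smooth ⊤) x (i := i)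
        (by exact_mod_cast le_top)
      change ‖iteratedFDeriv ℝ i (g ∘ tail) x‖ ≤ _
      rw [this]
      refine (ContinuousMultilinearMap.norm_compContinuousLinearMap_le _ _).trans ?_
      simp
    calc _ ≤ (1 + ‖tail x‖) ^ l * (‖iteratedFDeriv ℝ i g (tail x)‖ * ‖tail (k := k)‖ ^ i) := by
          gcongr
      _ = ((1 + ‖tail x‖) ^ l * ‖iteratedFDeriv ℝ i g (tail x)‖) * ‖tail (k := k)‖ ^ i := by ring
      _ ≤ 2 ^ l * (Finset.Iic (l, n)).sup (schwartzSeminormFamily ℂ _ ℂ) g *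
          ‖tail (k := k)‖ ^ i := by gcongr
      _ = _ := by ring
  have hf : ContDiff ℝ ∞ (fun y => f (P y)) := (f.smooth ⊤).comp P.contDiff
  have hg : ContDiff ℝ ∞ (fun y : EuclideanSpace ℝ (Fin (k + 1)) => g (tail y)) :=
    (g.smooth ⊤).comp tail.contDiff
  have h1 := norm_iteratedFDeriv_mul_le hf hg x (n := n) (by exact_mod_cast le_top)
  have h2 : ‖x‖ ^ l ≤ (1 + ‖P x‖) ^ l * (1 + ‖tail x‖) ^ l := by
    rw [← mul_pow]
    exact pow_le_pow_left₀ (norm_nonneg _) (norm_le_tail x) l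
  refine (mul_le_mul h2 h1 (norm_nonneg _) (by positivity)).trans ?_
  rw [Finset.mul_sum, Finset.sum_mul]
  refine Finset.sum_le_sum fun i _ => ?_
  calc _ = (n.choose i : ℝ) * ((1 + ‖P x‖) ^ l * ‖iteratedFDeriv ℝ i (fun y => f (P y)) x‖) *
        ((1 + ‖tail x‖) ^ l * ‖iteratedFDeriv ℝ (n - i) (fun y => g (tail y)) x‖) := by ring
    _ ≤ (n.choose i : ℝ) * A i * (2 ^ l * ‖tail (k := k)‖ ^ (n - i) *
        (Finset.Iic (l, n)).sup (schwartzSeminormFamily ℂ _ ℂ) g) := by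
      have h0 := hA0 i
      exact mul_le_mul (by gcongr; exact hA i x) (hB (n - i) (Nat.sub_le _ _)) (by positivity)
        (by positivity)
    _ = _ := by ring

theorem tensorCLM_apply (f : 𝓢(ℝ, ℂ)) (g : 𝓢(EuclideanSpace ℝ (Fin k), ℂ)) :
    tensorCLM f g = tensor f g := rfl

/-! ### Division by a coordinate -/

theorem hasTemperateGrowth_ofReal_comp {D : Type*} [NormedAddCommGroup D] [NormedSpace ℝ D]
    {θ : D → ℝ} (hθ : θ.HasTemperateGrowth) : (fun p => (θ p : ℂ)).HasTemperateGrowth :=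
  Function.HasTemperateGrowth.comp Function.Complex.hasTemperateGrowth_ofReal hθ

/-- A Schwartz function on `ℝᵏ⁺¹` that vanishes on `{x⁰ = 0}` is divisible by `x⁰`. -/
theorem exists_eq_coord_mul (G : 𝓢(EuclideanSpace ℝ (Fin (k + 1)), ℂ))
    (hG : ∀ p, G (cons 0 p) = 0) :
    ∃ K : 𝓢(EuclideanSpace ℝ (Fin (k + 1)), ℂ), ∀ x, G x = x 0 * K x := by
  -- The inverse Fourier transform of `h` is the restriction of `G` to `{x⁰ = 0}`, hence zero, and
  -- so `h = 0`. Thus `𝓕 G` has vanishing integrals along `e 0` and admits a Schwartz primitive `P`;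
  -- up to a constant, `𝓕⁻ P` is the quotient.
  let h : EuclideanSpace ℝ (Fin k) → ℂ := fun p => ∫ t : ℝ, 𝓕 G (cons t p)
  have hline : ∀ x : EuclideanSpace ℝ (Fin (k + 1)),
      ∫ s : ℝ, 𝓕 G (x + s • e 0) = h (tail x) := by
    intro x
    change _ = ∫ t, 𝓕 G (cons t (tail x))
    rw [← integral_add_left_eq_self (fun t => 𝓕 G (cons t (tail x))) (x 0)]
    congr 1
    ext s
    rw [← cons_add_smul, cons_tail]
  have hi := integrable_cons ((𝓕 G).integrable (μ := volume))
  have hint : Integrable h := hi.integral_prod_right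
  -- Continuity makes Fourier inversion for `h` hold pointwise and not merely almost everywhere.
  have hcont : Continuous h := by
    have h1 := contDiff_line_integral 0 (𝓕 G) (norm_e (0 : Fin (k + 1))) Set.univ
    have h2 := (h1.continuous.comp emb.continuous)
    convert h2 using 1
    ext p
    have := hline (emb p)
    simp only [tail_emb] at this
    simp [← this]
  have hinv : 𝓕⁻ h = 0 := by
    ext q
    have h1 : G (emb q) = 𝓕⁻ (𝓕 G) (emb q) := by rw [FourierTransform.fourierInv_fourier_eq]
    have h0 : G (emb q) = 0 := by simpa [cons] using hG q
    rw [h0, SchwartzMap.fourierInv_coe, Real.fourierInv_eq', integral_eq_integral_cons] at h1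
    · rw [Real.fourierInv_eq', Pi.zero_apply, h1]
      congr 1
      ext p
      have : ∀ t : ℝ, inner ℝ (cons t p) (emb q) = inner ℝ p q := by
        intro t
        simp [PiLp.inner_apply, Fin.sum_univ_succ]
      simp only [this, h]
      rw [integral_smul]
    · refine (𝓕 G).integrable.bdd_smul (C := 1)
        (φ := fun v => Complex.exp ((2 * Real.pi * inner ℝ v (emb q) : ℝ) * Complex.I))
        ?_ ?_
      · exact Continuous.aestronglyMeasurable (by fun_prop)
      · refine Filter.Eventually.of_forall fun x => le_of_eq ?_
        rw [Complex.norm_exp]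
        simp
  have hfour : 𝓕 h = 0 := by
    ext q
    rw [← neg_neg q, ← Real.fourierInv_eq_fourier_neg, hinv]
    rfl
  have hzero : h = 0 := by
    have h1 := hcont.fourier_fourierInv_eq hint (by rw [hfour]; exact integrable_zero _ _ _)
    rw [← h1, hinv]
    ext q
    simp [Real.fourier_eq']
  obtain ⟨P, hP⟩ := exists_lineDeriv_eq (𝓕 G) (norm_e (0 : Fin (k + 1))) (fun x => by
    rw [hline, hzero]; rfl)
  refine ⟨-(2 * Real.pi * Complex.I) • 𝓕⁻ P, fun x => ?_⟩
  have h1 : G = 𝓕⁻ (𝓕 G) := (FourierTransform.fourierInv_fourier_eq G).symm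
  rw [h1, ← hP, SchwartzMap.fourierInv_lineDerivOp_eq]
  have ht : (inner ℝ · (e 0 : EuclideanSpace ℝ (Fin (k + 1)))).HasTemperateGrowth := by fun_prop
  simp only [smul_apply, smulLeftCLM_apply_apply ht]
  rw [inner_e, Complex.real_smul]
  simp only [smul_eq_mul]
  ring

/-- A Schwartz function on `ℝᵏ⁺¹` that vanishes on the graph of `θ` is divisible by `x⁰ - θ`. -/
theorem exists_eq_sub_mul {θ : EuclideanSpace ℝ (Fin k) → ℝ} (hθ : θ.HasTemperateGrowth)
    (G : 𝓢(EuclideanSpace ℝ (Fin (k + 1)), ℂ)) (hG : ∀ p, G (cons (θ p) p) = 0) :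
    ∃ K : 𝓢(EuclideanSpace ℝ (Fin (k + 1)), ℂ), ∀ x, G x = (x 0 - θ (tail x)) * K x := by
  -- The shear maps `{x⁰ = 0}` onto the graph of `θ`; the quotient is carried back by the inverse
  -- shear.
  obtain ⟨K, hK⟩ := exists_eq_coord_mul (shearCLM hθ G) (fun p => by simpa using hG p)
  refine ⟨shearCLM hθ.neg K, fun x => ?_⟩
  have := hK (cons (x 0 + (-θ) (tail x)) (tail x))
  simp only [shearCLM_apply, cons_zero, tail_cons, Pi.neg_apply, neg_add_cancel_right,
    cons_tail] at this ⊢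
  rw [this]
  push_cast
  ring

end Splitting

/-! ### Tempered distributions applied to slices -/

section Slices

variable {k : ℕ}

/-- `H ↦ H(t, ·)`. -/
def sliceCLM (t : ℝ) :
    𝓢(EuclideanSpace ℝ (Fin (k + 1)), ℂ) →L[ℂ] 𝓢(EuclideanSpace ℝ (Fin k), ℂ) :=
  graphCLM (.const t)

@[simp] theorem sliceCLM_apply (t : ℝ) (H : 𝓢(EuclideanSpace ℝ (Fin (k + 1)), ℂ))
    (p : EuclideanSpace ℝ (Fin k)) : sliceCLM t H p = H (cons t p) := rfl

/-- The slice at `t` is the slice at `0` of a translate along `e 0`, which reduces the claim to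
differentiability of translations. -/
theorem hasDerivAt_slice (A : 𝓢(EuclideanSpace ℝ (Fin k), ℂ) →L[ℂ] ℂ)
    (H : 𝓢(EuclideanSpace ℝ (Fin (k + 1)), ℂ)) (t : ℝ) :
    HasDerivAt (fun t => A (sliceCLM t H))
      (A (sliceCLM t (∂_{(e 0 : EuclideanSpace ℝ (Fin (k + 1)))} H))) t := by
  have h := hasDerivAt_translation (A ∘L sliceCLM 0) H (e 0) t
  have hs : ∀ (s : ℝ) (G : 𝓢(EuclideanSpace ℝ (Fin (k + 1)), ℂ)),
      sliceCLM 0 (compSubConstCLM ℂ (-(s • e 0)) G) = sliceCLM s G := by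
    intro s G
    ext p
    simp only [sliceCLM_apply, compSubConstCLM_apply, sub_neg_eq_add, cons_add_smul, zero_add]
  simpa only [ContinuousLinearMap.comp_apply, hs] using h

theorem contDiff_slice (A : 𝓢(EuclideanSpace ℝ (Fin k), ℂ) →L[ℂ] ℂ)
    (H : 𝓢(EuclideanSpace ℝ (Fin (k + 1)), ℂ)) :
    ContDiff ℝ ∞ fun t => A (sliceCLM t H) := by
  refine contDiff_infty.2 fun n => ?_
  induction n generalizing H with
  | zero =>
    exact contDiff_zero.2 (continuous_iff_continuousAt.2 fun t =>
      (hasDerivAt_slice A H t).continuousAt)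
  | succ n ih =>
    rw [Nat.cast_succ, contDiff_succ_iff_deriv]
    refine ⟨fun t => (hasDerivAt_slice A H t).differentiableAt, by simp, ?_⟩
    have : deriv (fun t => A (sliceCLM t H)) = _ := funext fun t => (hasDerivAt_slice A H t).deriv
    rw [this]
    exact ih _

/-- Seminorms of a slice are bounded by those of `H` uniformly in `t`, since `‖p‖ ≤ ‖cons t p‖`. -/
theorem slice_bounded (A : 𝓢(EuclideanSpace ℝ (Fin k), ℂ) →L[ℂ] ℂ)
    (H : 𝓢(EuclideanSpace ℝ (Fin (k + 1)), ℂ)) : ∃ C : ℝ, ∀ t, ‖A (sliceCLM t H)‖ ≤ C := by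
  obtain ⟨s, C, hC0, hC⟩ := exists_seminorm_bound A
  obtain ⟨K, hK0, hK⟩ := finset_sup_seminorm_le
    (schwartzSeminormFamily ℂ (EuclideanSpace ℝ (Fin k)) ℂ) s
    (P := fun t => sliceCLM t H) (T := Set.univ) (w := fun _ => 1) (fun _ => zero_le_one) (by
      rintro ⟨l, j⟩
      refine ⟨SchwartzMap.seminorm ℂ l j H * ‖emb (k := k)‖ ^ j, by positivity, fun t _ => ?_⟩
      refine SchwartzMap.seminorm_le_bound ℂ l j _ (by positivity) fun p => ?_
      have h1 : ‖iteratedFDeriv ℝ j (sliceCLM t H) p‖ ≤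
          ‖iteratedFDeriv ℝ j H (cons t p)‖ * ‖emb (k := k)‖ ^ j := by
        have hf : ContDiff ℝ ∞ fun x => H (t • e 0 + x) :=
          (H.smooth ⊤).comp (contDiff_const.add contDiff_id)
        have := emb.iteratedFDeriv_comp_right hf p (i := j) (by exact_mod_cast le_top)
        change ‖iteratedFDeriv ℝ j ((fun x => H (t • e 0 + x)) ∘ emb) p‖ ≤ _
        rw [this, iteratedFDeriv_comp_add_left]
        refine (ContinuousMultilinearMap.norm_compContinuousLinearMap_le _ _).trans ?_
        simp [cons]
      calc _ ≤ ‖cons t p‖ ^ l * (‖iteratedFDeriv ℝ j H (cons t p)‖ * ‖emb (k := k)‖ ^ j) := by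
            gcongr; exact norm_le_norm_cons t p
        _ = (‖cons t p‖ ^ l * ‖iteratedFDeriv ℝ j H (cons t p)‖) * ‖emb (k := k)‖ ^ j := by ring
        _ ≤ _ := by
          rw [mul_one]; gcongr; exact SchwartzMap.le_seminorm ℂ l j H _)
  exact ⟨C * K, fun t => (hC _).trans (by gcongr; simpa using hK t trivial)⟩

/-- Apply the uniform bound to `(1 + (x⁰)²) H`, whose slice at `t` is `1 + t²` times that of `H`. -/
theorem slice_decay (A : 𝓢(EuclideanSpace ℝ (Fin k), ℂ) →L[ℂ] ℂ)
    (H : 𝓢(EuclideanSpace ℝ (Fin (k + 1)), ℂ)) :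
    ∃ C : ℝ, ∀ t : ℝ, ‖A (sliceCLM t H)‖ ≤ C * (1 + t ^ 2)⁻¹ := by
  have hg : (fun x : EuclideanSpace ℝ (Fin (k + 1)) => ((1 + x 0 ^ 2 : ℝ) : ℂ)).HasTemperateGrowth :=
    hasTemperateGrowth_ofReal_comp
      ((Function.HasTemperateGrowth.const 1).add (hasTemperateGrowth_coord_zero.pow 2))
  obtain ⟨C, hC⟩ := slice_bounded A (smulLeftCLM ℂ
    (fun x : EuclideanSpace ℝ (Fin (k + 1)) => ((1 + x 0 ^ 2 : ℝ) : ℂ)) H)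
  refine ⟨C, fun t => ?_⟩
  have h1 := hC t
  have h2 : sliceCLM t (smulLeftCLM ℂ
      (fun x : EuclideanSpace ℝ (Fin (k + 1)) => ((1 + x 0 ^ 2 : ℝ) : ℂ)) H) =
      ((1 + t ^ 2 : ℝ) : ℂ) • sliceCLM t H := by
    ext p
    rw [sliceCLM_apply, smulLeftCLM_apply_apply hg, cons_zero]
    rfl
  rw [h2, map_smul, norm_smul, Complex.norm_real, Real.norm_of_nonneg (by positivity)] at h1
  rw [← div_eq_mul_inv, le_div_iff₀ (by positivity)]
  linarith

theorem integrable_slice (A : 𝓢(EuclideanSpace ℝ (Fin k), ℂ) →L[ℂ] ℂ)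
    (H : 𝓢(EuclideanSpace ℝ (Fin (k + 1)), ℂ)) : Integrable fun t => A (sliceCLM t H) := by
  obtain ⟨C, hC⟩ := slice_decay A H
  exact (integrable_inv_one_add_sq.const_mul C).mono'
    (contDiff_slice A H).continuous.aestronglyMeasurable (Filter.Eventually.of_forall hC)

theorem exists_schwartz_integral_eq_one : ∃ φ : 𝓢(ℝ, ℂ), ∫ t, φ t = 1 := by
  let b : ContDiffBump (0 : ℝ) := ⟨1, 2, one_pos, one_lt_two⟩
  have hc : HasCompactSupport fun t => (b.normed volume t : ℂ) :=
    b.hasCompactSupport_normed.comp_left (g := Complex.ofReal) rfl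
  have hs : ContDiff ℝ ∞ fun t => (b.normed volume t : ℂ) :=
    Complex.ofRealCLM.contDiff.comp b.contDiff_normed
  refine ⟨hc.toSchwartzMap hs, ?_⟩
  simp only [HasCompactSupport.toSchwartzMap_toFun]
  rw [integral_complex_ofReal, b.integral_normed, Complex.ofReal_one]

/-- A tempered distribution may be interchanged with the integration over a parameter. -/
theorem integral_slice (A : 𝓢(EuclideanSpace ℝ (Fin k), ℂ) →L[ℂ] ℂ)
    (H : 𝓢(EuclideanSpace ℝ (Fin (k + 1)), ℂ)) (h : 𝓢(EuclideanSpace ℝ (Fin k), ℂ))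
    (hh : ∀ p, h p = ∫ t : ℝ, H (cons t p)) : ∫ t, A (sliceCLM t H) = A h := by
  obtain ⟨φ, hφ⟩ := exists_schwartz_integral_eq_one
  -- Subtracting `φ ⊗ h` makes all line integrals vanish, so the difference is `∂₀ G` for a Schwartz
  -- function `G`. Its contribution is the integral of the derivative of a function tending to zero
  -- at both ends, while `φ ⊗ h` contributes `(∫ φ) A h = A h`. No vector-valued integral is needed.
  have hline : ∀ x, ∫ s : ℝ, (H - tensor φ h) (x + s • e 0) = 0 := by
    intro x
    have h1 : ∀ s : ℝ, (H - tensor φ h) (x + s • e 0) =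
        H (cons (x 0 + s) (tail x)) - φ (x 0 + s) * h (tail x) := by
      intro s
      conv_lhs => rw [← cons_tail x, cons_add_smul]
      simp
    have hi : Integrable fun t : ℝ => H (cons t (tail x)) := by
      have := schwartz_line_integrable H (norm_e (0 : Fin (k + 1))) (emb (tail x))
      simpa only [cons, add_comm] using this
    simp only [h1]
    rw [integral_add_left_eq_self (fun s => H (cons s (tail x)) - φ s * h (tail x)) (x 0),
      integral_sub hi (φ.integrable.mul_const _), integral_mul_const, hφ, hh, one_mul, sub_self]
  obtain ⟨G, hG⟩ := exists_lineDeriv_eq (H - tensor φ h) (norm_e (0 : Fin (k + 1))) hline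
  obtain ⟨C, hC⟩ := slice_decay A G
  have hlim : ∀ l : Filter ℝ, Filter.Tendsto (fun t : ℝ => t ^ 2) l Filter.atTop →
      Filter.Tendsto (fun t => A (sliceCLM t G)) l (nhds 0) := by
    intro l hl
    refine squeeze_zero_norm hC ?_
    simpa using (Filter.tendsto_atTop_add_const_left _ 1 hl).inv_tendsto_atTop.const_mul C
  have h0 : ∫ t, A (sliceCLM t (∂_{(e 0 : EuclideanSpace ℝ (Fin (k + 1)))} G)) = 0 := by
    rw [integral_of_hasDerivAt_of_tendsto (hasDerivAt_slice A G) (integrable_slice A _)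
      (hlim _ ?_) (hlim _ (Filter.tendsto_pow_atTop two_ne_zero)), sub_self]
    simpa [Function.comp_def] using
      (Filter.tendsto_pow_atTop (α := ℝ) two_ne_zero).comp Filter.tendsto_abs_atBot_atTop
  have h2 : ∀ t, A (sliceCLM t H) = A (sliceCLM t (∂_{(e 0 : EuclideanSpace ℝ (Fin (k + 1)))} G)) + φ t * A h := by
    intro t
    have : sliceCLM t (tensor φ h) = φ t • h := by ext p; simp
    rw [hG, map_sub, map_sub, this, map_smul, smul_eq_mul, sub_add_cancel]
  simp only [h2]
  rw [integral_add (integrable_slice A _) (φ.integrable.mul_const _), h0, integral_mul_const, hφ,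
    zero_add, one_mul]

end Slices

/-! ### Oscillating families -/

section Phase

theorem hasTemperateGrowth_exp_I :
    (fun s : ℝ => Complex.exp (-(Complex.I * s))).HasTemperateGrowth := by
  have hd : ∀ n, iteratedDeriv n (fun s : ℝ => Complex.exp (-(Complex.I * s))) =
      fun s : ℝ => (-Complex.I) ^ n * Complex.exp (-(Complex.I * s)) := by
    intro n
    induction n with
    | zero => simp
    | succ n ih =>
      rw [iteratedDeriv_succ, ih]
      ext s
      have h1 : HasDerivAt (fun s : ℝ => -(Complex.I * s)) (-(Complex.I * 1)) s :=
        ((Complex.ofRealCLM.hasDerivAt (x := s)).const_mul Complex.I).neg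
      rw [((h1.cexp).const_mul ((-Complex.I) ^ n)).deriv]
      ring
  refine ⟨(contDiff_const.mul Complex.ofRealCLM.contDiff).neg.cexp, fun n => ⟨0, 1, fun s => ?_⟩⟩
  rw [norm_iteratedFDeriv_eq_norm_iteratedDeriv, hd]
  simp [Complex.norm_exp]

variable {k : ℕ}

/-- The oscillating factor `exp(-i t θ)`. -/
def phase (θ : EuclideanSpace ℝ (Fin k) → ℝ) (t : ℝ) (p : EuclideanSpace ℝ (Fin k)) : ℂ :=
  Complex.exp (-(Complex.I * (t * θ p : ℝ)))

theorem hasTemperateGrowth_phase {θ : EuclideanSpace ℝ (Fin k) → ℝ} (hθ : θ.HasTemperateGrowth)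
    (t : ℝ) : (phase θ t).HasTemperateGrowth :=
  hasTemperateGrowth_exp_I.comp ((Function.HasTemperateGrowth.const t).mul hθ)

theorem phase_zero (θ : EuclideanSpace ℝ (Fin k) → ℝ) : phase θ 0 = fun _ => 1 := by
  ext p; simp [phase]

/-- The Schwartz function `(t, p) ↦ f(t) exp(-i t θ(p)) h(p)`. -/
def phaseTensor (θ : EuclideanSpace ℝ (Fin k) → ℝ) (f : 𝓢(ℝ, ℂ))
    (h : 𝓢(EuclideanSpace ℝ (Fin k), ℂ)) : 𝓢(EuclideanSpace ℝ (Fin (k + 1)), ℂ) :=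
  smulLeftCLM ℂ (fun x => phase θ (x 0) (tail x)) (tensor f h)

theorem phaseTensor_apply {θ : EuclideanSpace ℝ (Fin k) → ℝ} (hθ : θ.HasTemperateGrowth)
    (f : 𝓢(ℝ, ℂ)) (h : 𝓢(EuclideanSpace ℝ (Fin k), ℂ)) (x : EuclideanSpace ℝ (Fin (k + 1))) :
    phaseTensor θ f h x = phase θ (x 0) (tail x) * (f (x 0) * h (tail x)) := by
  have hg : (fun x : EuclideanSpace ℝ (Fin (k + 1)) =>
      phase θ (x 0) (tail x)).HasTemperateGrowth :=
    hasTemperateGrowth_exp_I.comp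
      (hasTemperateGrowth_coord_zero.mul (hθ.comp tail.hasTemperateGrowth))
  rw [phaseTensor, smulLeftCLM_apply_apply hg]
  rfl

theorem slice_phaseTensor {θ : EuclideanSpace ℝ (Fin k) → ℝ} (hθ : θ.HasTemperateGrowth)
    (f : 𝓢(ℝ, ℂ)) (h : 𝓢(EuclideanSpace ℝ (Fin k), ℂ)) (t : ℝ) :
    sliceCLM t (phaseTensor θ f h) = f t • smulLeftCLM ℂ (phase θ t) h := by
  ext p
  simp [phaseTensor_apply hθ, smulLeftCLM_apply_apply (hasTemperateGrowth_phase hθ t),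
    mul_left_comm]

/-- The function `exp(-itθ) h` does not decay in `t`, so it is not a Schwartz function of both
variables. Smoothness being local, a bump function equal to `1` near `t₀` reduces the claim to
slices of a Schwartz function. -/
theorem contDiff_phase {θ : EuclideanSpace ℝ (Fin k) → ℝ} (hθ : θ.HasTemperateGrowth)
    (A : 𝓢(EuclideanSpace ℝ (Fin k), ℂ) →L[ℂ] ℂ) (h : 𝓢(EuclideanSpace ℝ (Fin k), ℂ)) :
    ContDiff ℝ ∞ fun t => A (smulLeftCLM ℂ (phase θ t) h) := by
  refine contDiff_iff_contDiffAt.2 fun t₀ => ?_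
  let b : ContDiffBump t₀ := ⟨1, 2, one_pos, one_lt_two⟩
  have hc : HasCompactSupport fun t => (b t : ℂ) :=
    b.hasCompactSupport.comp_left (g := Complex.ofReal) rfl
  have hs : ContDiff ℝ ∞ fun t => (b t : ℂ) := Complex.ofRealCLM.contDiff.comp b.contDiff
  let f : 𝓢(ℝ, ℂ) := hc.toSchwartzMap hs
  refine (contDiff_slice A (phaseTensor θ f h)).contDiffAt.congr_of_eventuallyEq ?_
  filter_upwards [Metric.closedBall_mem_nhds t₀ one_pos] with t ht
  have : f t = 1 := by
    change (b t : ℂ) = 1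
    rw [b.one_of_mem_closedBall ht, Complex.ofReal_one]
  rw [slice_phaseTensor hθ, this, one_smul]

theorem integrable_phase {θ : EuclideanSpace ℝ (Fin k) → ℝ} (hθ : θ.HasTemperateGrowth)
    (A : 𝓢(EuclideanSpace ℝ (Fin k), ℂ) →L[ℂ] ℂ) (h : 𝓢(EuclideanSpace ℝ (Fin k), ℂ))
    (f : 𝓢(ℝ, ℂ)) : Integrable fun t => A (smulLeftCLM ℂ (phase θ t) h) * f t := by
  have := integrable_slice A (phaseTensor θ f h)
  simpa only [slice_phaseTensor hθ, map_smul, smul_eq_mul, mul_comm] using this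

/-- Hypothesis `hw` is the form taken by the shell restriction of a tensor product, both for `x⁰ =
t` and for `x⁺ = t`; only the frequency `θ` differs. -/
theorem integral_phase {θ : EuclideanSpace ℝ (Fin k) → ℝ} (hθ : θ.HasTemperateGrowth)
    (A : 𝓢(EuclideanSpace ℝ (Fin k), ℂ) →L[ℂ] ℂ) (h : 𝓢(EuclideanSpace ℝ (Fin k), ℂ))
    (f : 𝓢(ℝ, ℂ)) (w : 𝓢(EuclideanSpace ℝ (Fin k), ℂ))
    (hw : ∀ p, w p = (∫ t : ℝ, Complex.exp (-(Complex.I * (t * θ p : ℝ))) * f t) * h p) :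
    ∫ t, A (smulLeftCLM ℂ (phase θ t) h) * f t = A w := by
  rw [← integral_slice A (phaseTensor θ f h) w]
  · simp only [slice_phaseTensor hθ, map_smul, smul_eq_mul, mul_comm]
  · intro p
    simp only [phaseTensor_apply hθ, cons_zero, tail_cons, ← mul_assoc]
    rw [integral_mul_const, hw]
    rfl

end Phase

/-! ### Functions on the complement of the hyperplane `p⁺ = 0` -/

section Weight

variable {d : ℕ}

/-- The open set `{p⁺ ≠ 0}`. -/
def offPlane (d : ℕ) : Set (Sp d) := {q | q 0 ≠ 0}

theorem isOpen_offPlane : IsOpen (offPlane d) :=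
  isOpen_ne_fun (by fun_prop) continuous_const

/-- The weight `(1 + ‖p‖) (1 + 1/|p⁺|)`. -/
def weight (q : Sp d) : ℝ := (1 + ‖q‖) * (1 + |q 0|⁻¹)

theorem abs_coord_le_norm {k : ℕ} (x : EuclideanSpace ℝ (Fin k)) (i : Fin k) : |x i| ≤ ‖x‖ := by
  simpa using PiLp.norm_apply_le x i

theorem one_add_norm_le_weight (q : Sp d) : 1 + ‖q‖ ≤ weight q := by
  have : 0 ≤ |q 0|⁻¹ := by positivity
  unfold weight
  nlinarith [norm_nonneg q]

theorem one_add_inv_le_weight (q : Sp d) : 1 + |q 0|⁻¹ ≤ weight q := by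
  have : 0 ≤ |q 0|⁻¹ := by positivity
  unfold weight
  nlinarith [norm_nonneg q, mul_nonneg (norm_nonneg q) this]

theorem one_le_weight (q : Sp d) : 1 ≤ weight q :=
  le_trans (by linarith [norm_nonneg q]) (one_add_norm_le_weight q)

theorem weight_pos (q : Sp d) : 0 < weight q := one_pos.trans_le (one_le_weight q)

theorem norm_le_weight (q : Sp d) : ‖q‖ ≤ weight q :=
  le_trans (by linarith) (one_add_norm_le_weight q)

theorem inv_le_weight (q : Sp d) : |q 0|⁻¹ ≤ weight q :=
  le_trans (by linarith) (one_add_inv_le_weight q)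

/-- Together with `pow_weight_le`, this replaces the seminorms of the squeezed space by suprema of
`weight ^ K * ‖Dʲ f‖`. A single weight, always at least `1`, is far easier to carry through the
Leibniz and chain rules. -/
theorem zpow_mul_pow_le_weight (a : ℤ) (l : ℕ) (q : Sp d) :
    |q 0| ^ a * ‖q‖ ^ l ≤ weight q ^ (a.natAbs + l) := by
  have h : |q 0| ^ a ≤ weight q ^ a.natAbs := by
    rcases Int.natAbs_eq a with h | h
    · rw [h, zpow_natCast, Int.natAbs_natCast]
      gcongr
      exact (abs_coord_le_norm q 0).trans (norm_le_weight q)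
    · rw [h, zpow_neg, zpow_natCast, Int.natAbs_neg, Int.natAbs_natCast, ← inv_pow]
      gcongr
      exact inv_le_weight q
  rw [pow_add]
  gcongr
  · exact pow_nonneg (weight_pos q).le _
  · exact norm_le_weight q

theorem pow_weight_le (K : ℕ) (q : Sp d) :
    weight q ^ K ≤ 4 ^ K * ((1 + ‖q‖ ^ K) * (1 + |q 0| ^ (-(K : ℤ)))) := by
  have h : ∀ x : ℝ, 0 ≤ x → (1 + x) ^ K ≤ 2 ^ K * (1 + x ^ K) := by
    intro x hx
    have h1 : 1 + x ≤ 2 * max 1 x := by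
      have := le_max_left 1 x; have := le_max_right 1 x; linarith
    calc (1 + x) ^ K ≤ (2 * max 1 x) ^ K := by gcongr
      _ = 2 ^ K * max 1 x ^ K := mul_pow _ _ _
      _ ≤ _ := by
        gcongr
        rcases max_cases 1 x with ⟨h, _⟩ | ⟨h, _⟩ <;> rw [h]
        · simp only [one_pow, le_add_iff_nonneg_right]; positivity
        · linarith
  rw [weight, mul_pow, zpow_neg, zpow_natCast, ← inv_pow]
  calc _ ≤ (2 ^ K * (1 + ‖q‖ ^ K)) * (2 ^ K * (1 + |q 0|⁻¹ ^ K)) := by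
        gcongr
        · exact h _ (norm_nonneg q)
        · exact h _ (by positivity)
    _ = (2 * 2) ^ K * ((1 + ‖q‖ ^ K) * (1 + |q 0|⁻¹ ^ K)) := by rw [mul_pow]; ring
    _ = _ := by norm_num

/-- Smooth functions on `{p⁺ ≠ 0}` all of whose derivatives are bounded by powers of the
weight. -/
def IsWeighted {F : Type*} [NormedAddCommGroup F] [NormedSpace ℝ F] (M : Sp d → F) : Prop :=
  (∀ q ∈ offPlane d, ContDiffAt ℝ ∞ M q) ∧ ∀ j : ℕ, ∃ (k : ℕ) (C : ℝ), 0 ≤ C ∧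
    ∀ q ∈ offPlane d, ‖iteratedFDeriv ℝ j M q‖ ≤ C * weight q ^ k

section

variable {F : Type*} [NormedAddCommGroup F] [NormedSpace ℝ F] {M N : Sp d → F} {c : Sp d → ℝ}

theorem IsWeighted.uniform (hM : IsWeighted M) (n : ℕ) : ∃ (k : ℕ) (C : ℝ), 0 ≤ C ∧
    ∀ j ≤ n, ∀ q ∈ offPlane d, ‖iteratedFDeriv ℝ j M q‖ ≤ C * weight q ^ k := by
  choose k C hC0 hC using hM.2
  refine ⟨∑ j ∈ Finset.range (n + 1), k j, ∑ j ∈ Finset.range (n + 1), C j,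
    Finset.sum_nonneg fun j _ => hC0 j, fun j hj q hq => (hC j q hq).trans ?_⟩
  have hj' : j ∈ Finset.range (n + 1) := Finset.mem_range.2 (by omega)
  have h1 : C j ≤ ∑ j ∈ Finset.range (n + 1), C j :=
    Finset.single_le_sum (fun j _ => hC0 j) hj'
  have h2 : k j ≤ ∑ j ∈ Finset.range (n + 1), k j :=
    Finset.single_le_sum (fun j _ => Nat.zero_le _) hj'
  exact mul_le_mul h1 (pow_le_pow_right₀ (one_le_weight q) h2) (pow_nonneg (weight_pos q).le _)
    ((hC0 j).trans h1)

theorem IsWeighted.contDiffOn (hM : IsWeighted M) : ContDiffOn ℝ ∞ M (offPlane d) :=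
  fun q hq => (hM.1 q hq).contDiffWithinAt

theorem IsWeighted.congr (hM : IsWeighted M) (h : ∀ q ∈ offPlane d, N q = M q) :
    IsWeighted N := by
  have he : ∀ q ∈ offPlane d, N =ᶠ[nhds q] M := fun q hq => by
    filter_upwards [isOpen_offPlane.mem_nhds hq] with y hy using h y hy
  refine ⟨fun q hq => (hM.1 q hq).congr_of_eventuallyEq (he q hq), fun j => ?_⟩
  obtain ⟨k, C, hC0, hC⟩ := hM.2 j
  refine ⟨k, C, hC0, fun q hq => ?_⟩
  rw [((he q hq).iteratedFDeriv ℝ j).eq_of_nhds]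
  exact hC q hq

theorem isWeighted_of_temperate (hM : M.HasTemperateGrowth) : IsWeighted M := by
  refine ⟨fun q _ => hM.1.contDiffAt, fun j => ?_⟩
  obtain ⟨k, C, hC0, hC⟩ := hM.norm_iteratedFDeriv_le_uniform j
  refine ⟨k, C, hC0, fun q _ => (hC j le_rfl q).trans ?_⟩
  gcongr
  exact one_add_norm_le_weight q

theorem IsWeighted.add (hM : IsWeighted M) (hN : IsWeighted N) :
    IsWeighted fun q => M q + N q := by
  refine ⟨fun q hq => (hM.1 q hq).add (hN.1 q hq), fun j => ?_⟩
  obtain ⟨k₁, C₁, h₁0, h₁⟩ := hM.2 j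
  obtain ⟨k₂, C₂, h₂0, h₂⟩ := hN.2 j
  refine ⟨k₁ + k₂, C₁ + C₂, by positivity, fun q hq => ?_⟩
  have hj : (j : ℕ∞ω) ≤ ∞ := by exact_mod_cast le_top
  have : iteratedFDeriv ℝ j (fun q => M q + N q) q =
      iteratedFDeriv ℝ j M q + iteratedFDeriv ℝ j N q :=
    iteratedFDeriv_add_apply ((hM.1 q hq).of_le hj) ((hN.1 q hq).of_le hj)
  rw [this, add_mul]
  refine (norm_add_le _ _).trans (add_le_add ((h₁ q hq).trans ?_) ((h₂ q hq).trans ?_))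
  · gcongr
    · exact one_le_weight q
    · omega
  · gcongr
    · exact one_le_weight q
    · omega

theorem norm_iteratedFDeriv_smul_le_of_contDiffAt {𝕜 : Type*} [NontriviallyNormedField 𝕜]
    [NormedAlgebra ℝ 𝕜] [NormedSpace 𝕜 F] [IsScalarTower ℝ 𝕜 F] {b : Sp d → 𝕜}
    (hb : ContDiffOn ℝ ∞ b (offPlane d)) (hM : ContDiffOn ℝ ∞ M (offPlane d)) (j : ℕ)
    {q : Sp d} (hq : q ∈ offPlane d) :
    ‖iteratedFDeriv ℝ j (fun q => b q • M q) q‖ ≤ ∑ i ∈ Finset.range (j + 1),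
      (j.choose i : ℝ) * ‖iteratedFDeriv ℝ i b q‖ * ‖iteratedFDeriv ℝ (j - i) M q‖ := by
  have h := norm_iteratedFDerivWithin_smul_le hb hM isOpen_offPlane.uniqueDiffOn hq (n := j)
    (by exact_mod_cast le_top)
  simpa only [iteratedFDerivWithin_of_isOpen _ isOpen_offPlane hq] using h

theorem IsWeighted.smul {𝕜 : Type*} [NontriviallyNormedField 𝕜]
    [NormedAlgebra ℝ 𝕜] [NormedSpace 𝕜 F] [IsScalarTower ℝ 𝕜 F] {b : Sp d → 𝕜}
    (hb : IsWeighted b) (hM : IsWeighted M) : IsWeighted fun q => b q • M q := by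
  refine ⟨fun q hq => (hb.1 q hq).smul (hM.1 q hq), fun j => ?_⟩
  obtain ⟨k₁, C₁, h₁0, h₁⟩ := hb.uniform j
  obtain ⟨k₂, C₂, h₂0, h₂⟩ := hM.uniform j
  refine ⟨k₁ + k₂, ∑ i ∈ Finset.range (j + 1), (j.choose i : ℝ) * C₁ * C₂, by positivity,
    fun q hq => ?_⟩
  refine (norm_iteratedFDeriv_smul_le_of_contDiffAt hb.contDiffOn hM.contDiffOn j hq).trans ?_
  rw [Finset.sum_mul]
  refine Finset.sum_le_sum fun i hi => ?_
  have hw := weight_pos q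
  calc _ ≤ (j.choose i : ℝ) * (C₁ * weight q ^ k₁) * (C₂ * weight q ^ k₂) := by
        gcongr
        · exact h₁ i (by have := Finset.mem_range.1 hi; omega) q hq
        · exact h₂ (j - i) (Nat.sub_le _ _) q hq
    _ = _ := by rw [pow_add]; ring

/-- Strong induction on the order: the derivative of `1/p⁺` is `-(1/p⁺)²` times a fixed functional,
so by the Leibniz rule each order is controlled by products of lower ones. -/
theorem isWeighted_inv : IsWeighted fun q : Sp d => (q 0)⁻¹ := by
  let P : Sp d →L[ℝ] ℝ := EuclideanSpace.proj 0
  have hsm : ∀ q ∈ offPlane d, ContDiffAt ℝ ∞ (fun q : Sp d => (q 0)⁻¹) q :=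
    fun q hq => P.contDiff.contDiffAt.inv hq
  refine ⟨hsm, fun j => ?_⟩
  induction j using Nat.strong_induction_on with
  | _ j ih =>
  rcases j with _ | j
  · refine ⟨1, 1, zero_le_one, fun q _ => ?_⟩
    rw [norm_iteratedFDeriv_zero, norm_inv, Real.norm_eq_abs, one_mul, pow_one]
    exact inv_le_weight q
  · choose! k C hC0 hC using ih
    have hk : ∃ K, ∀ i ≤ j, k i ≤ K :=
      ⟨∑ i ∈ Finset.range (j + 1), k i, fun i hi =>
        Finset.single_le_sum (fun i _ => Nat.zero_le _) (Finset.mem_range.2 (by omega))⟩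
    have hB : ∃ B : ℝ, 0 ≤ B ∧ ∀ i ≤ j, C i ≤ B :=
      ⟨∑ i ∈ Finset.range (j + 1), |C i|, Finset.sum_nonneg fun i _ => abs_nonneg _, fun i hi =>
        (le_abs_self _).trans (Finset.single_le_sum (f := fun i => |C i|)
          (fun i _ => abs_nonneg _) (Finset.mem_range.2 (by omega)))⟩
    obtain ⟨K, hK⟩ := hk
    obtain ⟨B, hB0, hB⟩ := hB
    have hall : ∀ i ≤ j, ∀ q ∈ offPlane d,
        ‖iteratedFDeriv ℝ i (fun q : Sp d => (q 0)⁻¹) q‖ ≤ B * weight q ^ K := by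
      intro i hi q hq
      refine (hC i (by omega) q hq).trans ?_
      exact mul_le_mul (hB i hi) (pow_le_pow_right₀ (one_le_weight q) (hK i hi))
        (pow_nonneg (weight_pos q).le _) hB0
    have hon : ContDiffOn ℝ ∞ (fun q : Sp d => (q 0)⁻¹) (offPlane d) :=
      fun q hq => (hsm q hq).contDiffWithinAt
    refine ⟨K + K, (∑ i ∈ Finset.range (j + 1), (j.choose i : ℝ) * B * B) * ‖-P‖, by positivity,
      fun q hq => ?_⟩
    have hd : fderiv ℝ (fun q : Sp d => (q 0)⁻¹) =ᶠ[nhds q]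
        fun q => ((q 0)⁻¹ • (q 0)⁻¹) • (-P) := by
      filter_upwards [isOpen_offPlane.mem_nhds hq] with y hy
      have h1 : HasFDerivAt (fun q : Sp d => (q 0)⁻¹) _ y :=
        (hasDerivAt_inv (show y 0 ≠ 0 from hy)).comp_hasFDerivAt y P.hasFDerivAt
      rw [h1.fderiv]
      ext v
      simp [P, pow_two]
    rw [← norm_iteratedFDeriv_fderiv, (hd.iteratedFDeriv ℝ j).eq_of_nhds]
    have hw := weight_pos q
    have h2 : ‖iteratedFDeriv ℝ j (fun q : Sp d => (q 0)⁻¹ • (q 0)⁻¹) q‖ ≤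
        (∑ i ∈ Finset.range (j + 1), (j.choose i : ℝ) * B * B) * weight q ^ (K + K) := by
      refine (norm_iteratedFDeriv_smul_le_of_contDiffAt hon hon j hq).trans ?_
      rw [Finset.sum_mul]
      refine Finset.sum_le_sum fun i hi => ?_
      calc _ ≤ (j.choose i : ℝ) * (B * weight q ^ K) * (B * weight q ^ K) := by
            gcongr
            · exact hall i (by have := Finset.mem_range.1 hi; omega) q hq
            · exact hall (j - i) (Nat.sub_le _ _) q hq
        _ = _ := by rw [pow_add]; ring
    have h3 : ‖iteratedFDeriv ℝ j (fun q : Sp d => ((q 0)⁻¹ • (q 0)⁻¹) • (-P)) q‖ ≤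
        ‖-P‖ * ‖iteratedFDeriv ℝ j (fun q : Sp d => (q 0)⁻¹ • (q 0)⁻¹) q‖ := by
      have hc : ContDiffAt ℝ j (fun q : Sp d => (q 0)⁻¹ • (q 0)⁻¹) q :=
        ((hsm q hq).smul (hsm q hq)).of_le (by exact_mod_cast le_top)
      have := ((ContinuousLinearMap.id ℝ ℝ).smulRight (-P)).norm_iteratedFDeriv_comp_left hc le_rfl
      refine this.trans ?_
      gcongr
      simp
    calc _ ≤ _ := h3
      _ ≤ ‖-P‖ * ((∑ i ∈ Finset.range (j + 1), (j.choose i : ℝ) * B * B) *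
          weight q ^ (K + K)) := by gcongr
      _ = _ := by ring

/-- The sign of `p⁺` is locally constant on `offPlane d`, so near each of its points the glued
function coincides with one of the two. -/
theorem IsWeighted.ite (hM : IsWeighted M) (hN : IsWeighted N) (σ : ℝ)
    [DecidablePred fun q : Sp d => 0 < σ * q 0] :
    IsWeighted fun q => if 0 < σ * q 0 then M q else N q := by
  have key : ∀ q ∈ offPlane d, (fun q => if 0 < σ * q 0 then M q else N q) =ᶠ[nhds q] M ∨
      (fun q => if 0 < σ * q 0 then M q else N q) =ᶠ[nhds q] N := by
    intro q hq
    have hc : Continuous fun q : Sp d => σ * q 0 := by fun_prop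
    rcases eq_or_ne σ 0 with rfl | hσ
    · exact Or.inr (Filter.Eventually.of_forall fun y => by simp)
    · rcases lt_or_gt_of_ne (mul_ne_zero hσ hq) with h | h
      · right
        filter_upwards [(isOpen_lt hc continuous_const).mem_nhds h] with y hy
        exact if_neg (not_lt.2 (le_of_lt hy))
      · left
        filter_upwards [(isOpen_lt continuous_const hc).mem_nhds h] with y hy
        exact if_pos hy
  refine ⟨fun q hq => ?_, fun j => ?_⟩
  · rcases key q hq with h | h
    · exact (hM.1 q hq).congr_of_eventuallyEq h
    · exact (hN.1 q hq).congr_of_eventuallyEq h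
  · obtain ⟨k₁, C₁, h₁0, h₁⟩ := hM.2 j
    obtain ⟨k₂, C₂, h₂0, h₂⟩ := hN.2 j
    refine ⟨k₁ + k₂, C₁ + C₂, by positivity, fun q hq => ?_⟩
    have hw := one_le_weight q
    have hw0 := weight_pos q
    rcases key q hq with h | h <;> rw [(h.iteratedFDeriv ℝ j).eq_of_nhds]
    · refine (h₁ q hq).trans (mul_le_mul (by linarith) ?_ (by positivity) (by positivity))
      exact pow_le_pow_right₀ hw (by omega)
    · refine (h₂ q hq).trans (mul_le_mul (by linarith) ?_ (by positivity) (by positivity))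
      exact pow_le_pow_right₀ hw (by omega)

end

theorem isWeighted_coord : IsWeighted fun q : Sp d => q 0 :=
  isWeighted_of_temperate hasTemperateGrowth_coord_zero

theorem isWeighted_ofReal {c : Sp d → ℝ} (hc : IsWeighted c) : IsWeighted fun q => (c q : ℂ) := by
  have h := hc.smul (isWeighted_of_temperate (d := d) (.const (1 : ℂ)))
  exact h.congr fun q _ => by simp

theorem isWeighted_abs : IsWeighted fun q : Sp d => |q 0| := by
  classical
  have hn : IsWeighted fun q : Sp d => -(q 0) :=
    isWeighted_of_temperate hasTemperateGrowth_coord_zero.neg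
  refine (isWeighted_coord.ite hn 1).congr fun q _ => ?_
  split_ifs with h
  · exact abs_of_pos (by simpa using h)
  · exact abs_of_nonpos (by simpa using h)

theorem isWeighted_abs_inv : IsWeighted fun q : Sp d => |q 0|⁻¹ := by
  have h := (isWeighted_inv.smul isWeighted_inv).smul (isWeighted_abs (d := d))
  refine h.congr fun q hq => ?_
  have hq : q 0 ≠ 0 := hq
  rw [smul_eq_mul, smul_eq_mul, ← mul_inv, ← abs_mul_abs_self (q 0)]
  have : |q 0| ≠ 0 := abs_ne_zero.2 hq
  field_simp

/-- A function which is smooth off the hyperplane `p⁺ = 0` and tends to zero there rapidly with all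
its derivatives is smooth. -/
theorem contDiff_of_rapid_decay {h : Sp d → ℂ} (h0 : ∀ q, q 0 = 0 → h q = 0)
    (hs : ∀ q ∈ offPlane d, ContDiffAt ℝ ∞ h q)
    (hb : ∀ j : ℕ, ∃ C : ℝ, ∀ q ∈ offPlane d, weight q ^ 2 * ‖iteratedFDeriv ℝ j h q‖ ≤ C) :
    ContDiff ℝ ∞ h := by
  classical
  -- The candidate Taylor series consists of the iterated derivatives off the hyperplane, extended
  -- by zero. Only differentiability at points of the hyperplane has to be checked by hand.
  let p : Sp d → FormalMultilinearSeries ℝ (Sp d) ℂ :=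
    fun q j => if q 0 ≠ 0 then iteratedFDeriv ℝ j h q else 0
  have hder : ∀ (m : ℕ) (x : Sp d), HasFDerivAt (fun q => p q m) (p x m.succ).curryLeft x := by
    intro m x
    by_cases hx : x 0 = 0
    · have hp : p x m.succ = 0 := if_neg (not_not.2 hx)
      have hpm : p x m = 0 := if_neg (not_not.2 hx)
      have hz : (p x m.succ).curryLeft = 0 := by rw [hp]; rfl
      rw [hz, hasFDerivAt_iff_isLittleO]
      obtain ⟨C, hC⟩ := hb m
      -- For `x` on the hyperplane `|y⁺| ≤ ‖y - x‖`, and `weight y ≥ 1/|y⁺|`. Decay against the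
      -- square of the weight therefore makes the increment `O(‖y - x‖²)`, and the derivative is
      -- zero.
      have hO : (fun y => p y m - p x m - (0 : Sp d →L[ℝ] _) (y - x)) =O[nhds x]
          fun y => ‖y - x‖ ^ 2 := by
        refine Asymptotics.IsBigO.of_bound |C| (Filter.Eventually.of_forall fun y => ?_)
        rw [hpm, sub_zero, zero_apply, sub_zero]
        by_cases hy : y 0 = 0
        · have : p y m = 0 := if_neg (not_not.2 hy)
          rw [this, norm_zero]
          positivity
        · have : p y m = iteratedFDeriv ℝ m h y := if_pos hy
          rw [this, norm_pow, norm_norm]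
          have h1 : |y 0| ≤ ‖y - x‖ := by simpa [hx] using abs_coord_le_norm (y - x) 0
          have hy0 : 0 < |y 0| := abs_pos.2 hy
          have h2 : 1 ≤ |y 0| * weight y := by
            have := inv_le_weight y
            rwa [inv_le_iff_one_le_mul₀ hy0, mul_comm] at this
          calc ‖iteratedFDeriv ℝ m h y‖ ≤ (|y 0| * weight y) ^ 2 * ‖iteratedFDeriv ℝ m h y‖ :=
                le_mul_of_one_le_left (norm_nonneg _) (one_le_pow₀ h2)
            _ = |y 0| ^ 2 * (weight y ^ 2 * ‖iteratedFDeriv ℝ m h y‖) := by ring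
            _ ≤ ‖y - x‖ ^ 2 * |C| := by
              gcongr
              exact (hC y hy).trans (le_abs_self C)
            _ = _ := mul_comm _ _
      refine hO.trans_isLittleO ?_
      have h2 : (fun y : Sp d => ‖y - x‖ ^ 2) =o[nhds x] fun y => y - x := by
        have := (Asymptotics.isLittleO_norm_pow_id (E' := Sp d) (n := 2) (by norm_num)).comp_tendsto
          (tendsto_sub_nhds_zero_iff.2 (Filter.tendsto_id (x := nhds x)))
        simpa [Function.comp_def] using this
      exact h2
    · have hU := isOpen_offPlane.mem_nhds (show x ∈ offPlane d from hx)
      have he : (fun q => p q m) =ᶠ[nhds x] iteratedFDeriv ℝ m h := by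
        filter_upwards [hU] with y hy using if_pos hy
      have hp : p x m.succ = iteratedFDeriv ℝ m.succ h x := if_pos hx
      refine HasFDerivAt.congr_of_eventuallyEq ?_ he
      have hd : DifferentiableAt ℝ (iteratedFDeriv ℝ m h) x :=
        (hs x hx).differentiableAt_iteratedFDeriv (by exact_mod_cast WithTop.coe_lt_top m)
      have hc : (iteratedFDeriv ℝ m.succ h x).curryLeft = fderiv ℝ (iteratedFDeriv ℝ m h) x := by
        rw [fderiv_iteratedFDeriv]; rfl
      rw [hp, hc]
      exact hd.hasFDerivAt
  have hT : HasFTaylorSeriesUpTo ∞ h p := by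
    refine ⟨fun x => ?_, fun m _ x => hder m x, fun m _ => ?_⟩
    · by_cases hx : x 0 = 0
      · rw [h0 x hx]
        change ((if x 0 ≠ 0 then iteratedFDeriv ℝ 0 h x else 0) : _) _ = 0
        rw [if_neg (not_not.2 hx)]
        rfl
      · change ((if x 0 ≠ 0 then iteratedFDeriv ℝ 0 h x else 0) : _) _ = h x
        rw [if_pos hx]
        rfl
    · exact continuous_iff_continuousAt.2 fun x => (hder m x).continuousAt
  exact hT.contDiff

end Weight

/-! ### Continuous linear maps between Schwartz spaces and squeezed spaces -/

section SqueezedMaps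

variable {d : ℕ}

/-- The seminorms of the squeezed Schwartz space. -/
def sqSeminorms (d : ℕ) : SeminormFamily ℂ (SqueezedSpace d) (ℤ × ℕ × ℕ) := squeezedSeminorm d

theorem squeezed_withSeminorms (d : ℕ) : WithSeminorms (sqSeminorms d) := ⟨rfl⟩

theorem cSqueezed_injective : Function.Injective (cSqueezed (d := d)) := Subtype.val_injective

theorem cSqueezed_add (f g : SqueezedSpace d) : cSqueezed (f + g) = cSqueezed f + cSqueezed g := rfl

theorem cSqueezed_smul (c : ℂ) (f : SqueezedSpace d) : cSqueezed (c • f) = c • cSqueezed f := rfl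

theorem contDiff_cSqueezed (f : SqueezedSpace d) : ContDiff ℝ ∞ (cSqueezed f) := f.2.1

theorem le_sqSeminorms (i : ℤ × ℕ × ℕ) (f : SqueezedSpace d) {q : Sp d} (hq : q ∈ offPlane d) :
    |q 0| ^ i.1 * ‖q‖ ^ i.2.1 * ‖iteratedFDeriv ℝ i.2.2 (cSqueezed f) q‖ ≤ sqSeminorms d i f :=
  le_ciSup (squeezed_bddAbove i f) ⟨q, hq⟩

theorem sqSeminorms_le (i : ℤ × ℕ × ℕ) (f : SqueezedSpace d) {C : ℝ} (hC : 0 ≤ C)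
    (h : ∀ q ∈ offPlane d,
      |q 0| ^ i.1 * ‖q‖ ^ i.2.1 * ‖iteratedFDeriv ℝ i.2.2 (cSqueezed f) q‖ ≤ C) :
    sqSeminorms d i f ≤ C :=
  Real.iSup_le (fun q => h q.1 q.2) hC

theorem weight_bound_sup (K n : ℕ) : ∃ (s : Finset (ℤ × ℕ × ℕ)) (C : ℝ), 0 ≤ C ∧
    ∀ (f : SqueezedSpace d), ∀ j ≤ n, ∀ q ∈ offPlane d,
      weight q ^ K * ‖iteratedFDeriv ℝ j (cSqueezed f) q‖ ≤ C * s.sup (sqSeminorms d) f := by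
  classical
  let s : Finset (ℤ × ℕ × ℕ) :=
    ({0, -(K : ℤ)} : Finset ℤ) ×ˢ (({0, K} : Finset ℕ) ×ˢ Finset.range (n + 1))
  refine ⟨s, 4 ^ K * 4, by positivity, fun f j hj q hq => ?_⟩
  have key : ∀ a ∈ ({0, -(K : ℤ)} : Finset ℤ), ∀ l ∈ ({0, K} : Finset ℕ),
      |q 0| ^ a * ‖q‖ ^ l * ‖iteratedFDeriv ℝ j (cSqueezed f) q‖ ≤ s.sup (sqSeminorms d) f := by
    intro a ha l hl
    have hm : (a, l, j) ∈ s :=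
      Finset.mk_mem_product ha (Finset.mk_mem_product hl (Finset.mem_range.2 (by omega)))
    exact (le_sqSeminorms (a, l, j) f hq).trans
      ((Finset.le_sup (f := sqSeminorms d) hm : sqSeminorms d (a, l, j) ≤ _) f)
  have h1 := key 0 (by simp) 0 (by simp)
  have h2 := key 0 (by simp) K (by simp)
  have h3 := key (-(K : ℤ)) (by simp) 0 (by simp)
  have h4 := key (-(K : ℤ)) (by simp) K (by simp)
  simp only [zpow_zero, pow_zero, one_mul, mul_one] at h1 h2 h3 h4
  set D := ‖iteratedFDeriv ℝ j (cSqueezed f) q‖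
  calc weight q ^ K * D ≤ 4 ^ K * ((1 + ‖q‖ ^ K) * (1 + |q 0| ^ (-(K : ℤ)))) * D :=
        mul_le_mul_of_nonneg_right (pow_weight_le K q) (norm_nonneg _)
    _ = 4 ^ K * (D + ‖q‖ ^ K * D + |q 0| ^ (-(K : ℤ)) * D +
          |q 0| ^ (-(K : ℤ)) * ‖q‖ ^ K * D) := by ring
    _ ≤ 4 ^ K * (s.sup (sqSeminorms d) f + s.sup (sqSeminorms d) f + s.sup (sqSeminorms d) f +
          s.sup (sqSeminorms d) f) := by gcongr
    _ = _ := by ring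

theorem weight_bound (f : SqueezedSpace d) (K n : ℕ) : ∃ C : ℝ, 0 ≤ C ∧ ∀ j ≤ n,
    ∀ q ∈ offPlane d, weight q ^ K * ‖iteratedFDeriv ℝ j (cSqueezed f) q‖ ≤ C := by
  obtain ⟨s, C, hC, h⟩ := weight_bound_sup (d := d) K n
  exact ⟨_, mul_nonneg hC (apply_nonneg _ _), h f⟩

theorem mem_squeezedSubmodule {h : Sp d → ℂ} (h0 : ∀ q, q 0 = 0 → h q = 0)
    (hs : ∀ q ∈ offPlane d, ContDiffAt ℝ ∞ h q)
    (hb : ∀ K j : ℕ, ∃ C : ℝ, ∀ q ∈ offPlane d, weight q ^ K * ‖iteratedFDeriv ℝ j h q‖ ≤ C) :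
    h ∈ squeezedSubmodule d := by
  refine ⟨contDiff_of_rapid_decay h0 hs (hb 2), fun a l j => ?_⟩
  obtain ⟨C, hC⟩ := hb (a.natAbs + l) j
  exact ⟨C, fun q hq => (mul_le_mul_of_nonneg_right (zpow_mul_pow_le_weight a l q)
    (norm_nonneg _)).trans (hC q hq)⟩

/-- Only information off the hyperplane is required: smoothness across `{p⁺ = 0}` follows from the
weighted bounds, and the same bounds give continuity. -/
theorem exists_clm_squeezed {X ι : Type*} [AddCommGroup X] [Module ℂ X] [TopologicalSpace X]
    [Nonempty ι] {p : SeminormFamily ℂ X ι} (hp : WithSeminorms p) (A : X → Sp d → ℂ)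
    (hadd : ∀ f g, A (f + g) = A f + A g) (hsmul : ∀ (c : ℂ) f, A (c • f) = c • A f)
    (h0 : ∀ f q, q 0 = 0 → A f q = 0) (hs : ∀ f, ∀ q ∈ offPlane d, ContDiffAt ℝ ∞ (A f) q)
    (hb : ∀ K j : ℕ, ∃ (s : Finset ι) (C : ℝ), 0 ≤ C ∧ ∀ f, ∀ q ∈ offPlane d,
      weight q ^ K * ‖iteratedFDeriv ℝ j (A f) q‖ ≤ C * s.sup p f) :
    ∃ T : X →L[ℂ] SqueezedSpace d, ∀ f, cSqueezed (T f) = A f := by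
  have hmem : ∀ f, A f ∈ squeezedSubmodule d := fun f =>
    mem_squeezedSubmodule (h0 f) (hs f) fun K j => by
      obtain ⟨s, C, hC, h⟩ := hb K j
      exact ⟨_, h f⟩
  let T : X →ₗ[ℂ] SqueezedSpace d :=
    { toFun := fun f => (⟨A f, hmem f⟩ : squeezedSubmodule d)
      map_add' := fun f g => Subtype.ext (hadd f g)
      map_smul' := fun c f => Subtype.ext (hsmul c f) }
  refine ⟨⟨T, WithSeminorms.continuous_of_isBounded hp (squeezed_withSeminorms d) T fun i => ?_⟩,
    fun f => rfl⟩
  obtain ⟨s, C, hC, h⟩ := hb (i.1.natAbs + i.2.1) i.2.2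
  refine ⟨s, ⟨C, hC⟩, fun f => ?_⟩
  refine sqSeminorms_le i (T f) (mul_nonneg hC (apply_nonneg _ _)) fun q hq => ?_
  exact (mul_le_mul_of_nonneg_right (zpow_mul_pow_le_weight i.1 i.2.1 q)
    (norm_nonneg _)).trans (h f q hq)

theorem exists_clm_schwartz {X ι : Type*} [AddCommGroup X] [Module ℂ X] [TopologicalSpace X]
    [Nonempty ι] {p : SeminormFamily ℂ X ι} (hp : WithSeminorms p) (A : X → Sp d → ℂ)
    (hadd : ∀ f g, A (f + g) = A f + A g) (hsmul : ∀ (c : ℂ) f, A (c • f) = c • A f)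
    (hs : ∀ f, ContDiff ℝ ∞ (A f))
    (hb : ∀ k j : ℕ, ∃ (s : Finset ι) (C : ℝ), 0 ≤ C ∧ ∀ f q,
      ‖q‖ ^ k * ‖iteratedFDeriv ℝ j (A f) q‖ ≤ C * s.sup p f) :
    ∃ T : X →L[ℂ] 𝓢(Sp d, ℂ), ∀ f, ⇑(T f) = A f := by
  let T : X →ₗ[ℂ] 𝓢(Sp d, ℂ) :=
    { toFun := fun f => ⟨A f, (hs f).of_le (by simp), fun k j => by
        obtain ⟨s, C, hC, h⟩ := hb k j
        exact ⟨_, h f⟩⟩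
      map_add' := fun f g => by ext q; exact congrFun (hadd f g) q
      map_smul' := fun c f => by ext q; exact congrFun (hsmul c f) q }
  refine ⟨⟨T, WithSeminorms.continuous_of_isBounded hp (schwartz_withSeminorms ℂ (Sp d) ℂ) T
    fun i => ?_⟩, fun f => rfl⟩
  obtain ⟨s, C, hC, h⟩ := hb i.1 i.2
  refine ⟨s, ⟨C, hC⟩, fun f => ?_⟩
  exact SchwartzMap.seminorm_le_bound ℂ i.1 i.2 (T f) (mul_nonneg hC (apply_nonneg _ _)) (h f)

/-- Squeezed functions vanish to infinite order on `{p⁺ = 0}`. -/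
theorem iteratedFDeriv_squeezed_eq_zero (f : SqueezedSpace d) (j : ℕ) {q : Sp d} (hq : q 0 = 0) :
    iteratedFDeriv ℝ j (cSqueezed f) q = 0 := by
  obtain ⟨C, hC, h⟩ := weight_bound f 1 j
  have hc : Continuous fun s : ℝ => ‖iteratedFDeriv ℝ j (cSqueezed f) (q + s • e 0)‖ :=
    ((contDiff_cSqueezed f).continuous_iteratedFDeriv (by exact_mod_cast le_top)).norm.comp
      (by fun_prop)
  have hlim := (hc.tendsto 0).mono_left (nhdsWithin_le_nhds (s := {0}ᶜ))
  have hlim' : Filter.Tendsto (fun s : ℝ => C * |s|) (nhdsWithin 0 {0}ᶜ) (nhds 0) := by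
    have : Continuous fun s : ℝ => C * |s| := by fun_prop
    simpa using (this.tendsto 0).mono_left (nhdsWithin_le_nhds (s := {0}ᶜ))
  -- At `q + s • e 0` the weight is at least `1/|s|`, so the derivative is `O(s)` there; continuity
  -- gives the value at `s = 0`.
  have hle : ‖iteratedFDeriv ℝ j (cSqueezed f) (q + (0 : ℝ) • e 0)‖ ≤ 0 := by
    refine le_of_tendsto_of_tendsto hlim hlim' ?_
    filter_upwards [self_mem_nhdsWithin] with s hs
    have hs0 : s ≠ 0 := hs
    have hval : (q + s • e 0 : Sp d) 0 = s := by simp [hq, e]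
    have hmem : (q + s • e 0 : Sp d) ∈ offPlane d := by
      change _ ≠ (0 : ℝ); rw [hval]; exact hs0
    have h1 := h j le_rfl _ hmem
    have h2 := inv_le_weight (q + s • e 0 : Sp d)
    rw [hval] at h2
    rw [pow_one] at h1
    have hpos : 0 < |s| := abs_pos.2 hs0
    have h3 := (mul_le_mul_of_nonneg_right h2 (norm_nonneg _)).trans h1
    rw [inv_mul_le_iff₀ hpos] at h3
    linarith
  simpa using hle

theorem squeezed_eq_zero (f : SqueezedSpace d) {q : Sp d} (hq : q 0 = 0) : cSqueezed f q = 0 := by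
  have := iteratedFDeriv_squeezed_eq_zero f 0 hq
  have h2 := norm_iteratedFDeriv_zero (𝕜 := ℝ) (f := cSqueezed f) (x := q)
  rw [this, norm_zero] at h2
  exact norm_eq_zero.1 h2.symm

theorem exists_toSchwartz (d : ℕ) :
    ∃ T : SqueezedSpace d →L[ℂ] 𝓢(Sp d, ℂ), ∀ f, ⇑(T f) = cSqueezed f := by
  refine exists_clm_schwartz (squeezed_withSeminorms d) _ cSqueezed_add cSqueezed_smul
    contDiff_cSqueezed fun k j => ?_
  obtain ⟨s, C, hC, h⟩ := weight_bound_sup (d := d) k j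
  refine ⟨s, C, hC, fun f q => ?_⟩
  by_cases hq : q 0 = 0
  · rw [iteratedFDeriv_squeezed_eq_zero f j hq]
    simpa using mul_nonneg hC (apply_nonneg (s.sup (sqSeminorms d)) f)
  · refine (mul_le_mul_of_nonneg_right ?_ (norm_nonneg _)).trans (h f j le_rfl q hq)
    exact pow_le_pow_left₀ (norm_nonneg _) (norm_le_weight q) k

/-- The inclusion of the squeezed Schwartz space into the Schwartz space. -/
def toSchwartz (d : ℕ) : SqueezedSpace d →L[ℂ] 𝓢(Sp d, ℂ) := (exists_toSchwartz d).choose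

@[simp] theorem coe_toSchwartz (f : SqueezedSpace d) : ⇑(toSchwartz d f) = cSqueezed f :=
  (exists_toSchwartz d).choose_spec f

theorem IsWeighted.exists_mul {M : Sp d → ℂ} (hM : IsWeighted M) :
    ∃ T : SqueezedSpace d →L[ℂ] SqueezedSpace d,
      ∀ f, cSqueezed (T f) = fun p => M p * cSqueezed f p := by
  refine exists_clm_squeezed (squeezed_withSeminorms d) (fun f p => M p * cSqueezed f p) ?_ ?_ ?_ ?_ ?_
  · intro f g; ext p; simp [cSqueezed_add, mul_add]
  · intro c f; ext p; simp [cSqueezed_smul, mul_left_comm]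
  · intro f q hq; simp [squeezed_eq_zero f hq]
  · intro f q hq; exact (hM.1 q hq).mul (contDiff_cSqueezed f).contDiffAt
  · intro K j
    obtain ⟨k, C₁, hC₁, h₁⟩ := hM.uniform j
    obtain ⟨s, C, hC, h⟩ := weight_bound_sup (d := d) (K + k) j
    refine ⟨s, ∑ i ∈ Finset.range (j + 1), (j.choose i : ℝ) * C₁ * C, by positivity,
      fun f q hq => ?_⟩
    have hw := (weight_pos q).le
    refine (mul_le_mul_of_nonneg_left (norm_iteratedFDeriv_smul_le_of_contDiffAt hM.contDiffOn
      (contDiff_cSqueezed f).contDiffOn j hq) (by positivity)).trans ?_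
    rw [Finset.mul_sum, Finset.sum_mul]
    refine Finset.sum_le_sum fun i hi => ?_
    have hi' : i ≤ j := by have := Finset.mem_range.1 hi; omega
    calc _ ≤ weight q ^ K * ((j.choose i : ℝ) * (C₁ * weight q ^ k) *
          ‖iteratedFDeriv ℝ (j - i) (cSqueezed f) q‖) := by
          gcongr; exact h₁ i hi' q hq
      _ = (j.choose i : ℝ) * C₁ *
          (weight q ^ (K + k) * ‖iteratedFDeriv ℝ (j - i) (cSqueezed f) q‖) := by
          rw [pow_add]; ring
      _ ≤ (j.choose i : ℝ) * C₁ * (C * s.sup (sqSeminorms d) f) := by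
          exact mul_le_mul_of_nonneg_left (h f _ (by omega) q hq) (by positivity)
      _ = _ := by ring

/-- Multiplication by a weighted function on the squeezed Schwartz space. -/
def mulSqueezed {M : Sp d → ℂ} (hM : IsWeighted M) : SqueezedSpace d →L[ℂ] SqueezedSpace d :=
  hM.exists_mul.choose

theorem mulSqueezed_apply {M : Sp d → ℂ} (hM : IsWeighted M) (f : SqueezedSpace d) :
    cSqueezed (mulSqueezed hM f) = fun p => M p * cSqueezed f p :=
  hM.exists_mul.choose_spec f

/-- For a weighted `M` the pointwise product does induce a continuous map, so `sqMul` is given by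
`mulSqueezed` and not by the default value `0` of `inducedCLM`. -/
theorem sqMul_eq {M : Sp d → ℂ} (hM : IsWeighted M) (b : SqueezedDist d) (f : SqueezedSpace d) :
    sqMul M b f = b (mulSqueezed hM f) := by
  rw [sqMul, inducedCLM_eq cSqueezed_injective (mulSqueezed hM) (mulSqueezed_apply hM)]
  rfl

end SqueezedMaps

/-! ### The squeezing maps -/

section Squeezing

variable {d : ℕ} {m σ : ℝ}

theorem sign_cases (hσ : σ ^ 2 = 1) : σ = 1 ∨ σ = -1 :=
  sq_eq_sq_iff_eq_or_eq_neg.1 (by rw [hσ, one_pow])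

@[simp] theorem mu_zero (p : Sp d) : mu m σ p 0 = (p (Fin.last d) + σ * omega m p) / √2 := rfl

@[simp] theorem mu_succ (p : Sp d) (i : Fin d) : mu m σ p i.succ = p i.castSucc := rfl

@[simp] theorem nu_last (q : Sp d) : nu m q (Fin.last d) = (q 0 - omegaLC m q) / √2 := by
  have hl : Fin.last (d + 1) ≠ 0 := Fin.last_pos.ne'
  change kappaFun (OmegaLC m q) (Fin.last d).succ = _
  rw [Fin.succ_last]
  simp only [kappaFun, hl, if_false, if_true, OmegaLC]
  rw [Fin.snoc_last]
  rfl

@[simp] theorem nu_castSucc (q : Sp d) (i : Fin d) : nu m q i.castSucc = q i.succ := by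
  change kappaFun (OmegaLC m q) i.castSucc.succ = _
  have h1 : i.castSucc.succ ≠ 0 := Fin.succ_ne_zero _
  have h2 : i.castSucc.succ ≠ Fin.last (d + 1) := by
    rw [Fin.succ_castSucc]; exact (Fin.castSucc_lt_last _).ne
  simp only [kappaFun, h1, h2, if_false, OmegaLC]
  rw [Fin.succ_castSucc]
  exact Fin.snoc_castSucc (α := fun _ => ℝ) (i := i.succ) _ _

theorem omega_sq (m : ℝ) (p : Sp d) : omega m p ^ 2 = ‖p‖ ^ 2 + m ^ 2 :=
  Real.sq_sqrt (by positivity)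

theorem norm_sq_castSucc (p : Sp d) :
    ‖p‖ ^ 2 = ∑ i : Fin d, p i.castSucc ^ 2 + p (Fin.last d) ^ 2 := by
  rw [EuclideanSpace.norm_sq_eq, Fin.sum_univ_castSucc]
  simp

theorem norm_sq_succ (p : Sp d) : ‖p‖ ^ 2 = p 0 ^ 2 + ∑ i : Fin d, p i.succ ^ 2 := by
  rw [EuclideanSpace.norm_sq_eq, Fin.sum_univ_succ]
  simp

/-- Strictness, which comes from `m > 0`, keeps the image of `μ` off the hyperplane `{p⁺ = 0}`. -/
theorem abs_last_lt_omega (hm : 0 < m) (p : Sp d) : |p (Fin.last d)| < omega m p := by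
  refine Real.lt_sqrt_of_sq_lt ?_
  rw [sq_abs, norm_sq_castSucc]
  have : 0 ≤ ∑ i : Fin d, p i.castSucc ^ 2 := Finset.sum_nonneg fun i _ => sq_nonneg _
  nlinarith

theorem sign_mu_pos (hm : 0 < m) (hσ : σ ^ 2 = 1) (p : Sp d) : 0 < σ * mu m σ p 0 := by
  have h := abs_last_lt_omega hm p
  have h2 : σ * mu m σ p 0 = (σ * p (Fin.last d) + omega m p) / √2 := by
    rw [mu_zero]; linear_combination (omega m p / √2) * hσ
  rw [h2]
  refine div_pos ?_ (by positivity)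
  rcases sign_cases hσ with rfl | rfl
  · linarith [neg_abs_le (p (Fin.last d))]
  · linarith [le_abs_self (p (Fin.last d))]

theorem mu_mem_offPlane (hm : 0 < m) (hσ : σ ^ 2 = 1) (p : Sp d) : mu m σ p ∈ offPlane d := by
  intro h
  have := sign_mu_pos hm hσ p
  rw [h, mul_zero] at this
  exact this.false

/-- This is the mass-shell relation `2p⁺p⁻ = p_⊥² + m²`, obtained by factoring `ω² - (pⁿ)² = p_⊥² +
m²`. The singular function `ω̃` becomes smooth and of temperate growth in the variable `p`. -/
theorem omegaLC_mu (hm : 0 < m) (hσ : σ ^ 2 = 1) (p : Sp d) :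
    omegaLC m (mu m σ p) = (σ * omega m p - p (Fin.last d)) / √2 := by
  have h0 : mu m σ p 0 ≠ 0 := mu_mem_offPlane hm hσ p
  have h2 : √(2 : ℝ) ^ 2 = 2 := Real.sq_sqrt (by norm_num)
  have h3 := omega_sq m p
  rw [norm_sq_castSucc] at h3
  rw [omegaLC, div_eq_iff (by simpa using h0)]
  simp only [mu_succ, mu_zero]
  field_simp
  rw [h2]
  linear_combination (-2) * h3 - 2 * (omega m p) ^ 2 * hσ

theorem nu_mu (hm : 0 < m) (hσ : σ ^ 2 = 1) (p : Sp d) : nu m (mu m σ p) = p := by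
  ext i
  refine Fin.lastCases ?_ (fun i => ?_) i
  · rw [nu_last, omegaLC_mu hm hσ, mu_zero]
    have h2 : √(2 : ℝ) ^ 2 = 2 := Real.sq_sqrt (by norm_num)
    field_simp
    linear_combination (-p (Fin.last d)) * h2
  · rw [nu_castSucc, mu_succ]

/-- Since `2 q⁺ ω̃ = q_⊥² + m²`, adding it to `(q⁺ - ω̃)²/2` completes the square `(q⁺ + ω̃)²/2`. -/
theorem omega_nu {q : Sp d} (hq : q ∈ offPlane d) :
    omega m (nu m q) = |q 0 + omegaLC m q| / √2 := by
  have hq0 : q 0 ≠ 0 := hq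
  have h2 : √(2 : ℝ) ^ 2 = 2 := Real.sq_sqrt (by norm_num)
  rw [omega, Real.sqrt_eq_iff_mul_self_eq (by positivity) (by positivity), ← sq, div_pow, sq_abs, h2,
    norm_sq_castSucc]
  simp only [nu_castSucc, nu_last, div_pow, h2]
  have : omegaLC m q * (2 * q 0) = ∑ i : Fin d, q i.succ ^ 2 + m ^ 2 := by
    rw [omegaLC, div_mul_cancel₀ _ (by simpa using hq0)]
  linear_combination (-1) * this

theorem sign_omegaLC_pos (hm : 0 < m) {q : Sp d} (hq : 0 < σ * q 0) (hσ : σ ^ 2 = 1) :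
    0 < σ * omegaLC m q := by
  have h1 : 0 < ∑ i : Fin d, q i.succ ^ 2 + m ^ 2 := by
    have : 0 ≤ ∑ i : Fin d, q i.succ ^ 2 := Finset.sum_nonneg fun i _ => sq_nonneg _
    positivity
  have hq0 : q 0 ≠ 0 := fun h => by rw [h, mul_zero] at hq; exact hq.false
  have hσ0 : σ ≠ 0 := fun h => by rw [h] at hσ; norm_num at hσ
  have : σ * omegaLC m q = (∑ i : Fin d, q i.succ ^ 2 + m ^ 2) / (2 * (σ * q 0)) := by
    rw [omegaLC]; field_simp; rw [hσ]
  rw [this]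
  positivity

theorem omega_nu_eq (hm : 0 < m) (hσ : σ ^ 2 = 1) {q : Sp d} (hq : 0 < σ * q 0) :
    omega m (nu m q) = σ * (q 0 + omegaLC m q) / √2 := by
  have hq0 : q 0 ≠ 0 := fun h => by rw [h, mul_zero] at hq; exact hq.false
  rw [omega_nu hq0]
  have h1 := sign_omegaLC_pos hm hq hσ
  congr 1
  rcases sign_cases hσ with rfl | rfl
  · rw [abs_of_pos (by linarith)]; ring
  · rw [abs_of_neg (by linarith)]; ring

theorem mu_nu (hm : 0 < m) (hσ : σ ^ 2 = 1) {q : Sp d} (hq : 0 < σ * q 0) :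
    mu m σ (nu m q) = q := by
  ext i
  refine Fin.cases ?_ (fun i => ?_) i
  · rw [mu_zero, nu_last, omega_nu_eq hm hσ hq]
    have h2 : √(2 : ℝ) ^ 2 = 2 := Real.sq_sqrt (by norm_num)
    field_simp
    linear_combination (q 0 + omegaLC m q) * hσ - q 0 * h2
  · rw [mu_succ, nu_castSucc]

theorem exists_sign {q : Sp d} (hq : q ∈ offPlane d) : 0 < 1 * q 0 ∨ 0 < -1 * q 0 := by
  rcases lt_or_gt_of_ne (show q 0 ≠ 0 from hq) with h | h
  · right; linarith
  · left; linarith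

/-- The isometry `p ↦ (pⁿ, p¹, …, pⁿ⁻¹)`. -/
def rotate (d : ℕ) : Sp d ≃ₗᵢ[ℝ] Sp d := LinearIsometryEquiv.piLpCongrLeft 2 ℝ ℝ (finRotate (d + 1))

@[simp] theorem rotate_zero (p : Sp d) : rotate d p 0 = p (Fin.last d) := by
  change p ((finRotate (d + 1)).symm 0) = _
  rw [(Equiv.symm_apply_eq _).2 finRotate_last.symm]

@[simp] theorem rotate_succ (p : Sp d) (i : Fin d) : rotate d p i.succ = p i.castSucc := by
  change p ((finRotate (d + 1)).symm i.succ) = _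
  rw [(Equiv.symm_apply_eq _).2 (by simp : i.succ = finRotate (d + 1) i.castSucc)]

/-- An isometry maps the unit ball onto itself and hence scales volume by `1`. -/
theorem abs_det_isometry {k : ℕ} (R : EuclideanSpace ℝ (Fin k) ≃ₗᵢ[ℝ] EuclideanSpace ℝ (Fin k)) :
    |LinearMap.det (R.toLinearEquiv : EuclideanSpace ℝ (Fin k) →ₗ[ℝ] EuclideanSpace ℝ (Fin k))|
      = 1 := by
  have h := Measure.addHaar_image_linearMap (volume : Measure (EuclideanSpace ℝ (Fin k)))
    (R.toLinearEquiv : EuclideanSpace ℝ (Fin k) →ₗ[ℝ] EuclideanSpace ℝ (Fin k)) (Metric.ball 0 1)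
  have h2 : (R.toLinearEquiv : EuclideanSpace ℝ (Fin k) →ₗ[ℝ] EuclideanSpace ℝ (Fin k)) ''
      Metric.ball 0 1 = Metric.ball 0 1 := by
    have := R.image_ball 0 1
    rw [map_zero] at this
    exact this
  rw [h2] at h
  have hpos : volume (Metric.ball (0 : EuclideanSpace ℝ (Fin k)) 1) ≠ 0 :=
    (Metric.measure_ball_pos volume _ one_pos).ne'
  have h3 : ENNReal.ofReal |LinearMap.det (R.toLinearEquiv : EuclideanSpace ℝ (Fin k) →ₗ[ℝ]
      EuclideanSpace ℝ (Fin k))| = 1 := by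
    refine (ENNReal.mul_left_inj hpos measure_ball_lt_top.ne).1 ?_
    rw [one_mul]; exact h.symm
  simpa using h3

/-! ### Derivative and Jacobian determinant of `μ`. -/

theorem hasFDerivAt_omega (hm : 0 < m) (p : Sp d) :
    HasFDerivAt (omega m) ((omega m p)⁻¹ • innerSL ℝ p) p := by
  have h := ((hasStrictFDerivAt_norm_sq p).hasFDerivAt.add_const (m ^ 2)).sqrt
    (by positivity : ‖p‖ ^ 2 + m ^ 2 ≠ 0)
  refine h.congr_fderiv ?_
  ext v
  simp [omega]
  field_simp

/-- Written as an isometry plus a scalar function times a fixed vector, `μ` has a derivative that is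
a rank-one perturbation of an isometry, so its determinant is explicit in every dimension. -/
theorem mu_eq (p : Sp d) : mu m σ p =
    rotate d p + (((√2)⁻¹ - 1) * p (Fin.last d) + σ * (√2)⁻¹ * omega m p) • (e 0 : Sp d) := by
  ext i
  refine Fin.cases ?_ (fun i => ?_) i
  · simp [e]; ring
  · simp [e]

theorem hasFDerivAt_mu (hm : 0 < m) (p : Sp d) :
    HasFDerivAt (mu m σ) ((rotate d).toContinuousLinearEquiv.toContinuousLinearMap +
      ((((√2)⁻¹ - 1) • EuclideanSpace.proj (𝕜 := ℝ) (Fin.last d) +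
        (σ * (√2)⁻¹) • ((omega m p)⁻¹ • innerSL ℝ p) : Sp d →L[ℝ] ℝ)).smulRight (e 0)) p := by
  have h1 : HasFDerivAt (fun p : Sp d => rotate d p)
    (rotate d).toContinuousLinearEquiv.toContinuousLinearMap p :=
    (rotate d).toContinuousLinearEquiv.toContinuousLinearMap.hasFDerivAt
  have h2 : HasFDerivAt (fun p : Sp d => p (Fin.last d))
    (EuclideanSpace.proj (𝕜 := ℝ) (Fin.last d) : Sp d →L[ℝ] ℝ) p :=
    (EuclideanSpace.proj (𝕜 := ℝ) (Fin.last d) : Sp d →L[ℝ] ℝ).hasFDerivAt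
  have h := h1.add (((h2.const_mul ((√2)⁻¹ - 1)).add
    ((hasFDerivAt_omega hm p).const_mul (σ * (√2)⁻¹))).smul_const (e 0 : Sp d))
  refine h.congr_of_eventuallyEq (Filter.Eventually.of_forall fun x => ?_)
  rw [mu_eq]
  rfl

/-- This is the invariance of the measure on the mass shell, `dp/ω = dp̃/|p⁺|`, and the source of
the factors `ω` and `|p⁺|` in the transformation laws. -/
theorem abs_det_mu (hm : 0 < m) (hσ : σ ^ 2 = 1) (p : Sp d) :
    |(fderiv ℝ (mu m σ) p).det| = |mu m σ p 0| / omega m p := by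
  rw [(hasFDerivAt_mu hm p).fderiv]
  set ℓ : Sp d →L[ℝ] ℝ := ((√2)⁻¹ - 1) • EuclideanSpace.proj (𝕜 := ℝ) (Fin.last d) +
        (σ * (√2)⁻¹) • ((omega m p)⁻¹ • innerSL ℝ p) with hℓ
  have hR : (rotate d).symm (e 0) = e (Fin.last d) := by
    rw [LinearIsometryEquiv.symm_apply_eq]
    ext i
    refine Fin.cases ?_ (fun i => ?_) i
    · simp
    · have h1 : i.castSucc ≠ Fin.last d := (Fin.castSucc_lt_last _).ne
      simp [e, h1]
  -- Factor out the rotation `R`: the derivative is `(1 + e₀ ⊗ ℓR⁻¹) R`, whose first factor is a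
  -- transvection with determinant `1 + ℓ(R⁻¹e₀)`.
  have hdec : (((rotate d).toContinuousLinearEquiv.toContinuousLinearMap + ℓ.smulRight (e 0) :
      Sp d →L[ℝ] Sp d) : Sp d →ₗ[ℝ] Sp d) =
      LinearMap.transvection ((ℓ : Sp d →ₗ[ℝ] ℝ) ∘ₗ
        ((rotate d).symm.toLinearEquiv : Sp d →ₗ[ℝ] Sp d)) (e 0) ∘ₗ
        ((rotate d).toLinearEquiv : Sp d →ₗ[ℝ] Sp d) := by
    ext v
    simp [LinearMap.transvection.apply]
  have hω := omega_pos hm p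
  rw [ContinuousLinearMap.det, hdec, LinearMap.det_comp, LinearMap.transvection.det, abs_mul,
    abs_det_isometry, mul_one]
  have hval : 1 + ((ℓ : Sp d →ₗ[ℝ] ℝ) ∘ₗ
      ((rotate d).symm.toLinearEquiv : Sp d →ₗ[ℝ] Sp d)) (e 0) =
      (σ * mu m σ p 0) / omega m p := by
    change 1 + ℓ ((rotate d).symm (e 0)) = _
    rw [hR, hℓ]
    simp only [add_apply, smul_apply, innerSL_apply_apply, inner_e, smul_eq_mul, mu_zero]
    rw [show (EuclideanSpace.proj (𝕜 := ℝ) (Fin.last d) : Sp d →L[ℝ] ℝ) (e (Fin.last d)) = 1 from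
      e_self _]
    field_simp
    linear_combination (-omega m p) * hσ
  rw [hval, abs_div, abs_mul, abs_of_pos hω]
  have : |σ| = 1 := by
    rcases sign_cases hσ with rfl | rfl <;> simp
  rw [this, one_mul]

end Squeezing

/-! ### Composition with the squeezing maps -/

section SqueezingCLM

variable {d : ℕ} {m σ : ℝ}

theorem hasTemperateGrowth_omega (hm : 0 < m) : (omega m : Sp d → ℝ).HasTemperateGrowth := by
  have h := (Complex.reCLM.hasTemperateGrowth).comp (omega_hasTemperateGrowth (d := d) hm)
  exact h

theorem hasTemperateGrowth_mu (hm : 0 < m) : (mu m σ : Sp d → Sp d).HasTemperateGrowth := by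
  have h1 : (fun p : Sp d => rotate d p).HasTemperateGrowth :=
    (rotate d).toContinuousLinearEquiv.toContinuousLinearMap.hasTemperateGrowth
  have h2 : (fun p : Sp d => p (Fin.last d)).HasTemperateGrowth :=
    (EuclideanSpace.proj (𝕜 := ℝ) (Fin.last d) : Sp d →L[ℝ] ℝ).hasTemperateGrowth
  have h3 := h1.add ((((Function.HasTemperateGrowth.const ((√2)⁻¹ - 1)).mul h2).add
    ((Function.HasTemperateGrowth.const (σ * (√2)⁻¹)).mul (hasTemperateGrowth_omega hm))).smul
      (Function.HasTemperateGrowth.const (e 0 : Sp d)))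
  convert h3 using 1
  ext1 p
  rw [mu_eq]
  rfl

theorem isWeighted_omegaLC : IsWeighted (omegaLC m : Sp d → ℝ) := by
  have h1 : (fun q : Sp d => (∑ i : Fin d, q i.succ ^ 2 + m ^ 2) / 2).HasTemperateGrowth := by
    have hs : (fun q : Sp d => ∑ i : Fin d, q i.succ ^ 2).HasTemperateGrowth :=
      Function.HasTemperateGrowth.sum fun i _ =>
        (EuclideanSpace.proj (𝕜 := ℝ) i.succ : Sp d →L[ℝ] ℝ).hasTemperateGrowth.pow 2
    have := (hs.add (Function.HasTemperateGrowth.const (m ^ 2))).mul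
      (Function.HasTemperateGrowth.const (2 : ℝ)⁻¹)
    exact this
  refine ((isWeighted_of_temperate h1).smul isWeighted_inv).congr fun q hq => ?_
  have hq : q 0 ≠ 0 := hq
  rw [omegaLC, smul_eq_mul]
  field_simp

theorem nu_eq (q : Sp d) : nu m q =
    (rotate d).symm q + (((√2)⁻¹ - 1) * q 0 + (-(√2)⁻¹) * omegaLC m q) • (e (Fin.last d) : Sp d) := by
  have h0 : ∀ i, (rotate d).symm q i = q (finRotate (d + 1) i) := fun i => by
    rw [rotate, LinearIsometryEquiv.piLpCongrLeft_symm]; rfl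
  ext i
  refine Fin.lastCases ?_ (fun i => ?_) i
  · rw [PiLp.add_apply, h0, finRotate_last, PiLp.smul_apply, e_self, nu_last, smul_eq_mul]
    ring
  · have h1 : i.castSucc ≠ Fin.last d := (Fin.castSucc_lt_last _).ne
    rw [PiLp.add_apply, h0, PiLp.smul_apply, nu_castSucc]
    simp [e, h1]

theorem isWeighted_nu : IsWeighted (nu m : Sp d → Sp d) := by
  have h1 : (fun p : Sp d => (rotate d).symm p).HasTemperateGrowth :=
    (rotate d).symm.toContinuousLinearEquiv.toContinuousLinearMap.hasTemperateGrowth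
  have hc := fun c : ℝ => isWeighted_of_temperate (d := d) (.const c)
  refine ((isWeighted_of_temperate h1).add ((((hc ((√2)⁻¹ - 1)).smul isWeighted_coord).add
    ((hc (-(√2)⁻¹)).smul (isWeighted_omegaLC (m := m)))).smul
      (isWeighted_of_temperate (.const (e (Fin.last d) : Sp d))))).congr fun q _ => ?_
  rw [nu_eq]
  rfl

theorem isOpen_signed (σ : ℝ) : IsOpen {q : Sp d | 0 < σ * q 0} :=
  isOpen_lt continuous_const (by fun_prop)

theorem signed_subset_offPlane {q : Sp d} (hq : 0 < σ * q 0) : q ∈ offPlane d := fun h => by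
  rw [h, mul_zero] at hq; exact hq.false

/-- Differentiate `μ ∘ ν = id` on the half-space containing `q` and insert the determinant of `Dμ`.
-/
theorem abs_det_nu (hm : 0 < m) {q : Sp d} (hq : q ∈ offPlane d) :
    |(fderiv ℝ (nu m) q).det| = omega m (nu m q) / |q 0| := by
  have key : ∀ σ : ℝ, σ ^ 2 = 1 → 0 < σ * q 0 →
      |(fderiv ℝ (nu m) q).det| = omega m (nu m q) / |q 0| := by
    intro σ hσ hq'
    have he : (fun y => mu m σ (nu m y)) =ᶠ[nhds q] fun y => y := by
      filter_upwards [(isOpen_signed σ).mem_nhds hq'] with y hy using mu_nu hm hσ hy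
    have hd : HasFDerivAt (nu m) (fderiv ℝ (nu m) q) q :=
      ((isWeighted_nu.1 q hq).differentiableAt (by simp)).hasFDerivAt
    have hμ := (hasFDerivAt_mu (σ := σ) hm (nu m q)).differentiableAt.hasFDerivAt
    have h1 := (hμ.comp q hd).congr_of_eventuallyEq he.symm
    have h2 := h1.unique (hasFDerivAt_id q)
    have h3 : LinearMap.det ((fderiv ℝ (mu m σ) (nu m q) : Sp d →ₗ[ℝ] Sp d) ∘ₗ
        (fderiv ℝ (nu m) q : Sp d →ₗ[ℝ] Sp d)) = LinearMap.det (LinearMap.id : Sp d →ₗ[ℝ] Sp d) :=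
      congrArg (fun A : Sp d →L[ℝ] Sp d => LinearMap.det (A : Sp d →ₗ[ℝ] Sp d)) h2
    replace h3 := congrArg abs h3
    rw [LinearMap.det_comp, LinearMap.det_id, abs_one, abs_mul] at h3
    have h4 := abs_det_mu hm hσ (nu m q)
    rw [mu_nu hm hσ hq'] at h4
    simp only [ContinuousLinearMap.det] at h4 ⊢
    rw [h4] at h3
    have hω := omega_pos hm (nu m q)
    have hq0 : |q 0| ≠ 0 := abs_ne_zero.2 hq
    field_simp at h3 ⊢
    linarith
  rcases exists_sign hq with h | h
  · exact key 1 (by norm_num) h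
  · exact key (-1) (by norm_num) h

theorem omega_le (hm : 0 < m) (p : Sp d) : omega m p ≤ (1 + m) * (1 + ‖p‖) := by
  rw [omega]
  refine Real.sqrt_le_iff.2 ⟨by positivity, ?_⟩
  have := norm_nonneg p
  nlinarith [mul_nonneg hm.le this, mul_nonneg (mul_nonneg hm.le this) this,
    mul_nonneg (mul_nonneg hm.le this) hm.le, sq_nonneg (m * ‖p‖)]

/-- As `q⁺` and `ω̃(q)` have the same sign, `√2 ω(ν q) = |q⁺| + |ω̃(q)|`. The first summand controls
`|q⁺|`; the second is at least `m²/(2|q⁺|)` and controls `1/|q⁺|`, for which `m > 0` is essential.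
Both factors of the weight are thus bounded by multiples of `ω(ν q)`, whence the square. -/
theorem exists_weight_le (hm : 0 < m) : ∃ C : ℝ, 0 ≤ C ∧ ∀ q ∈ offPlane d,
    weight q ≤ C * (1 + ‖nu m q‖) ^ 2 := by
  refine ⟨(m⁻¹ + 2) * (m⁻¹ + 2 * √2 * (m ^ 2)⁻¹) * (1 + m) ^ 2, by positivity, fun q hq => ?_⟩
  set W := omega m (nu m q) with hW
  have hq0 : 0 < |q 0| := abs_pos.2 hq
  have hWpos : 0 < W := omega_pos hm _
  have h2 : √(2 : ℝ) ^ 2 = 2 := Real.sq_sqrt (by norm_num)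
  have hS : 0 ≤ ∑ i : Fin d, q i.succ ^ 2 := Finset.sum_nonneg fun i _ => sq_nonneg _
  have hΩ : |omegaLC m q| = (∑ i : Fin d, q i.succ ^ 2 + m ^ 2) / (2 * |q 0|) := by
    rw [omegaLC, abs_div, abs_mul, abs_of_nonneg (by positivity), abs_two]
  have hWeq : √2 * W = |q 0| + |omegaLC m q| := by
    have key : ∀ σ : ℝ, σ ^ 2 = 1 → 0 < σ * q 0 → √2 * W = |q 0| + |omegaLC m q| := by
      intro σ hσ hq'
      have h1 := sign_omegaLC_pos hm hq' hσ
      have hσ' : |σ| = 1 := by rcases sign_cases hσ with rfl | rfl <;> simp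
      have e1 : |q 0| = σ * q 0 := by rw [← abs_of_pos hq', abs_mul, hσ', one_mul]
      have e2 : |omegaLC m q| = σ * omegaLC m q := by rw [← abs_of_pos h1, abs_mul, hσ', one_mul]
      rw [hW, omega_nu_eq hm hσ hq', e1, e2]
      field_simp
    rcases exists_sign hq with h | h
    · exact key 1 (by norm_num) h
    · exact key (-1) (by norm_num) h
  have hle1 : |q 0| ≤ √2 * W := by rw [hWeq]; linarith [abs_nonneg (omegaLC m q)]
  have hle2 : |q 0|⁻¹ ≤ 2 * √2 * (m ^ 2)⁻¹ * W := by
    have h3 : m ^ 2 / (2 * |q 0|) ≤ √2 * W := by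
      rw [hWeq, hΩ]
      have : m ^ 2 / (2 * |q 0|) ≤ (∑ i : Fin d, q i.succ ^ 2 + m ^ 2) / (2 * |q 0|) := by
        gcongr; linarith
      linarith
    calc |q 0|⁻¹ = 2 * (m ^ 2)⁻¹ * (m ^ 2 / (2 * |q 0|)) := by field_simp
      _ ≤ 2 * (m ^ 2)⁻¹ * (√2 * W) := by gcongr
      _ = _ := by ring
  have hmW : m ≤ W := by
    rw [hW, omega]
    refine Real.le_sqrt_of_sq_le ?_
    nlinarith [sq_nonneg ‖nu m q‖]
  have h1W : 1 ≤ m⁻¹ * W := by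
    rw [← div_eq_inv_mul, one_le_div hm]; exact hmW
  have hnq : ‖q‖ ≤ 2 * W := by
    refine le_of_sq_le_sq ?_ (by positivity)
    have h5 : ∑ i : Fin d, q i.succ ^ 2 ≤ W ^ 2 := by
      rw [hW, omega_sq, norm_sq_castSucc]
      simp only [nu_castSucc]
      nlinarith [sq_nonneg (nu m q (Fin.last d))]
    have h6 : q 0 ^ 2 ≤ 2 * W ^ 2 := by
      rw [← sq_abs, ← h2, ← mul_pow]; gcongr
    rw [norm_sq_succ]
    nlinarith
  have hW2 : W ≤ (1 + m) * (1 + ‖nu m q‖) := omega_le hm _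
  calc weight q ≤ (m⁻¹ * W + 2 * W) * (m⁻¹ * W + 2 * √2 * (m ^ 2)⁻¹ * W) := by
        unfold weight; gcongr
    _ = (m⁻¹ + 2) * (m⁻¹ + 2 * √2 * (m ^ 2)⁻¹) * W ^ 2 := by ring
    _ ≤ (m⁻¹ + 2) * (m⁻¹ + 2 * √2 * (m ^ 2)⁻¹) * ((1 + m) * (1 + ‖nu m q‖)) ^ 2 := by gcongr
    _ = _ := by ring

/-- By the chain rule the derivatives of `f ∘ μ` grow at most like powers of `‖p‖` times derivatives
of `f` at `q = μ(p)`. Since `p = ν(q)` is bounded by a power of `weight q`, the decay of `f` absorbs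
every such power. -/
theorem exists_compMu (hm : 0 < m) (hσ : σ ^ 2 = 1) :
    ∃ T : SqueezedSpace d →L[ℂ] 𝓢(Sp d, ℂ), ∀ f, ⇑(T f) = cSqueezed f ∘ mu m σ := by
  have hμ := hasTemperateGrowth_mu (d := d) (σ := σ) hm
  refine exists_clm_schwartz (squeezed_withSeminorms d) _ (fun f g => rfl) (fun c f => rfl)
    (fun f => (contDiff_cSqueezed f).comp hμ.1) fun k j => ?_
  obtain ⟨k₁, C₁, hC₁, h₁⟩ := hμ.norm_iteratedFDeriv_le_uniform j
  obtain ⟨k₂, C₂, hC₂, h₂⟩ := (isWeighted_nu (d := d) (m := m)).2 0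
  -- The exponent collects the power `k` of the seminorm and the growth `k₁` of up to `j`
  -- derivatives of `μ`; the next line supplies the bound of `‖ν q‖` by a power of the weight.
  set N := k + k₁ * j
  obtain ⟨s, C₃, hC₃, h₃⟩ := weight_bound_sup (d := d) ((k₂ + 1) * N) j
  refine ⟨s, j.factorial * (1 + C₁) ^ j * (1 + C₂) ^ N * C₃, by positivity, fun f p => ?_⟩
  set q := mu m σ p with hq
  have hqU : q ∈ offPlane d := mu_mem_offPlane hm hσ p
  have hw := one_le_weight q
  have hp : 1 + ‖p‖ ≤ (1 + C₂) * weight q ^ (k₂ + 1) := by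
    have h := h₂ q hqU
    rw [norm_iteratedFDeriv_zero, hq, nu_mu hm hσ, ← hq] at h
    have h4 : weight q ^ k₂ ≤ weight q ^ (k₂ + 1) := pow_le_pow_right₀ hw (by omega)
    have h5 : 1 ≤ weight q ^ (k₂ + 1) := one_le_pow₀ hw
    nlinarith
  set Q := s.sup (sqSeminorms d) f
  have hQ : 0 ≤ Q := apply_nonneg _ _
  have hwK : 0 < weight q ^ ((k₂ + 1) * N) := pow_pos (weight_pos q) _
  have hcomp := norm_iteratedFDeriv_comp_le (contDiff_cSqueezed f) hμ.1
    (by exact_mod_cast le_top : (j : ℕ∞ω) ≤ ∞) p (C := C₃ * Q / weight q ^ ((k₂ + 1) * N))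
    (D := (1 + C₁) * (1 + ‖p‖) ^ k₁)
    (fun i hi => by rw [le_div_iff₀ hwK, mul_comm]; exact h₃ f i hi q hqU)
    (fun i hi1 hi => by
      refine (h₁ i hi p).trans ?_
      have h7 : 1 ≤ (1 + ‖p‖) ^ k₁ := one_le_pow₀ (by linarith [norm_nonneg p])
      have h8 : 1 ≤ (1 + C₁) * (1 + ‖p‖) ^ k₁ := by nlinarith
      refine le_trans ?_ (le_self_pow₀ h8 (by omega))
      gcongr
      linarith)
  calc ‖p‖ ^ k * ‖iteratedFDeriv ℝ j (cSqueezed f ∘ mu m σ) p‖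
      ≤ (1 + ‖p‖) ^ k * (j.factorial * (C₃ * Q / weight q ^ ((k₂ + 1) * N)) *
          ((1 + C₁) * (1 + ‖p‖) ^ k₁) ^ j) := by
        gcongr; linarith
    _ = j.factorial * (1 + C₁) ^ j * C₃ * Q * ((1 + ‖p‖) ^ N / weight q ^ ((k₂ + 1) * N)) := by
        rw [mul_pow, ← pow_mul, pow_add]; ring
    _ ≤ j.factorial * (1 + C₁) ^ j * C₃ * Q * (1 + C₂) ^ N := by
        gcongr
        rw [div_le_iff₀ hwK, pow_mul, ← mul_pow]
        gcongr
    _ = _ := by ring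

/-- `f ↦ f ∘ μ` as a map from the squeezed Schwartz space to the Schwartz space. -/
def compMu (hm : 0 < m) (hσ : σ ^ 2 = 1) : SqueezedSpace d →L[ℂ] 𝓢(Sp d, ℂ) :=
  (exists_compMu hm hσ).choose

theorem compMu_apply (hm : 0 < m) (hσ : σ ^ 2 = 1) (f : SqueezedSpace d) (p : Sp d) :
    compMu hm hσ f p = cSqueezed f (mu m σ p) :=
  congrFun ((exists_compMu hm hσ).choose_spec f) p

open Classical in
-- Here the chain rule costs powers of the weight, and `weight q ≤ C (1 + ‖ν q‖)²` converts them
-- into powers of `‖ν q‖` that the decay of `g` absorbs; this explains the seminorms of order `2 *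
-- N`.
theorem exists_compNu (hm : 0 < m) : ∃ T : 𝓢(Sp d, ℂ) →L[ℂ] SqueezedSpace d,
    ∀ g, cSqueezed (T g) = fun q => if q ∈ offPlane d then g (nu m q) else 0 := by
  have hev : ∀ (g : 𝓢(Sp d, ℂ)), ∀ q ∈ offPlane d,
      (fun q => if q ∈ offPlane d then g (nu m q) else 0) =ᶠ[nhds q] g ∘ nu m := by
    intro g q hq
    filter_upwards [isOpen_offPlane.mem_nhds hq] with y hy using if_pos hy
  refine exists_clm_squeezed (schwartz_withSeminorms ℂ (Sp d) ℂ)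
    (fun g q => if q ∈ offPlane d then g (nu m q) else 0) ?_ ?_ ?_ ?_ ?_
  · intro f g; ext q; by_cases h : q ∈ offPlane d <;> simp [h]
  · intro c f; ext q; by_cases h : q ∈ offPlane d <;> simp [h]
  · intro g q hq; exact if_neg (not_not.2 hq)
  · intro g q hq
    exact ((g.smooth ⊤).contDiffAt.comp q (isWeighted_nu.1 q hq)).congr_of_eventuallyEq (hev g q hq)
  · intro K j
    obtain ⟨k₁, C₁, hC₁, h₁⟩ := (isWeighted_nu (d := d) (m := m)).uniform j
    obtain ⟨C₂, hC₂, h₂⟩ := exists_weight_le (d := d) hm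
    set N := K + k₁ * j
    refine ⟨Finset.Iic (2 * N, j), j.factorial * (1 + C₁) ^ j * C₂ ^ N * 2 ^ (2 * N),
      by positivity, fun g q hq => ?_⟩
    set Q := (Finset.Iic (2 * N, j)).sup (schwartzSeminormFamily ℂ (Sp d) ℂ) g
    have hw := one_le_weight q
    have hw0 := weight_pos q
    have hx : 0 < (1 + ‖nu m q‖) ^ (2 * N) := by positivity
    have hQ : ∀ i ≤ j, ‖iteratedFDeriv ℝ i g (nu m q)‖ ≤
        2 ^ (2 * N) * Q / (1 + ‖nu m q‖) ^ (2 * N) := by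
      intro i hi
      rw [le_div_iff₀ hx, mul_comm]
      exact one_add_le_sup_seminorm_apply (𝕜 := ℂ) (m := (2 * N, j)) le_rfl hi g (nu m q)
    rw [((hev g q hq).iteratedFDeriv ℝ j).eq_of_nhds, ← iteratedFDerivWithin_of_isOpen j
      isOpen_offPlane hq]
    have hcomp := norm_iteratedFDerivWithin_comp_le (g := g) (f := nu m) (g.smooth ⊤).contDiffOn
      (isWeighted_nu (d := d) (m := m)).contDiffOn (by exact_mod_cast le_top : (j : ℕ∞ω) ≤ ∞)
      uniqueDiffOn_univ isOpen_offPlane.uniqueDiffOn (Set.mapsTo_univ _ _) hq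
      (C := 2 ^ (2 * N) * Q / (1 + ‖nu m q‖) ^ (2 * N)) (D := (1 + C₁) * weight q ^ k₁)
      (fun i hi => by rw [iteratedFDerivWithin_univ]; exact hQ i hi)
      (fun i hi1 hi => by
        rw [iteratedFDerivWithin_of_isOpen i isOpen_offPlane hq]
        refine (h₁ i hi q hq).trans ?_
        have h7 : 1 ≤ weight q ^ k₁ := one_le_pow₀ hw
        have h8 : 1 ≤ (1 + C₁) * weight q ^ k₁ := by nlinarith
        refine le_trans ?_ (le_self_pow₀ h8 (by omega))
        gcongr
        linarith)
    calc _ ≤ weight q ^ K * (j.factorial * (2 ^ (2 * N) * Q / (1 + ‖nu m q‖) ^ (2 * N)) *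
          ((1 + C₁) * weight q ^ k₁) ^ j) := by gcongr
      _ = j.factorial * (1 + C₁) ^ j * 2 ^ (2 * N) * Q *
          (weight q ^ N / (1 + ‖nu m q‖) ^ (2 * N)) := by
        rw [mul_pow, ← pow_mul, pow_add]; ring
      _ ≤ j.factorial * (1 + C₁) ^ j * 2 ^ (2 * N) * Q * C₂ ^ N := by
        gcongr
        rw [div_le_iff₀ hx, pow_mul, ← mul_pow]
        gcongr
        exact h₂ q hq
      _ = _ := by ring

open Classical in
theorem isWeighted_theta (σ : ℝ) : IsWeighted fun q : Sp d => if 0 < σ * q 0 then (1 : ℂ) else 0 :=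
  (isWeighted_of_temperate (.const (1 : ℂ))).ite (isWeighted_of_temperate (.const (0 : ℂ))) σ

/-- `g ↦ g ∘ ν` on `{σ p⁺ > 0}`, extended by zero, as a map from the Schwartz space to the squeezed
Schwartz space. -/
def compNu (hm : 0 < m) (σ : ℝ) : 𝓢(Sp d, ℂ) →L[ℂ] SqueezedSpace d :=
  mulSqueezed (isWeighted_theta σ) ∘L (exists_compNu hm).choose

open Classical in
theorem compNu_apply (hm : 0 < m) (σ : ℝ) (g : 𝓢(Sp d, ℂ)) (q : Sp d) :
    cSqueezed (compNu hm σ g) q = if 0 < σ * q 0 then g (nu m q) else 0 := by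
  rw [compNu, ContinuousLinearMap.comp_apply, mulSqueezed_apply, (exists_compNu hm).choose_spec]
  dsimp only
  split_ifs with h1 h2 h2
  · rw [one_mul]
  · exact absurd (signed_subset_offPlane h1) h2
  · rw [zero_mul]
  · rw [zero_mul]

/-- With the next two lemmas this identifies the squeezed space with two copies of `𝓢(ℝⁿ)`, one for
each sign of `p⁺`; dually, a squeezed generalized function is a pair of tempered distributions. -/
theorem compMu_compNu (hm : 0 < m) (hσ : σ ^ 2 = 1) (g : 𝓢(Sp d, ℂ)) :
    compMu hm hσ (compNu hm σ g) = g := by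
  ext p
  rw [compMu_apply, compNu_apply, if_pos (sign_mu_pos hm hσ p), nu_mu hm hσ]

theorem compMu_compNu_neg (hm : 0 < m) (hσ : σ ^ 2 = 1) (g : 𝓢(Sp d, ℂ)) :
    compMu hm hσ (compNu hm (-σ) g) = 0 := by
  ext p
  have := sign_mu_pos hm hσ p
  rw [compMu_apply, compNu_apply, if_neg (by linarith)]
  rfl

theorem compNu_compMu_add (hm : 0 < m) (f : SqueezedSpace d) :
    compNu hm 1 (compMu hm (by norm_num : (1 : ℝ) ^ 2 = 1) f) +
      compNu hm (-1) (compMu hm (by norm_num : (-1 : ℝ) ^ 2 = 1) f) = f := by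
  refine cSqueezed_injective ?_
  rw [cSqueezed_add]
  ext q
  rw [Pi.add_apply, compNu_apply, compNu_apply]
  by_cases hq : q ∈ offPlane d
  · rcases exists_sign hq with h | h
    · rw [if_pos h, if_neg (by linarith), add_zero, compMu_apply, mu_nu hm (by norm_num) h]
    · rw [if_neg (by linarith), if_pos h, zero_add, compMu_apply, mu_nu hm (by norm_num) h]
  · have h0 : q 0 = 0 := not_not.1 hq
    rw [h0, if_neg (by simp), if_neg (by simp), squeezed_eq_zero f h0, add_zero]

/-- The Jacobian is split: `|p⁺|` multiplies before composition with `μ`, and `1/ω` after it. Each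
factor is then a known continuous map, so the default value of `inducedCLM` does not occur;
`muPull_eq` is analogous. -/
theorem nuPull_eq (hm : 0 < m) (hσ : σ ^ 2 = 1) (a : 𝓢'(Sp d, ℂ)) (f : SqueezedSpace d) :
    nuPull m σ a f = a (smulLeftCLM ℂ (fun p => ((1 / omega m p : ℝ) : ℂ))
      (compMu hm hσ (mulSqueezed (isWeighted_ofReal isWeighted_abs) f))) := by
  rw [nuPull, inducedCLM_eq (cY := cSchwartz) DFunLike.coe_injective
    (smulLeftCLM ℂ (fun p => ((1 / omega m p : ℝ) : ℂ)) ∘L compMu hm hσ ∘L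
      mulSqueezed (isWeighted_ofReal isWeighted_abs))]
  · rfl
  · intro f
    ext p
    rw [cSchwartz, ContinuousLinearMap.comp_apply, ContinuousLinearMap.comp_apply,
      smulLeftCLM_apply_apply (one_div_omega_hasTemperateGrowth hm), compMu_apply,
      mulSqueezed_apply, abs_det_mu hm hσ, smul_eq_mul]
    push_cast
    ring

theorem muPull_eq (hm : 0 < m) (σ : ℝ) (b : SqueezedDist d) (g : 𝓢(Sp d, ℂ)) :
    muPull m σ b g = b (mulSqueezed (isWeighted_ofReal isWeighted_abs_inv)
      (compNu hm σ (smulLeftCLM ℂ (fun p => (omega m p : ℂ)) g))) := by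
  rw [muPull, inducedCLM_eq (cY := cSqueezed) cSqueezed_injective
    (mulSqueezed (isWeighted_ofReal isWeighted_abs_inv) ∘L compNu hm σ ∘L
      smulLeftCLM ℂ (fun p => (omega m p : ℂ)))]
  · rfl
  · intro g
    ext q
    rw [ContinuousLinearMap.comp_apply, ContinuousLinearMap.comp_apply, mulSqueezed_apply]
    dsimp only
    rw [compNu_apply]
    split_ifs with h
    · rw [smulLeftCLM_apply_apply (omega_hasTemperateGrowth hm),
        abs_det_nu hm (signed_subset_offPlane h), smul_eq_mul, cSchwartz]
      push_cast
      ring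
    · rw [mul_zero]

end SqueezingCLM

/-! ### The transformation laws in terms of amplitudes -/

section Laws

variable {d : ℕ} {m : ℝ}

/-- The amplitudes `(û₀ + σ i ω⁻¹ û₁) / 2` of the positive (`σ = 1`) and negative (`σ = -1`)
frequency parts of the solution with Cauchy data `u₀`, `u₁`. -/
def amplitude (m σ : ℝ) (u₀ u₁ : 𝓢'(Sp d, ℂ)) : 𝓢'(Sp d, ℂ) :=
  (1 / 2 : ℂ) • (fourierT u₀ +
    (σ * Complex.I) • tMul (fun p => ((1 / omega m p : ℝ) : ℂ)) (fourierT u₁))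

theorem tMul_apply (M : Sp d → ℂ) (u : 𝓢'(Sp d, ℂ)) (g : 𝓢(Sp d, ℂ)) :
    tMul M u g = u (smulLeftCLM ℂ M g) := rfl

theorem amplitude_apply (σ : ℝ) (u₀ u₁ : 𝓢'(Sp d, ℂ)) (g : 𝓢(Sp d, ℂ)) :
    amplitude m σ u₀ u₁ g = (1 / 2) * (fourierT u₀ g +
      σ * Complex.I * fourierT u₁ (smulLeftCLM ℂ (fun p => ((1 / omega m p : ℝ) : ℂ)) g)) := rfl

theorem smulLeft_omega_inv (hm : 0 < m) (g : 𝓢(Sp d, ℂ)) :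
    smulLeftCLM ℂ (fun p : Sp d => (omega m p : ℂ))
      (smulLeftCLM ℂ (fun p => ((1 / omega m p : ℝ) : ℂ)) g) = g := by
  ext p
  have := (omega_pos hm p).ne'
  rw [smulLeftCLM_apply_apply (omega_hasTemperateGrowth hm),
    smulLeftCLM_apply_apply (one_div_omega_hasTemperateGrowth hm), smul_smul, ← Complex.ofReal_mul,
    mul_one_div_cancel this, Complex.ofReal_one, one_smul]

theorem smulLeft_inv_omega (hm : 0 < m) (g : 𝓢(Sp d, ℂ)) :
    smulLeftCLM ℂ (fun p => ((1 / omega m p : ℝ) : ℂ))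
      (smulLeftCLM ℂ (fun p : Sp d => (omega m p : ℂ)) g) = g := by
  ext p
  have := (omega_pos hm p).ne'
  rw [smulLeftCLM_apply_apply (one_div_omega_hasTemperateGrowth hm),
    smulLeftCLM_apply_apply (omega_hasTemperateGrowth hm), smul_smul, ← Complex.ofReal_mul,
    one_div_mul_cancel this, Complex.ofReal_one, one_smul]

theorem isWeighted_one_div_two_abs : IsWeighted fun q : Sp d => ((1 / (2 * |q 0|) : ℝ) : ℂ) := by
  refine isWeighted_ofReal (((isWeighted_of_temperate (.const (1 / 2 : ℝ))).smul
    isWeighted_abs_inv).congr fun q hq => ?_)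
  rw [smul_eq_mul]
  ring

theorem isWeighted_absTheta (σ : ℝ) : IsWeighted (absTheta σ : Sp d → ℂ) :=
  (isWeighted_ofReal isWeighted_abs).ite (isWeighted_of_temperate (.const (0 : ℂ))) σ

/-- The prefactor in `LawToTame` cancels the `|p⁺|` of the Jacobian, leaving the `1/2` that appears
in `amplitude`. -/
theorem mulSqueezed_abs_half (f : SqueezedSpace d) :
    mulSqueezed (isWeighted_ofReal isWeighted_abs) (mulSqueezed isWeighted_one_div_two_abs f) =
      (1 / 2 : ℂ) • f := by
  refine cSqueezed_injective ?_
  rw [mulSqueezed_apply, mulSqueezed_apply, cSqueezed_smul]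
  ext q
  by_cases hq : q 0 = 0
  · simp [squeezed_eq_zero f hq]
  · have : ((|q 0| : ℝ) : ℂ) ≠ 0 := Complex.ofReal_ne_zero.2 (abs_ne_zero.2 hq)
    rw [Pi.smul_apply, smul_eq_mul]
    push_cast
    field_simp

/-- The multiplier in the inverse laws cancels the `1/|p⁺|` of `|det Dν|`, and the Heaviside factor
is already contained in `compNu`. -/
theorem mulSqueezed_absTheta_inv (hm : 0 < m) (σ : ℝ) (g : 𝓢(Sp d, ℂ)) :
    mulSqueezed (isWeighted_absTheta σ)
      (mulSqueezed (isWeighted_ofReal isWeighted_abs_inv) (compNu hm σ g)) = compNu hm σ g := by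
  refine cSqueezed_injective ?_
  rw [mulSqueezed_apply, mulSqueezed_apply]
  ext q
  dsimp only
  rw [compNu_apply]
  split_ifs with h
  · have : ((|q 0| : ℝ) : ℂ) ≠ 0 := by
      exact Complex.ofReal_ne_zero.2 (abs_ne_zero.2 (signed_subset_offPlane h))
    rw [absTheta, if_pos h]
    push_cast
    field_simp
  · simp

theorem one_sq' : (1 : ℝ) ^ 2 = 1 := by norm_num

theorem neg_one_sq' : (-1 : ℝ) ^ 2 = 1 := by norm_num

/-- All weights cancel: the Jacobian's `1/ω` turns `ω û₀ ± i û₁` into `û₀ ± iω⁻¹ û₁`, and the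
factors of `|p⁺|` leave `1/2`. What remains is the form in which `isTameRestriction_iff` expresses a
tame initial value. -/
theorem lawToTame_iff (hm : 0 < m) (u₀ u₁ : 𝓢'(Sp d, ℂ)) (v₀ : TameDist d) :
    LawToTame m u₀ u₁ v₀ ↔ ∀ f : SqueezedSpace d, lcFourier v₀ f =
      amplitude m 1 u₀ u₁ (compMu hm one_sq' f) +
        amplitude m (-1) u₀ u₁ (compMu hm neg_one_sq' f) := by
  rw [LawToTame, DFunLike.ext_iff]
  refine forall_congr' fun f => ?_
  have key : ∀ (σ : ℝ) (hσ : σ ^ 2 = 1) (a : 𝓢'(Sp d, ℂ)),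
      nuPull m σ a (mulSqueezed isWeighted_one_div_two_abs f) =
        (1 / 2) * a (smulLeftCLM ℂ (fun p => ((1 / omega m p : ℝ) : ℂ)) (compMu hm hσ f)) := by
    intro σ hσ a
    rw [nuPull_eq hm hσ, mulSqueezed_abs_half, map_smul, map_smul]
    exact map_smul a _ _
  rw [sqMul_eq isWeighted_one_div_two_abs, add_apply, key 1 one_sq', key (-1) neg_one_sq',
    add_apply, sub_apply, tMul_apply, tMul_apply, smul_apply, smul_apply, smulLeft_omega_inv hm,
    smulLeft_omega_inv hm, amplitude_apply, amplitude_apply, smul_eq_mul, smul_eq_mul]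
  push_cast
  ring_nf

theorem lawFromTame₀_iff (hm : 0 < m) (u₀ : 𝓢'(Sp d, ℂ)) (v₀ : TameDist d) :
    LawFromTame₀ m u₀ v₀ ↔ ∀ g : 𝓢(Sp d, ℂ), fourierT u₀ g =
      lcFourier v₀ (compNu hm 1 g) + lcFourier v₀ (compNu hm (-1) g) := by
  rw [LawFromTame₀, DFunLike.ext_iff]
  refine forall_congr' fun g => ?_
  rw [tMul_apply, add_apply, muPull_eq hm, muPull_eq hm, sqMul_eq (isWeighted_absTheta _),
    sqMul_eq (isWeighted_absTheta _), mulSqueezed_absTheta_inv, mulSqueezed_absTheta_inv,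
    smulLeft_omega_inv hm]

theorem lawFromTame₁_iff (hm : 0 < m) (u₁ : 𝓢'(Sp d, ℂ)) (v₀ : TameDist d) :
    LawFromTame₁ m u₁ v₀ ↔ ∀ g : 𝓢(Sp d, ℂ), fourierT u₁ g = (1 / Complex.I) *
      (lcFourier v₀ (compNu hm 1 (smulLeftCLM ℂ (fun p => (omega m p : ℂ)) g)) -
        lcFourier v₀ (compNu hm (-1) (smulLeftCLM ℂ (fun p => (omega m p : ℂ)) g))) := by
  rw [LawFromTame₁, DFunLike.ext_iff]
  refine forall_congr' fun g => ?_
  rw [smul_apply, sub_apply, muPull_eq hm, muPull_eq hm, sqMul_eq (isWeighted_absTheta _),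
    sqMul_eq (isWeighted_absTheta _), mulSqueezed_absTheta_inv, mulSqueezed_absTheta_inv,
    smul_eq_mul]

/-- Testing with `compNu hm σ g` isolates one amplitude, and `compNu_compMu_add` reassembles an
arbitrary squeezed `f` from its two halves. The rest is the linear system relating the amplitudes to
`û₀` and `û₁`. -/
theorem law_iff (hm : 0 < m) (u₀ u₁ : 𝓢'(Sp d, ℂ)) (v₀ : TameDist d) :
    LawToTame m u₀ u₁ v₀ ↔ LawFromTame₀ m u₀ v₀ ∧ LawFromTame₁ m u₁ v₀ := by
  rw [lawToTame_iff hm, lawFromTame₀_iff hm, lawFromTame₁_iff hm]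
  have hI := Complex.I_mul_I
  constructor
  · intro h
    have hp : ∀ g, lcFourier v₀ (compNu hm 1 g) = amplitude m 1 u₀ u₁ g := by
      intro g
      have h2 := compMu_compNu_neg hm neg_one_sq' g
      rw [neg_neg] at h2
      rw [h, compMu_compNu, h2, map_zero, add_zero]
    have hn : ∀ g, lcFourier v₀ (compNu hm (-1) g) = amplitude m (-1) u₀ u₁ g := by
      intro g
      rw [h, compMu_compNu, compMu_compNu_neg hm one_sq' g, map_zero, zero_add]
    refine ⟨fun g => ?_, fun g => ?_⟩
    · rw [hp, hn, amplitude_apply, amplitude_apply]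
      push_cast
      ring
    · rw [hp, hn, amplitude_apply, amplitude_apply, smulLeft_inv_omega hm]
      have := Complex.I_ne_zero
      push_cast
      field_simp
      ring
  · rintro ⟨h0, h1⟩ f
    have hp : ∀ g, amplitude m 1 u₀ u₁ g = lcFourier v₀ (compNu hm 1 g) := by
      intro g
      rw [amplitude_apply, h0, h1, smulLeft_omega_inv hm]
      have := Complex.I_ne_zero
      push_cast
      field_simp
      ring
    have hn : ∀ g, amplitude m (-1) u₀ u₁ g = lcFourier v₀ (compNu hm (-1) g) := by
      intro g
      rw [amplitude_apply, h0, h1, smulLeft_omega_inv hm]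
      have := Complex.I_ne_zero
      push_cast
      field_simp
      ring
    rw [hp, hn, ← map_add, compNu_compMu_add]

end Laws

/-! ### Flat Schwartz functions -/

section Flat

variable {d : ℕ}

/-- Schwartz functions vanishing to infinite order on `{p⁺ = 0}`. -/
def IsFlat (f : 𝓢(Sp d, ℂ)) : Prop :=
  ∀ (j : ℕ) (q : Sp d), q 0 = 0 → iteratedFDeriv ℝ j f q = 0

theorem one_add_norm_le_tail (q : Sp d) : 1 + ‖q‖ ≤ (1 + |q 0|) * (1 + 2 * ‖tail q‖) := by
  have h : ‖q‖ ≤ |q 0| + ‖tail q‖ := by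
    conv_lhs => rw [← cons_tail q]
    refine le_of_sq_le_sq ?_ (by positivity)
    rw [norm_cons_sq, ← sq_abs (q 0)]
    nlinarith [abs_nonneg (q 0), norm_nonneg (tail q)]
  nlinarith [abs_nonneg (q 0), norm_nonneg (tail q), mul_nonneg (abs_nonneg (q 0))
    (norm_nonneg (tail q))]

theorem norm_tail_le (q : Sp d) : ‖tail q‖ ≤ ‖q‖ := by
  conv_rhs => rw [← cons_tail q]
  exact norm_le_norm_cons _ _

/-- Each induction step applies the mean value inequality along `e 0` starting on the hyperplane,
gaining a factor `|q⁺|` at the cost of one derivative. The polynomial weight involves only `tail q`,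
which is constant along that segment. -/
theorem flat_bound (N l j : ℕ) : ∃ (s : Finset (ℕ × ℕ)) (C : ℝ), 0 ≤ C ∧
    ∀ f : 𝓢(Sp d, ℂ), IsFlat f → ∀ q, (1 + 2 * ‖tail q‖) ^ l * ‖iteratedFDeriv ℝ j f q‖ ≤
      |q 0| ^ N * (C * s.sup (schwartzSeminormFamily ℂ (Sp d) ℂ) f) := by
  induction N generalizing j with
  | zero =>
    refine ⟨Finset.Iic (l, j), 2 ^ l * 2 ^ l, by positivity, fun f _ q => ?_⟩
    have h := one_add_le_sup_seminorm_apply (𝕜 := ℂ) (m := (l, j)) le_rfl le_rfl f q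
    have h2 : 1 + 2 * ‖tail q‖ ≤ 2 * (1 + ‖q‖) := by linarith [norm_tail_le q]
    rw [pow_zero, one_mul]
    calc _ ≤ (2 * (1 + ‖q‖)) ^ l * ‖iteratedFDeriv ℝ j f q‖ := by gcongr
      _ = 2 ^ l * ((1 + ‖q‖) ^ l * ‖iteratedFDeriv ℝ j f q‖) := by rw [mul_pow]; ring
      _ ≤ 2 ^ l * (2 ^ l * _) := by gcongr
      _ = _ := by rw [mul_assoc]; rfl
  | succ N ih =>
    obtain ⟨s, C, hC, h⟩ := ih (j + 1)
    refine ⟨s, C, hC, fun f hf q => ?_⟩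
    set Q := C * s.sup (schwartzSeminormFamily ℂ (Sp d) ℂ) f
    have hQ : 0 ≤ Q := mul_nonneg hC (apply_nonneg _ _)
    set W := (1 + 2 * ‖tail q‖) ^ l
    have hW : 0 < W := by positivity
    have hder : ∀ t : ℝ, HasDerivAt (fun t => iteratedFDeriv ℝ j f (cons t (tail q)))
        (fderiv ℝ (iteratedFDeriv ℝ j f) (cons t (tail q)) (e 0)) t := by
      intro t
      have hd : DifferentiableAt ℝ (iteratedFDeriv ℝ j f) (cons t (tail q)) :=
        (f.smooth ⊤).contDiffAt.differentiableAt_iteratedFDeriv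
          (by exact_mod_cast WithTop.coe_lt_top j)
      have hc : HasDerivAt (fun t : ℝ => (cons t (tail q) : Sp d)) (e 0) t := by
        have := ((hasDerivAt_id t).smul_const (e 0 : Sp d)).add_const (emb (tail q))
        simpa [cons] using this
      exact hd.hasFDerivAt.comp_hasDerivAt t hc
    have hb : ∀ t ∈ Metric.closedBall (0 : ℝ) |q 0|,
        ‖fderiv ℝ (iteratedFDeriv ℝ j f) (cons t (tail q)) (e 0)‖ ≤ |q 0| ^ N * Q / W := by
      intro t ht
      rw [mem_closedBall_zero_iff, Real.norm_eq_abs] at ht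
      refine (ContinuousLinearMap.le_opNorm _ _).trans ?_
      rw [norm_e, mul_one, norm_fderiv_iteratedFDeriv, le_div_iff₀ hW, mul_comm]
      have := h f hf (cons t (tail q))
      rw [tail_cons, cons_zero] at this
      refine this.trans ?_
      gcongr
    have hmv := (convex_closedBall (0 : ℝ) |q 0|).norm_image_sub_le_of_norm_hasDerivWithin_le
      (fun t _ => (hder t).hasDerivWithinAt) hb (x := 0) (y := q 0) (by simp)
      (by rw [mem_closedBall_zero_iff, Real.norm_eq_abs])
    rw [hf j (cons 0 (tail q)) (cons_zero _ _), sub_zero, sub_zero, cons_tail, Real.norm_eq_abs]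
      at hmv
    calc _ ≤ W * (|q 0| ^ N * Q / W * |q 0|) := by gcongr
      _ = _ := by field_simp; ring

/-- For `|q⁺| ≥ 1` the weight is comparable to `1 + ‖q‖` and Schwartz seminorms suffice; for `|q⁺| ≤
1` flatness to order `K` cancels `|q⁺| ^ (-K)`. On flat functions the squeezed seminorms are thus
dominated by Schwartz seminorms. -/
theorem flat_weight_bound (K j : ℕ) : ∃ (s : Finset (ℕ × ℕ)) (C : ℝ), 0 ≤ C ∧
    ∀ f : 𝓢(Sp d, ℂ), IsFlat f → ∀ q ∈ offPlane d, weight q ^ K * ‖iteratedFDeriv ℝ j f q‖ ≤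
      C * s.sup (schwartzSeminormFamily ℂ (Sp d) ℂ) f := by
  classical
  obtain ⟨s, C, hC, h⟩ := flat_bound (d := d) K K j
  refine ⟨s ∪ Finset.Iic (K, j), 2 ^ K * 2 ^ K + 2 ^ K * 2 ^ K * C, by positivity,
    fun f hf q hq => ?_⟩
  have hq0 : 0 < |q 0| := abs_pos.2 hq
  set Q := (s ∪ Finset.Iic (K, j)).sup (schwartzSeminormFamily ℂ (Sp d) ℂ) f
  have hQ : 0 ≤ Q := apply_nonneg _ _
  have hsQ : s.sup (schwartzSeminormFamily ℂ (Sp d) ℂ) f ≤ Q :=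
    Seminorm.le_def.1 (Finset.sup_mono Finset.subset_union_left) f
  have hIQ : (Finset.Iic (K, j)).sup (schwartzSeminormFamily ℂ (Sp d) ℂ) f ≤ Q :=
    Seminorm.le_def.1 (Finset.sup_mono Finset.subset_union_right) f
  set D := ‖iteratedFDeriv ℝ j f q‖
  rcases le_total 1 |q 0| with h1 | h1
  · have h2 : (1 + ‖q‖) ^ K * D ≤ 2 ^ K * Q :=
      (one_add_le_sup_seminorm_apply (𝕜 := ℂ) (m := (K, j)) le_rfl le_rfl f q).trans (by
        gcongr; exact hIQ)
    have h3 : |q 0|⁻¹ ≤ 1 := inv_le_one_of_one_le₀ h1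
    calc weight q ^ K * D ≤ ((1 + ‖q‖) * 2) ^ K * D := by
          unfold weight; gcongr; linarith
      _ = 2 ^ K * ((1 + ‖q‖) ^ K * D) := by rw [mul_pow]; ring
      _ ≤ 2 ^ K * (2 ^ K * Q) := by gcongr
      _ ≤ _ := by
        rw [add_mul, ← mul_assoc]
        exact le_add_of_nonneg_right (by positivity)
  · have h2 := h f hf q
    have h3 : 1 ≤ |q 0|⁻¹ := (one_le_inv₀ hq0).2 h1
    have h4 : weight q ≤ 2 * (1 + 2 * ‖tail q‖) * (2 * |q 0|⁻¹) := by
      unfold weight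
      gcongr
      · refine (one_add_norm_le_tail q).trans ?_
        gcongr; linarith
      · linarith
    calc weight q ^ K * D ≤ (2 * (1 + 2 * ‖tail q‖) * (2 * |q 0|⁻¹)) ^ K * D := by
          gcongr
          exact (weight_pos q).le
      _ = 2 ^ K * 2 ^ K * (|q 0| ^ K)⁻¹ * ((1 + 2 * ‖tail q‖) ^ K * D) := by
        rw [mul_pow, mul_pow, mul_pow, inv_pow]; ring
      _ ≤ 2 ^ K * 2 ^ K * (|q 0| ^ K)⁻¹ * (|q 0| ^ K * (C * Q)) := by
        exact mul_le_mul_of_nonneg_left (h2.trans (by gcongr)) (by positivity)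
      _ = 2 ^ K * 2 ^ K * C * Q := by field_simp
      _ ≤ _ := by
        rw [add_mul]
        exact le_add_of_nonneg_left (by positivity)

theorem exists_clm_of_flat {X ι : Type*} [AddCommGroup X] [Module ℂ X] [TopologicalSpace X]
    [Nonempty ι] {p : SeminormFamily ℂ X ι} (hp : WithSeminorms p) (T : X →L[ℂ] 𝓢(Sp d, ℂ))
    (hT : ∀ f, IsFlat (T f)) :
    ∃ S : X →L[ℂ] SqueezedSpace d, ∀ f, cSqueezed (S f) = T f := by
  have hbd : Seminorm.IsBounded p (schwartzSeminormFamily ℂ (Sp d) ℂ) T.toLinearMap := by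
    intro i
    obtain ⟨s, C, _, h⟩ := Seminorm.bound_of_continuous hp
      ((schwartzSeminormFamily ℂ (Sp d) ℂ i).comp T.toLinearMap)
      (((schwartz_withSeminorms ℂ (Sp d) ℂ).continuous_seminorm i).comp T.continuous)
    exact ⟨s, C, h⟩
  refine exists_clm_squeezed hp (fun f => ⇑(T f)) (fun f g => by rw [map_add]; rfl)
    (fun c f => by rw [map_smul]; rfl) (fun f q hq => ?_)
    (fun f q _ => ((T f).smooth ⊤).contDiffAt) fun K j => ?_
  · have := hT f 0 q hq
    have h2 := norm_iteratedFDeriv_zero (𝕜 := ℝ) (f := T f) (x := q)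
    rw [this, norm_zero] at h2
    exact norm_eq_zero.1 h2.symm
  · obtain ⟨s, C, hC, h⟩ := flat_weight_bound (d := d) K j
    obtain ⟨C', s', h'⟩ := Seminorm.isBounded_sup hbd s
    refine ⟨s', C * C', by positivity, fun f q hq => (h (T f) (hT f) q hq).trans ?_⟩
    rw [mul_assoc]
    exact mul_le_mul_of_nonneg_left (h' f) hC

theorem isFlat_of_forall_eq_pow_mul {f : 𝓢(Sp d, ℂ)}
    (h : ∀ m : ℕ, ∃ g : 𝓢(Sp d, ℂ), ∀ q, f q = ((q 0 : ℝ) : ℂ) ^ m * g q) : IsFlat f := by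
  intro j q hq
  -- With the exponent `j + 1`, every term of the Leibniz formula of order `j` contains a derivative
  -- of `t ^ (j + 1)` of order at most `j`, which vanishes at `0`.
  obtain ⟨g, hg⟩ := h (j + 1)
  let P : Sp d →L[ℝ] ℝ := EuclideanSpace.proj 0
  let φ : ℝ → ℂ := fun t => (t : ℂ) ^ (j + 1)
  have hφ : ContDiff ℝ ∞ φ := Complex.ofRealCLM.contDiff.pow _
  have hφ0 : ∀ i ≤ j, iteratedDeriv i φ 0 = 0 := by
    intro i hi
    have h1 : φ = fun t : ℝ => ((t ^ (j + 1) : ℝ) : ℂ) := by ext t; simp [φ]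
    have h2 : ∀ i, iteratedDeriv i φ = fun t : ℝ =>
        (((j + 1).descFactorial i * t ^ (j + 1 - i) : ℝ) : ℂ) := by
      intro i
      induction i with
      | zero => ext t; simp [φ]
      | succ i ih =>
        rw [iteratedDeriv_succ, ih]
        ext t
        have h3 : HasDerivAt (fun t : ℝ => ((j + 1).descFactorial i * t ^ (j + 1 - i) : ℝ))
            ((j + 1).descFactorial i * (((j + 1 - i : ℕ) : ℝ) * t ^ (j + 1 - i - 1))) t :=
          (hasDerivAt_pow _ t).const_mul _
        rw [h3.ofReal_comp.deriv, Nat.descFactorial_succ, Nat.sub_sub]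
        push_cast
        ring
    rw [h2 i]
    simp [show j + 1 - i ≠ 0 by omega]
  have hfun : ⇑f = fun q => φ (P q) * g q := by ext q; exact hg q
  rw [← norm_le_zero_iff, hfun]
  have hPφ : ContDiff ℝ ∞ fun q => φ (P q) := hφ.comp P.contDiff
  refine (norm_iteratedFDeriv_mul_le hPφ (g.smooth ⊤) q
    (n := j) (by exact_mod_cast le_top)).trans ?_
  refine (Finset.sum_eq_zero fun i hi => ?_).le
  have hi' : i ≤ j := by have := Finset.mem_range.1 hi; omega
  have h5 : iteratedFDeriv ℝ i (fun q => φ (P q)) q = 0 := by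
    change iteratedFDeriv ℝ i (φ ∘ P) q = 0
    rw [P.iteratedFDeriv_comp_right hφ q (by exact_mod_cast le_top)]
    have h6 : iteratedFDeriv ℝ i φ (P q) = 0 := by
      rw [← norm_eq_zero, norm_iteratedFDeriv_eq_norm_iteratedDeriv, show P q = 0 from hq,
        hφ0 i hi', norm_zero]
    rw [h6]
    rfl
  rw [h5, norm_zero, mul_zero, zero_mul]

end Flat

/-! ### The light-cone Fourier transform -/

section LightConeFourier

/-- `(x⁰, x¹, …, xᵏ) ↦ (x⁰, -x¹, …, -xᵏ)`. -/
def signFlip (k : ℕ) : EuclideanSpace ℝ (Fin (k + 1)) ≃L[ℝ] EuclideanSpace ℝ (Fin (k + 1)) :=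
  LinearEquiv.toContinuousLinearEquiv <|
    LinearEquiv.ofInvolutive
      { toFun := fun x => cons (x 0) (-tail x)
        map_add' := fun x y => by
          ext i; refine Fin.cases ?_ (fun i => ?_) i
          · simp
          · simp; ring
        map_smul' := fun c x => by
          ext i; refine Fin.cases ?_ (fun i => ?_) i <;> simp }
      (fun x => by ext i; refine Fin.cases ?_ (fun i => ?_) i <;> simp)

theorem signFlip_apply {k : ℕ} (x : EuclideanSpace ℝ (Fin (k + 1))) :
    signFlip k x = cons (x 0) (-tail x) := rfl

@[simp] theorem signFlip_zero {k : ℕ} (x : EuclideanSpace ℝ (Fin (k + 1))) :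
    signFlip k x 0 = x 0 := by simp [signFlip_apply]

@[simp] theorem signFlip_succ {k : ℕ} (x : EuclideanSpace ℝ (Fin (k + 1))) (i : Fin k) :
    signFlip k x i.succ = -x i.succ := by simp [signFlip_apply]

variable {d : ℕ}

theorem scale_apply (x : Sp d) : scale d x = (2 * Real.pi)⁻¹ • x := rfl

/-- `(x_⊥, x⁻) ↦ (2π)⁻¹ (x⁻, -x_⊥)`. -/
def lcFrequency (d : ℕ) : Sp d ≃L[ℝ] Sp d :=
  ((rotate d).toContinuousLinearEquiv.trans (signFlip d)).trans (scale d)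

theorem lcFrequency_apply (x : Sp d) :
    lcFrequency d x = (2 * Real.pi)⁻¹ • signFlip d (rotate d x) := rfl

theorem inner_lcFrequency (p x : Sp d) :
    2 * Real.pi * inner ℝ p (lcFrequency d x) = lcPairing x p := by
  have hπ := Real.pi_ne_zero
  rw [lcFrequency_apply, real_inner_smul_right, PiLp.inner_apply, Fin.sum_univ_succ, lcPairing]
  simp only [signFlip_zero, signFlip_succ, rotate_zero, rotate_succ, RCLike.inner_apply, conj_trivial,
    neg_mul, Finset.sum_neg_distrib]
  field_simp
  ring

theorem lcFrequency_e_last : lcFrequency d (e (Fin.last d)) = (2 * Real.pi)⁻¹ • e 0 := by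
  rw [lcFrequency_apply]
  congr 1
  ext i
  refine Fin.cases ?_ (fun i => ?_) i
  · simp
  · have h1 : i.castSucc ≠ Fin.last d := (Fin.castSucc_lt_last _).ne
    simp [e, h1]

/-- The transposed light-cone Fourier transform on the Schwartz space. -/
def lcSchwartz (d : ℕ) : 𝓢(Sp d, ℂ) →L[ℂ] 𝓢(Sp d, ℂ) :=
  compCLMOfContinuousLinearEquiv ℂ (lcFrequency d) ∘L
    FourierTransform.fourierInvCLM ℂ 𝓢(Sp d, ℂ)

/-- The inverse of the transposed light-cone Fourier transform on the Schwartz space. -/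
def lcSchwartzInv (d : ℕ) : 𝓢(Sp d, ℂ) →L[ℂ] 𝓢(Sp d, ℂ) :=
  FourierTransform.fourierCLM ℂ 𝓢(Sp d, ℂ) ∘L
    compCLMOfContinuousLinearEquiv ℂ (lcFrequency d).symm

theorem lcSchwartz_lcSchwartzInv (f : 𝓢(Sp d, ℂ)) : lcSchwartz d (lcSchwartzInv d f) = f := by
  change compCLMOfContinuousLinearEquiv ℂ (lcFrequency d)
    (𝓕⁻ (𝓕 (compCLMOfContinuousLinearEquiv ℂ (lcFrequency d).symm f))) = f
  rw [FourierTransform.fourierInv_fourier_eq]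
  ext x
  simp

theorem lcSchwartzInv_lcSchwartz (f : 𝓢(Sp d, ℂ)) : lcSchwartzInv d (lcSchwartz d f) = f := by
  change 𝓕 (compCLMOfContinuousLinearEquiv ℂ (lcFrequency d).symm
    (compCLMOfContinuousLinearEquiv ℂ (lcFrequency d) (𝓕⁻ f))) = f
  have : compCLMOfContinuousLinearEquiv ℂ (lcFrequency d).symm
      (compCLMOfContinuousLinearEquiv ℂ (lcFrequency d) (𝓕⁻ f)) = 𝓕⁻ f := by
    ext x; simp
  rw [this, FourierTransform.fourier_fourierInv_eq]

theorem lcSchwartz_apply (f : 𝓢(Sp d, ℂ)) (x : Sp d) :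
    lcSchwartz d f x = ∫ p : Sp d, Complex.exp (Complex.I * (lcPairing x p : ℝ)) * f p := by
  change 𝓕⁻ f (lcFrequency d x) = _
  rw [SchwartzMap.fourierInv_coe, Real.fourierInv_eq']
  refine integral_congr_ae (Filter.Eventually.of_forall fun p => ?_)
  simp only [smul_eq_mul]
  rw [inner_lcFrequency, mul_comm Complex.I]

theorem hasTemperateGrowth_I_coord :
    (fun q : Sp d => Complex.I * ((q 0 : ℝ) : ℂ)).HasTemperateGrowth :=
  (Function.HasTemperateGrowth.const Complex.I).mul
    (hasTemperateGrowth_ofReal_comp hasTemperateGrowth_coord_zero)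

theorem lineDeriv_lcSchwartz (f : 𝓢(Sp d, ℂ)) :
    (∂_{(e (Fin.last d) : Sp d)} (lcSchwartz d f) : 𝓢(Sp d, ℂ)) =
      lcSchwartz d (smulLeftCLM ℂ (fun q => Complex.I * ((q 0 : ℝ) : ℂ)) f) := by
  change (∂_{(e (Fin.last d) : Sp d)} (compCLMOfContinuousLinearEquiv ℂ (lcFrequency d) (𝓕⁻ f)) :
    𝓢(Sp d, ℂ)) = compCLMOfContinuousLinearEquiv ℂ (lcFrequency d)
      (𝓕⁻ (smulLeftCLM ℂ (fun q => Complex.I * ((q 0 : ℝ) : ℂ)) f))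
  rw [lineDerivOp_compCLMOfContinuousLinearEquiv, lcFrequency_e_last, lineDerivOp_fourierInv_eq]
  congr 2
  ext q
  have h1 : (fun x : Sp d => inner ℝ x ((2 * Real.pi)⁻¹ • e 0 : Sp d)).HasTemperateGrowth :=
    Function.hasTemperateGrowth_inner_left _
  rw [smul_apply, smulLeftCLM_apply_apply h1, smulLeftCLM_apply_apply hasTemperateGrowth_I_coord,
    real_inner_smul_right, inner_e]
  have hπ : (Real.pi : ℂ) ≠ 0 := by exact_mod_cast Real.pi_ne_zero
  simp only [Complex.real_smul, smul_eq_mul]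
  push_cast
  field_simp

theorem lcSchwartzInv_lineDeriv (f : 𝓢(Sp d, ℂ)) :
    lcSchwartzInv d (∂_{(e (Fin.last d) : Sp d)} f) =
      smulLeftCLM ℂ (fun q => Complex.I * ((q 0 : ℝ) : ℂ)) (lcSchwartzInv d f) := by
  have h := lineDeriv_lcSchwartz (lcSchwartzInv d f)
  rw [lcSchwartz_lcSchwartzInv] at h
  rw [h, lcSchwartzInv_lcSchwartz]

theorem isWeighted_inv_I_coord : IsWeighted fun q : Sp d => (-Complex.I) * (((q 0)⁻¹ : ℝ) : ℂ) := by
  exact (isWeighted_of_temperate (.const (-Complex.I))).smul (isWeighted_ofReal isWeighted_inv)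

/-- A squeezed function may be divided by `ip⁺` any number of times, and each division exhibits its
transform as one more derivative `∂₋` of a Schwartz function. -/
theorem lcSchwartz_mem_tameSpace (f : SqueezedSpace d) :
    lcSchwartz d (toSchwartz d f) ∈ tameSpace d := by
  intro m
  induction m generalizing f with
  | zero => exact ⟨_, (iteratedLineDerivOp_fin_zero _ _).symm⟩
  | succ m ih =>
    obtain ⟨h, hh⟩ := ih (mulSqueezed isWeighted_inv_I_coord f)
    refine ⟨h, ?_⟩
    rw [iteratedLineDerivOp_succ_left]
    have h1 := congrArg (fun g : 𝓢(Sp d, ℂ) => (∂_{(e (Fin.last d) : Sp d)} g : 𝓢(Sp d, ℂ))) hh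
    refine Eq.trans ?_ h1
    dsimp only
    rw [lineDeriv_lcSchwartz]
    congr 1
    ext q
    rw [smulLeftCLM_apply_apply hasTemperateGrowth_I_coord, coe_toSchwartz, coe_toSchwartz,
      mulSqueezed_apply, smul_eq_mul]
    by_cases hq : q 0 = 0
    · simp [squeezed_eq_zero f hq, hq]
    · have : ((q 0 : ℝ) : ℂ) ≠ 0 := Complex.ofReal_ne_zero.2 hq
      push_cast
      field_simp
      rw [Complex.I_sq]
      ring

theorem cTame_injective : Function.Injective (cTame (d := d)) :=
  fun _ _ h => Subtype.ext (DFunLike.coe_injective h)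

/-- The transposed light-cone Fourier transform from the squeezed space to the tame space. -/
def lcTranspose (d : ℕ) : SqueezedSpace d →L[ℂ] tameSpace d :=
  (lcSchwartz d ∘L toSchwartz d).codRestrict _ lcSchwartz_mem_tameSpace

theorem coe_lcTranspose (f : SqueezedSpace d) :
    (lcTranspose d f : 𝓢(Sp d, ℂ)) = lcSchwartz d (toSchwartz d f) := rfl

theorem lcFourierTranspose_eq : lcFourierTranspose d = lcTranspose d := by
  rw [lcFourierTranspose]
  refine inducedCLM_eq cTame_injective _ fun f => ?_
  ext x
  change lcSchwartz d (toSchwartz d f) x = _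
  rw [lcSchwartz_apply, coe_toSchwartz]

theorem lcFourier_apply (v : TameDist d) (f : SqueezedSpace d) :
    lcFourier v f = v (lcTranspose d f) := by
  rw [lcFourier, lcFourierTranspose_eq]
  rfl

/-- Each `∂₋` becomes a factor `ip⁺`, so the inverse transform of a tame function is divisible by
every power of `p⁺`. -/
theorem isFlat_lcSchwartzInv (g : tameSpace d) : IsFlat (lcSchwartzInv d (g : 𝓢(Sp d, ℂ))) := by
  refine isFlat_of_forall_eq_pow_mul fun m => ?_
  obtain ⟨h, hh⟩ := g.2 m
  rw [hh]
  clear hh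
  induction m generalizing h with
  | zero => exact ⟨lcSchwartzInv d h, fun q => by simp⟩
  | succ m ih =>
    obtain ⟨K, hK⟩ := ih h
    refine ⟨Complex.I • K, fun q => ?_⟩
    rw [iteratedLineDerivOp_succ_left]
    have := lcSchwartzInv_lineDeriv (∂^{fun _ : Fin m => (e (Fin.last d) : Sp d)} h)
    refine (DFunLike.congr_fun this q).trans ?_
    rw [smulLeftCLM_apply_apply hasTemperateGrowth_I_coord, hK, smul_apply, smul_eq_mul, smul_eq_mul]
    ring

/-- Flatness upgrades continuity into the Schwartz space to continuity into the squeezed space. Tame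
and squeezed spaces are thereby isomorphic, so `lcFourier` loses no information. -/
theorem exists_lcInverse (d : ℕ) : ∃ T : tameSpace d →L[ℂ] SqueezedSpace d,
    ∀ g, cSqueezed (T g) = lcSchwartzInv d (g : 𝓢(Sp d, ℂ)) :=
  exists_clm_of_flat
    (Topology.IsInducing.withSeminorms (f := (tameSpace d).subtype)
      (schwartz_withSeminorms ℂ (Sp d) ℂ) Topology.IsInducing.subtypeVal)
    (lcSchwartzInv d ∘L (tameSpace d).subtypeL) isFlat_lcSchwartzInv

/-- The inverse of the transposed light-cone Fourier transform. -/
def lcInverse (d : ℕ) : tameSpace d →L[ℂ] SqueezedSpace d := (exists_lcInverse d).choose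

theorem cSqueezed_lcInverse (g : tameSpace d) :
    cSqueezed (lcInverse d g) = lcSchwartzInv d (g : 𝓢(Sp d, ℂ)) :=
  (exists_lcInverse d).choose_spec g

theorem lcTranspose_lcInverse (g : tameSpace d) : lcTranspose d (lcInverse d g) = g := by
  refine Subtype.ext ?_
  rw [coe_lcTranspose]
  have : toSchwartz d (lcInverse d g) = lcSchwartzInv d (g : 𝓢(Sp d, ℂ)) := by
    refine DFunLike.coe_injective ?_
    rw [coe_toSchwartz, cSqueezed_lcInverse]
  rw [this, lcSchwartz_lcSchwartzInv]

theorem lcInverse_lcTranspose (f : SqueezedSpace d) : lcInverse d (lcTranspose d f) = f := by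
  refine cSqueezed_injective ?_
  rw [cSqueezed_lcInverse, coe_lcTranspose, lcSchwartzInv_lcSchwartz, coe_toSchwartz]

end LightConeFourier

/-! ### Solutions of the Klein–Gordon equation -/

section KleinGordon

variable {d : ℕ} {m : ℝ}

/-- The frequency map `(k⁰, k) ↦ (2π)⁻¹ (k⁰, -k)` of the Lorentz-invariant Fourier transform. -/
def stFrequency (d : ℕ) : ST d ≃L[ℝ] ST d :=
  (signFlip (d + 1)).trans
    (ContinuousLinearEquiv.smulLeft (Units.mk0 (2 * Real.pi)⁻¹ (by positivity)))

theorem stFrequency_apply (k : ST d) :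
    stFrequency d k = (2 * Real.pi)⁻¹ • signFlip (d + 1) k := rfl

theorem two_pi_ne_zero : (2 * Real.pi : ℂ) ≠ 0 := by
  exact_mod_cast (by positivity : (2 * Real.pi : ℝ) ≠ 0)

/-- `F ↦ (k ↦ (2π)⁻ⁿ ∫ F(x) exp(-i (k⁰x⁰ - 𝐤·𝐱)) dx)`. -/
def stFourier (d : ℕ) : 𝓢(ST d, ℂ) →L[ℂ] 𝓢(ST d, ℂ) :=
  ((2 * Real.pi : ℂ) ^ (d + 1))⁻¹ • (compCLMOfContinuousLinearEquiv ℂ (stFrequency d) ∘L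
    FourierTransform.fourierCLM ℂ 𝓢(ST d, ℂ))

theorem stFourier_apply_apply (F : 𝓢(ST d, ℂ)) (k : ST d) :
    stFourier d F k = ((2 * Real.pi : ℂ) ^ (d + 1))⁻¹ * 𝓕 F (stFrequency d k) := rfl

/-- The inverse of `stFourier`. -/
def stFourierInv (d : ℕ) : 𝓢(ST d, ℂ) →L[ℂ] 𝓢(ST d, ℂ) :=
  (2 * Real.pi : ℂ) ^ (d + 1) • (FourierTransform.fourierInvCLM ℂ 𝓢(ST d, ℂ) ∘L
    compCLMOfContinuousLinearEquiv ℂ (stFrequency d).symm)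

theorem stFourierInv_stFourier (F : 𝓢(ST d, ℂ)) : stFourierInv d (stFourier d F) = F := by
  have hc : (2 * Real.pi : ℂ) ^ (d + 1) ≠ 0 := pow_ne_zero _ two_pi_ne_zero
  have h1 : compCLMOfContinuousLinearEquiv ℂ (stFrequency d).symm
      (compCLMOfContinuousLinearEquiv ℂ (stFrequency d) (𝓕 F)) = 𝓕 F := by
    ext x; simp
  have h2 : (FourierTransform.fourierInvCLM ℂ 𝓢(ST d, ℂ) : 𝓢(ST d, ℂ) →L[ℂ] 𝓢(ST d, ℂ))
      (compCLMOfContinuousLinearEquiv ℂ (stFrequency d).symm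
        (compCLMOfContinuousLinearEquiv ℂ (stFrequency d) (𝓕 F))) = F := by
    rw [h1]
    change (𝓕⁻ (𝓕 F : 𝓢(ST d, ℂ)) : 𝓢(ST d, ℂ)) = F
    rw [FourierTransform.fourierInv_fourier_eq]
  rw [stFourierInv, smul_apply, stFourier, smul_apply, map_smul, smul_smul, mul_inv_cancel₀ hc,
    one_smul]
  exact h2

theorem stFourier_stFourierInv (F : 𝓢(ST d, ℂ)) : stFourier d (stFourierInv d F) = F := by
  have hc : (2 * Real.pi : ℂ) ^ (d + 1) ≠ 0 := pow_ne_zero _ two_pi_ne_zero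
  have h2 : compCLMOfContinuousLinearEquiv ℂ (stFrequency d)
      (𝓕 (𝓕⁻ (compCLMOfContinuousLinearEquiv ℂ (stFrequency d).symm F))) = F := by
    rw [FourierTransform.fourier_fourierInv_eq]
    ext x; simp
  rw [stFourierInv, smul_apply, stFourier, smul_apply, map_smul, smul_smul, inv_mul_cancel₀ hc,
    one_smul]
  exact h2

theorem stFourier_lineDeriv (v : ST d) (F : 𝓢(ST d, ℂ)) (k : ST d) :
    stFourier d (∂_{v} F) k =
      Complex.I * ((inner ℝ (signFlip (d + 1) k) v : ℝ) : ℂ) * stFourier d F k := by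
  have h1 : (fun x : ST d => inner ℝ x v).HasTemperateGrowth :=
    Function.hasTemperateGrowth_inner_left _
  rw [stFourier_apply_apply, stFourier_apply_apply, fourier_lineDerivOp_eq, smul_apply,
    smulLeftCLM_apply_apply h1, stFrequency_apply, real_inner_smul_left]
  simp only [smul_eq_mul, Complex.real_smul]
  have := two_pi_ne_zero
  push_cast
  field_simp

/-- The Klein–Gordon operator on test functions. -/
def testKleinGordon (m : ℝ) (F : 𝓢(ST d, ℂ)) : 𝓢(ST d, ℂ) :=
  (∂_{(e 0 : ST d)} (∂_{(e 0 : ST d)} F : 𝓢(ST d, ℂ)) : 𝓢(ST d, ℂ))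
    - ∑ i : Fin (d + 1),
      (∂_{(e i.succ : ST d)} (∂_{(e i.succ : ST d)} F : 𝓢(ST d, ℂ)) : 𝓢(ST d, ℂ))
    + ((m ^ 2 : ℝ) : ℂ) • F

theorem lineDeriv_lineDeriv_apply {k : ℕ} (u : 𝓢'(EuclideanSpace ℝ (Fin k), ℂ))
    (v w : EuclideanSpace ℝ (Fin k)) (F : 𝓢(EuclideanSpace ℝ (Fin k), ℂ)) :
    (∂_{v} (∂_{w} u : 𝓢'(EuclideanSpace ℝ (Fin k), ℂ)) : 𝓢'(EuclideanSpace ℝ (Fin k), ℂ)) F =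
      u (∂_{w} (∂_{v} F : 𝓢(EuclideanSpace ℝ (Fin k), ℂ))) := by
  rw [TemperedDistribution.lineDerivOp_apply_apply, TemperedDistribution.lineDerivOp_apply_apply,
    lineDerivOp_neg, neg_neg]

theorem kleinGordon_apply (u : 𝓢'(ST d, ℂ)) (F : 𝓢(ST d, ℂ)) :
    kleinGordon m u F = u (testKleinGordon m F) := by
  rw [kleinGordon, testKleinGordon, add_apply, sub_apply, sum_apply, map_add, map_sub, map_sum,
    map_smul, smul_apply, lineDeriv_lineDeriv_apply]
  simp only [lineDeriv_lineDeriv_apply]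

theorem stFourier_testKleinGordon (F : 𝓢(ST d, ℂ)) (k : ST d) :
    stFourier d (testKleinGordon m F) k =
      ((omega m (tail k) : ℂ) ^ 2 - (k 0 : ℂ) ^ 2) * stFourier d F k := by
  rw [testKleinGordon, map_add, map_sub, map_sum, map_smul, add_apply, sub_apply, sum_apply,
    smul_apply]
  simp only [stFourier_lineDeriv, inner_e, signFlip_zero, signFlip_succ, smul_eq_mul]
  have h : (omega m (tail k) : ℂ) ^ 2 = ∑ i : Fin (d + 1), (k i.succ : ℂ) ^ 2 + (m : ℂ) ^ 2 := by
    have h1 := omega_sq m (tail k)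
    rw [EuclideanSpace.norm_sq_eq] at h1
    simp only [tail_apply, Real.norm_eq_abs, sq_abs] at h1
    exact_mod_cast h1
  rw [h]
  have h2 : ∀ i : Fin (d + 1), Complex.I * ((-k i.succ : ℝ) : ℂ) *
      (Complex.I * ((-k i.succ : ℝ) : ℂ) * stFourier d F k) =
      -((k i.succ : ℂ) ^ 2 * stFourier d F k) := by
    intro i
    push_cast
    linear_combination ((k i.succ : ℂ) ^ 2 * stFourier d F k) * Complex.I_mul_I
  simp only [h2, Finset.sum_neg_distrib, ← Finset.sum_mul]
  push_cast
  linear_combination ((k 0 : ℂ) ^ 2 * stFourier d F k) * Complex.I_mul_I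

theorem hasTemperateGrowth_energy (hm : 0 < m) (σ : ℝ) :
    (fun p : Sp d => σ * omega m p).HasTemperateGrowth :=
  (Function.HasTemperateGrowth.const σ).mul (hasTemperateGrowth_omega hm)

/-- Restriction of the Fourier transform to the mass shell `{k⁰ = σ ω(𝐤)}`. -/
def shellCLM (hm : 0 < m) (σ : ℝ) : 𝓢(ST d, ℂ) →L[ℂ] 𝓢(Sp d, ℂ) :=
  graphCLM (hasTemperateGrowth_energy hm σ) ∘L stFourier d

theorem shellCLM_apply (hm : 0 < m) (σ : ℝ) (F : 𝓢(ST d, ℂ)) (p : Sp d) :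
    shellCLM hm σ F p = stFourier d F (cons (σ * omega m p) p) := rfl

theorem exists_bump (hm : 0 < m) : ∃ φ : 𝓢(ℝ, ℂ), φ 0 = 1 ∧ ∀ y, m ≤ |y| → φ y = 0 := by
  let b : ContDiffBump (0 : ℝ) := ⟨m / 2, m, by positivity, by linarith⟩
  have hc : HasCompactSupport fun t => (b t : ℂ) :=
    b.hasCompactSupport.comp_left (g := Complex.ofReal) rfl
  have hs : ContDiff ℝ ∞ fun t => (b t : ℂ) := Complex.ofRealCLM.contDiff.comp b.contDiff
  refine ⟨hc.toSchwartzMap hs, ?_, fun y hy => ?_⟩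
  · change (b 0 : ℂ) = 1
    rw [b.one_of_mem_closedBall (by simp [b]; positivity), Complex.ofReal_one]
  · change (b y : ℂ) = 0
    rw [b.zero_of_le_dist (by simpa [b] using hy), Complex.ofReal_zero]

/-- Extension of a function from a mass shell to `ℝ¹⁺ⁿ`, vanishing on the opposite shell. -/
theorem exists_shell_extension (hm : 0 < m) {σ : ℝ} (hσ : σ ^ 2 = 1) :
    ∃ L : 𝓢(Sp d, ℂ) →L[ℂ] 𝓢(ST d, ℂ), ∀ h p,
      L h (cons (σ * omega m p) p) = h p ∧ L h (cons (-σ * omega m p) p) = 0 := by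
  obtain ⟨φ, hφ, hφ0⟩ := exists_bump hm
  -- The extension is `k ↦ φ(k⁰ - σω(𝐤)) h(𝐤)`. On the opposite shell the argument of `φ` has
  -- modulus `2ω ≥ 2m`, outside the support: the mass gap separates the shells.
  refine ⟨shearCLM (hasTemperateGrowth_energy hm (-σ)) ∘L tensorCLM φ, fun h p => ⟨?_, ?_⟩⟩
  · rw [ContinuousLinearMap.comp_apply, shearCLM_apply, tensorCLM_apply, tensor_apply]
    simp [hφ]
  · rw [ContinuousLinearMap.comp_apply, shearCLM_apply, tensorCLM_apply, tensor_apply]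
    simp only [cons_zero, tail_cons]
    rw [hφ0, zero_mul]
    have h1 : m ≤ omega m p := by
      refine Real.le_sqrt_of_sq_le ?_
      nlinarith [sq_nonneg ‖p‖]
    have h2 : |σ| = 1 := by rcases sign_cases hσ with rfl | rfl <;> simp
    rw [← two_mul, abs_mul, abs_mul, abs_neg, h2, abs_two, abs_of_pos (omega_pos hm p)]
    linarith

/-- Divide by `k⁰ - ω` and then by `k⁰ + ω`. The first quotient still vanishes on the lower shell
because `k⁰ - ω = -2ω ≠ 0` there. The product of the divisors is minus the symbol, hence the sign of
the witness. -/
theorem exists_eq_mul_of_shell_eq_zero (hm : 0 < m) (G : 𝓢(ST d, ℂ))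
    (hG : ∀ p, G (cons (1 * omega m p) p) = 0) (hG' : ∀ p, G (cons (-1 * omega m p) p) = 0) :
    ∃ K : 𝓢(ST d, ℂ), ∀ k, G k = ((omega m (tail k) : ℂ) ^ 2 - (k 0 : ℂ) ^ 2) * K k := by
  obtain ⟨K, hK⟩ := exists_eq_sub_mul (hasTemperateGrowth_energy hm 1) G hG
  obtain ⟨K', hK'⟩ := exists_eq_sub_mul (hasTemperateGrowth_energy hm (-1)) K (fun p => by
    have h1 := hK (cons (-1 * omega m p) p)
    rw [hG', cons_zero, tail_cons] at h1
    have h2 : ((-1 * omega m p : ℝ) : ℂ) - ((1 * omega m p : ℝ) : ℂ) ≠ 0 := by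
      rw [← Complex.ofReal_sub]
      refine Complex.ofReal_ne_zero.2 ?_
      have := omega_pos hm p
      linarith
    exact (mul_eq_zero.1 h1.symm).resolve_left h2)
  refine ⟨-K', fun k => ?_⟩
  rw [hK, hK', neg_apply]
  push_cast
  ring

/-- Removing from `F̂` the extensions of its two shell restrictions leaves a function divisible by
`ω² - (k⁰)²`, that is, the transform of the Klein–Gordon operator applied to a test function, which
`u` annihilates. The amplitudes are `u` composed with the extension maps. -/
theorem exists_amplitudes (hm : 0 < m) {u : 𝓢'(ST d, ℂ)} (hu : kleinGordon m u = 0) :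
    ∃ a b : 𝓢'(Sp d, ℂ), ∀ F, u F = a (shellCLM hm 1 F) + b (shellCLM hm (-1) F) := by
  obtain ⟨L, hL⟩ := exists_shell_extension (d := d) hm one_sq'
  obtain ⟨L', hL'⟩ := exists_shell_extension (d := d) hm neg_one_sq'
  refine ⟨PointwiseConvergenceCLM.precomp ℂ (stFourierInv d ∘L L) u,
    PointwiseConvergenceCLM.precomp ℂ (stFourierInv d ∘L L') u, fun F => ?_⟩
  change u F = u (stFourierInv d (L (shellCLM hm 1 F))) +
    u (stFourierInv d (L' (shellCLM hm (-1) F)))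
  obtain ⟨K, hK⟩ := exists_eq_mul_of_shell_eq_zero hm
    (stFourier d F - L (shellCLM hm 1 F) - L' (shellCLM hm (-1) F))
    (fun p => by
      have h := (hL' (shellCLM hm (-1) F) p).2
      rw [neg_neg] at h
      rw [sub_apply, sub_apply, (hL _ p).1, h, shellCLM_apply, sub_self, sub_zero])
    (fun p => by
      rw [sub_apply, sub_apply, (hL _ p).2, (hL' _ p).1, shellCLM_apply, sub_zero, sub_self])
  have h1 : stFourier d F - L (shellCLM hm 1 F) - L' (shellCLM hm (-1) F) =
      stFourier d (testKleinGordon m (stFourierInv d K)) := by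
    ext k
    rw [hK, stFourier_testKleinGordon, stFourier_stFourierInv]
  have h2 := congrArg (fun G => u (stFourierInv d G)) h1
  simp only [map_sub, stFourierInv_stFourier] at h2
  rw [← kleinGordon_apply, hu, zero_apply] at h2
  linear_combination h2

theorem shellCLM_lineDeriv_time (hm : 0 < m) (σ : ℝ) (F : 𝓢(ST d, ℂ)) :
    shellCLM hm σ (∂_{(e 0 : ST d)} F) = (Complex.I * σ) •
      smulLeftCLM ℂ (fun p => (omega m p : ℂ)) (shellCLM hm σ F) := by
  ext p
  rw [smul_apply, smulLeftCLM_apply_apply (omega_hasTemperateGrowth hm), shellCLM_apply,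
    stFourier_lineDeriv, inner_e, signFlip_zero, cons_zero, shellCLM_apply, smul_eq_mul, smul_eq_mul]
  push_cast
  ring

end KleinGordon

/-! ### Restrictions of solutions -/

section Restrictions

variable {d : ℕ} {m : ℝ}

/-- The definitions of restriction only assert that some family exists. This form of the fundamental
lemma of the calculus of variations makes the family unique on `Ω`, so its value at `0` can be
computed from an explicit one. -/
theorem eqOn_of_integral_eq {Ω : Set ℝ} (hΩ : IsOpen Ω) {D₁ D₂ : ℝ → ℂ} (h₁ : ContinuousOn D₁ Ω)
    (h₂ : ContinuousOn D₂ Ω)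
    (h : ∀ f : 𝓢(ℝ, ℂ), HasCompactSupport f → tsupport f ⊆ Ω →
      ∫ t in Ω, D₁ t * f t = ∫ t in Ω, D₂ t * f t) : Set.EqOn D₁ D₂ Ω := by
  have hint : ∀ (D : ℝ → ℂ) (f : 𝓢(ℝ, ℂ)), ContinuousOn D Ω → HasCompactSupport f →
      tsupport f ⊆ Ω → IntegrableOn (fun t => D t * f t) Ω := by
    intro D f hD hf hs
    have h1 : IntegrableOn (fun t => D t * f t) (tsupport f) :=
      ((hD.mono hs).mul f.continuous.continuousOn).integrableOn_compact hf
    rw [integrableOn_iff_integrable_of_support_subset] at h1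
    · exact h1.integrableOn
    · intro t ht
      refine subset_tsupport f fun h0 => ht ?_
      simp [h0]
  have hae : ∀ᵐ t : ℝ, t ∈ Ω → (D₁ - D₂) t = 0 := by
    refine hΩ.ae_eq_zero_of_integral_contDiff_smul_eq_zero
      ((h₁.sub h₂).locallyIntegrableOn hΩ.measurableSet) fun g hg hgc hgs => ?_
    have hc : HasCompactSupport fun t => (g t : ℂ) := hgc.comp_left (g := Complex.ofReal) rfl
    have hs : ContDiff ℝ ∞ fun t => (g t : ℂ) := Complex.ofRealCLM.contDiff.comp hg
    obtain ⟨f, hf⟩ : ∃ f : 𝓢(ℝ, ℂ), ⇑f = fun t => (g t : ℂ) := ⟨hc.toSchwartzMap hs, rfl⟩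
    have hts : tsupport f ⊆ Ω := by
      rw [hf]
      exact (closure_mono (Function.support_comp_subset (g := Complex.ofReal) rfl g)).trans hgs
    rw [← hf] at hc
    have h3 := h f hc hts
    rw [← sub_eq_zero, ← integral_sub (hint D₁ f h₁ hc hts) (hint D₂ f h₂ hc hts)] at h3
    have h4 : ∀ t, t ∉ Ω → D₁ t * f t - D₂ t * f t = 0 := fun t ht => by
      rw [image_eq_zero_of_notMem_tsupport fun h0 => ht (hts h0), mul_zero, mul_zero, sub_zero]
    rw [setIntegral_eq_integral_of_forall_compl_eq_zero h4] at h3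
    rw [← h3]
    refine integral_congr_ae (Filter.Eventually.of_forall fun t => ?_)
    dsimp only
    rw [hf, Complex.real_smul, Pi.sub_apply]
    ring
  refine Measure.eqOn_open_of_ae_eq (μ := volume) ?_ hΩ h₁ h₂
  rw [Filter.EventuallyEq, ae_restrict_iff' hΩ.measurableSet]
  filter_upwards [hae] with t ht htΩ using sub_eq_zero.1 (ht htΩ)

/-! ### Integral formulas for the Fourier transforms and for shell restrictions of tensor products.
-/

theorem integral_comp_of_norm_eq {k : ℕ}
    (A : EuclideanSpace ℝ (Fin k) ≃L[ℝ] EuclideanSpace ℝ (Fin k)) (hA : ∀ x, ‖A x‖ = ‖x‖)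
    (G : EuclideanSpace ℝ (Fin k) → ℂ) : ∫ x, G (A x) = ∫ x, G x := by
  let R : EuclideanSpace ℝ (Fin k) ≃ₗᵢ[ℝ] EuclideanSpace ℝ (Fin k) := ⟨A.toLinearEquiv, hA⟩
  exact R.measurePreserving.integral_comp' (f := R.toHomeomorph.toMeasurableEquiv) G

theorem integral_comp_inv_two_pi (G : Sp d → ℂ) :
    ∫ x, G ((2 * Real.pi) • x) = ((2 * Real.pi : ℂ) ^ (d + 1))⁻¹ * ∫ x, G x := by
  rw [Measure.integral_comp_smul, finrank_euclideanSpace_fin, abs_of_pos (by positivity),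
    Complex.real_smul]
  push_cast
  rfl

/-- The inverse of the Fourier transform `fourierS`. -/
def fourierSInv (d : ℕ) : 𝓢(Sp d, ℂ) →L[ℂ] 𝓢(Sp d, ℂ) :=
  FourierTransform.fourierInvCLM ℂ 𝓢(Sp d, ℂ) ∘L
    compCLMOfContinuousLinearEquiv ℂ (scale d).symm

theorem fourierS_fourierSInv (g : 𝓢(Sp d, ℂ)) : fourierS (fourierSInv d g) = g := by
  change compCLMOfContinuousLinearEquiv ℂ (scale d)
    (𝓕 (𝓕⁻ (compCLMOfContinuousLinearEquiv ℂ (scale d).symm g))) = g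
  rw [FourierTransform.fourier_fourierInv_eq]
  ext x; simp

theorem fourierSInv_fourierS (g : 𝓢(Sp d, ℂ)) : fourierSInv d (fourierS g) = g := by
  have h1 : compCLMOfContinuousLinearEquiv ℂ (scale d).symm
      (compCLMOfContinuousLinearEquiv ℂ (scale d) (𝓕 g)) = 𝓕 g := by
    ext x; simp
  change (𝓕⁻ (compCLMOfContinuousLinearEquiv ℂ (scale d).symm
      (compCLMOfContinuousLinearEquiv ℂ (scale d) (𝓕 g)) : 𝓢(Sp d, ℂ)) : 𝓢(Sp d, ℂ)) = g
  rw [h1, FourierTransform.fourierInv_fourier_eq]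

theorem scale_symm_apply (x : Sp d) : (scale d).symm x = (2 * Real.pi) • x := by
  rw [ContinuousLinearEquiv.symm_apply_eq, scale_apply, smul_smul,
    inv_mul_cancel₀ (by positivity), one_smul]

theorem fourierSInv_apply (g : 𝓢(Sp d, ℂ)) (p : Sp d) :
    fourierSInv d g p = ((2 * Real.pi : ℂ) ^ (d + 1))⁻¹ *
      ∫ x : Sp d, Complex.exp (Complex.I * (∑ i, x i * p i : ℝ)) * g x := by
  change 𝓕⁻ (compCLMOfContinuousLinearEquiv ℂ (scale d).symm g) p = _
  rw [SchwartzMap.fourierInv_coe, Real.fourierInv_eq', ← integral_comp_inv_two_pi]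
  refine integral_congr_ae (Filter.Eventually.of_forall fun x => ?_)
  simp only [compCLMOfContinuousLinearEquiv_apply, Function.comp, scale_symm_apply, smul_eq_mul,
    PiLp.smul_apply, PiLp.inner_apply, RCLike.inner_apply, conj_trivial]
  congr 2
  rw [mul_comm Complex.I, mul_assoc, Finset.mul_sum]
  congr 2
  rw [Finset.mul_sum]
  exact Finset.sum_congr rfl fun i _ => by ring

theorem norm_signFlip {k : ℕ} (x : EuclideanSpace ℝ (Fin (k + 1))) : ‖signFlip k x‖ = ‖x‖ := by
  refine (sq_eq_sq₀ (norm_nonneg _) (norm_nonneg _)).1 ?_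
  rw [EuclideanSpace.norm_sq_eq, EuclideanSpace.norm_sq_eq, Fin.sum_univ_succ, Fin.sum_univ_succ]
  simp

theorem lcSchwartzInv_apply (g : 𝓢(Sp d, ℂ)) (q : Sp d) :
    lcSchwartzInv d g q = ((2 * Real.pi : ℂ) ^ (d + 1))⁻¹ *
      ∫ x : Sp d, Complex.exp (-(Complex.I * (lcPairing x q : ℝ))) * g x := by
  let A : Sp d ≃L[ℝ] Sp d := (rotate d).toContinuousLinearEquiv.trans (signFlip d)
  have hA : ∀ x, ‖A x‖ = ‖x‖ := fun x => (norm_signFlip _).trans ((rotate d).norm_map x)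
  have hΛ : ∀ x, lcFrequency d x = (2 * Real.pi)⁻¹ • A x := fun x => rfl
  have hΛ' : ∀ z, (lcFrequency d).symm z = A.symm ((2 * Real.pi) • z) := by
    intro z
    rw [ContinuousLinearEquiv.symm_apply_eq, hΛ, ContinuousLinearEquiv.apply_symm_apply, smul_smul,
      inv_mul_cancel₀ (by positivity), one_smul]
  change 𝓕 (compCLMOfContinuousLinearEquiv ℂ (lcFrequency d).symm g) q = _
  have hR : ∀ G : Sp d → ℂ, ((2 * Real.pi : ℂ) ^ (d + 1))⁻¹ * ∫ x, G x =
      ∫ z, G ((lcFrequency d).symm z) := by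
    intro G
    rw [← integral_comp_of_norm_eq A.symm (fun x => by
      rw [← hA (A.symm x), ContinuousLinearEquiv.apply_symm_apply]) G,
      ← integral_comp_inv_two_pi (fun x => G (A.symm x))]
    simp only [hΛ']
  rw [SchwartzMap.fourier_coe, Real.fourier_eq', hR]
  refine integral_congr_ae (Filter.Eventually.of_forall fun z => ?_)
  simp only [compCLMOfContinuousLinearEquiv_apply, Function.comp, smul_eq_mul]
  congr 2
  rw [← inner_lcFrequency, ContinuousLinearEquiv.apply_symm_apply, real_inner_comm]
  push_cast
  ring

theorem stFourier_eq_integral (F : 𝓢(ST d, ℂ)) (k : ST d) :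
    stFourier d F k = ((2 * Real.pi : ℂ) ^ (d + 1))⁻¹ * ∫ x : ST d,
      Complex.exp (-(Complex.I * (x 0 * k 0 - ∑ i : Fin (d + 1), x i.succ * k i.succ : ℝ))) * F x := by
  rw [stFourier_apply_apply, SchwartzMap.fourier_coe, Real.fourier_eq']
  congr 1
  refine integral_congr_ae (Filter.Eventually.of_forall fun x => ?_)
  have h1 : inner ℝ x (stFrequency d k) = (2 * Real.pi)⁻¹ *
      (x 0 * k 0 - ∑ i : Fin (d + 1), x i.succ * k i.succ) := by
    rw [stFrequency_apply, real_inner_smul_right, PiLp.inner_apply, Fin.sum_univ_succ]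
    simp [mul_comm]
    ring
  simp only [h1, smul_eq_mul]
  congr 2
  have := two_pi_ne_zero
  push_cast
  field_simp

theorem exp_neg_I_sub (a b : ℝ) : Complex.exp (-(Complex.I * (a - b : ℝ))) =
    Complex.exp (-(Complex.I * a)) * Complex.exp (Complex.I * b) := by
  rw [← Complex.exp_add]
  congr 1
  push_cast
  ring

theorem exp_neg_I_add (a b : ℝ) : Complex.exp (-(Complex.I * (a + b : ℝ))) =
    Complex.exp (-(Complex.I * a)) * Complex.exp (-(Complex.I * b)) := by
  rw [← Complex.exp_add]
  congr 1
  push_cast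
  ring

/-- The normalization of `stFourier` has exponent `d + 1`, the number of space dimensions, so that
the spatial factor is exactly the inverse of `fourierS` while the time integral carries no constant.
-/
theorem shellCLM_tensor (hm : 0 < m) (σ : ℝ) (f : 𝓢(ℝ, ℂ)) (g : 𝓢(Sp d, ℂ)) (p : Sp d) :
    shellCLM hm σ (tensor f g) p =
      (∫ t : ℝ, Complex.exp (-(Complex.I * (t * (σ * omega m p) : ℝ))) * f t) *
        fourierSInv d g p := by
  rw [shellCLM_apply, stFourier_eq_integral, fourierSInv_apply, mul_left_comm,
    ← integral_mul_tail]
  congr 1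
  refine integral_congr_ae (Filter.Eventually.of_forall fun x => ?_)
  simp only [tensor_apply, cons_zero, cons_succ, exp_neg_I_sub, tail_apply]
  ring

theorem norm_sq_st (x : ST d) : ‖x‖ ^ 2 =
    x 0 ^ 2 + (∑ i : Fin d, x i.castSucc.succ ^ 2 + x (Fin.last (d + 1)) ^ 2) := by
  rw [EuclideanSpace.norm_sq_eq, Fin.sum_univ_succ, Fin.sum_univ_castSucc]
  simp

theorem norm_kappa (x : ST d) : ‖kappa d x‖ = ‖x‖ := by
  have h2 : √(2 : ℝ) ^ 2 = 2 := Real.sq_sqrt (by norm_num)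
  have hl : Fin.last (d + 1) ≠ 0 := Fin.last_pos.ne'
  refine (sq_eq_sq₀ (norm_nonneg _) (norm_nonneg _)).1 ?_
  rw [norm_sq_st, norm_sq_st]
  have h3 : ∀ i : Fin d, kappa d x i.castSucc.succ = x i.castSucc.succ := by
    intro i
    have h1 : i.castSucc.succ ≠ 0 := Fin.succ_ne_zero _
    have h2 : i.castSucc.succ ≠ Fin.last (d + 1) := by
      rw [Fin.succ_castSucc]; exact (Fin.castSucc_lt_last _).ne
    simp [kappaFun, h1, h2]
  have h4 : kappa d x 0 = (x 0 + x (Fin.last _)) / √2 := rfl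
  have h5 : kappa d x (Fin.last (d + 1)) = (x 0 - x (Fin.last _)) / √2 := by
    simp [kappaFun, hl]
  simp only [h3, h4, h5, div_pow, h2]
  ring

/-- In the coordinates `y = κ(x)` the phase on the shell becomes `y⁺p⁻` plus `lcPairing (tail y) (mu
m σ p)`, with `p⁻ = (σω - pⁿ)/√2`. Since `κ` is an isometry, no Jacobian appears. -/
theorem shellCLM_tensor_kappa (hm : 0 < m) {σ : ℝ} (hσ : σ ^ 2 = 1) (f : 𝓢(ℝ, ℂ)) (g : tameSpace d)
    (p : Sp d) :
    shellCLM hm σ (compCLMOfContinuousLinearEquiv ℂ (kappa d) (tensor f (g : 𝓢(Sp d, ℂ)))) p =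
      (∫ t : ℝ, Complex.exp (-(Complex.I * (t * ((σ * omega m p - p (Fin.last d)) / √2) : ℝ))) *
        f t) * compMu hm hσ (lcInverse d g) p := by
  rw [shellCLM_apply, stFourier_eq_integral, compMu_apply, cSqueezed_lcInverse, lcSchwartzInv_apply,
    mul_left_comm, ← integral_mul_tail]
  congr 1
  refine Eq.trans ?_ (integral_comp_of_norm_eq (kappa d) norm_kappa _)
  refine integral_congr_ae (Filter.Eventually.of_forall fun x => ?_)
  set y := kappa d x with hy
  have hx : x = kappa d y := (kappaFun_involutive x).symm
  have hl : Fin.last (d + 1) ≠ 0 := Fin.last_pos.ne'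
  have h3 : ∀ i : Fin d, x i.castSucc.succ = y i.castSucc.succ := by
    intro i
    have h1 : i.castSucc.succ ≠ 0 := Fin.succ_ne_zero _
    have h2 : i.castSucc.succ ≠ Fin.last (d + 1) := by
      rw [Fin.succ_castSucc]; exact (Fin.castSucc_lt_last _).ne
    rw [hx]
    simp [kappaFun, h1, h2]
  have h4 : x 0 = (y 0 + y (Fin.last _)) / √2 := by rw [hx]; rfl
  have h5 : x (Fin.last (d + 1)) = (y 0 - y (Fin.last _)) / √2 := by
    rw [hx]; simp [kappaFun, hl]
  have key : x 0 * (cons (σ * omega m p) p : ST d) 0 -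
      ∑ i : Fin (d + 1), x i.succ * (cons (σ * omega m p) p : ST d) i.succ =
      y 0 * ((σ * omega m p - p (Fin.last d)) / √2) + lcPairing (tail y) (mu m σ p) := by
    have h6 : (cons (σ * omega m p) p : ST d) (Fin.last (d + 1)) = p (Fin.last d) := by
      rw [← Fin.succ_last, cons_succ]
    rw [Fin.sum_univ_castSucc, lcPairing]
    rw [Fin.succ_last, h6]
    simp only [cons_zero, cons_succ, h3, h4, h5, Fin.succ_last, tail_apply, mu_zero, mu_succ]
    ring
  simp only [compCLMOfContinuousLinearEquiv_apply, Function.comp, ← hy, tensor_apply]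
  rw [key, exp_neg_I_add]
  ring

/-- The explicit family has spatial Fourier transform `exp(-iωt) a + exp(iωt) b`. Uniqueness of
families gives one direction, the explicit family itself the other. -/
theorem isRestriction_iff (hm : 0 < m) {u : 𝓢'(ST d, ℂ)} {a b : 𝓢'(Sp d, ℂ)}
    (hu : ∀ F, u F = a (shellCLM hm 1 F) + b (shellCLM hm (-1) F)) (v : 𝓢'(Sp d, ℂ)) :
    IsRestriction u v ↔ ∀ g, fourierT v g = a g + b g := by
  let W : ℝ → 𝓢'(Sp d, ℂ) := fun t =>
    PointwiseConvergenceCLM.precomp ℂ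
      (smulLeftCLM ℂ (phase (fun p => 1 * omega m p) t) ∘L fourierSInv d) a +
    PointwiseConvergenceCLM.precomp ℂ
      (smulLeftCLM ℂ (phase (fun p => -1 * omega m p) t) ∘L fourierSInv d) b
  have hW : ∀ t g, W t g = a (smulLeftCLM ℂ (phase (fun p => 1 * omega m p) t) (fourierSInv d g)) +
      b (smulLeftCLM ℂ (phase (fun p => -1 * omega m p) t) (fourierSInv d g)) := fun t g => rfl
  have hθ := hasTemperateGrowth_energy (d := d) hm
  have hWsmooth : ∀ g, ContDiff ℝ ∞ fun t => W t g := fun g =>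
    (contDiff_phase (hθ 1) a _).add (contDiff_phase (hθ (-1)) b _)
  have hWint : ∀ (f : 𝓢(ℝ, ℂ)) g, Integrable (fun t => W t g * f t) ∧
      u (tensor f g) = ∫ t, W t g * f t := by
    intro f g
    have h1 := integrable_phase (hθ 1) a (fourierSInv d g) f
    have h2 := integrable_phase (hθ (-1)) b (fourierSInv d g) f
    simp only [hW, add_mul]
    refine ⟨h1.add h2, ?_⟩
    refine Eq.trans ?_ (integral_add h1 h2).symm
    rw [integral_phase (hθ 1) a _ f _ (shellCLM_tensor hm 1 f g),
      integral_phase (hθ (-1)) b _ f _ (shellCLM_tensor hm (-1) f g)]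
    exact hu _
  have hW0 : ∀ g, W 0 g = a (fourierSInv d g) + b (fourierSInv d g) := by
    intro g
    have h1 : ∀ h : 𝓢(Sp d, ℂ), smulLeftCLM ℂ (fun _ : Sp d => (1 : ℂ)) h = h := by
      intro h; ext p; rw [smulLeftCLM_apply_apply (.const 1), one_smul]
    rw [hW, phase_zero, phase_zero, h1]
  constructor
  · rintro ⟨U, hs, hi, rfl⟩ g
    have h := eqOn_of_integral_eq isOpen_univ (hs (fourierS g)).continuous.continuousOn
      (hWsmooth (fourierS g)).continuous.continuousOn (fun f _ _ => by
        rw [setIntegral_univ, setIntegral_univ, ← (hi f _).2, ← (hWint f _).2]) (Set.mem_univ 0)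
    change U 0 (fourierS g) = _
    refine h.trans ?_
    change W 0 (fourierS g) = _
    rw [hW0, fourierSInv_fourierS]
  · intro h
    refine ⟨W, hWsmooth, hWint, ?_⟩
    ext g
    rw [hW0, ← h]
    change v (fourierS (fourierSInv d g)) = v g
    rw [fourierS_fourierSInv]

theorem abs_det_kappa_symm : |((kappa d).symm : ST d →L[ℝ] ST d).det| = 1 := by
  have h : ∀ x, ‖(kappa d).symm x‖ = ‖x‖ := fun x => by
    rw [← norm_kappa ((kappa d).symm x), ContinuousLinearEquiv.apply_symm_apply]
  exact abs_det_isometry (⟨(kappa d).symm.toLinearEquiv, h⟩ : ST d ≃ₗᵢ[ℝ] ST d)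

theorem distComp_kappa_symm_apply (u : 𝓢'(ST d, ℂ)) (F : 𝓢(ST d, ℂ)) :
    distComp u (kappa d).symm F = u (compCLMOfContinuousLinearEquiv ℂ (kappa d) F) := by
  rw [distComp, abs_det_kappa_symm, inv_one, Complex.ofReal_one, one_smul]
  rfl

/-- The frequencies are now `p⁻ = (±ω - pⁿ)/√2`. Tameness of `g` enters through `lcInverse`: its
light-cone transform must be squeezed for the composition with `μ` to be a Schwartz function. An
arbitrary `Ω` is compared with the explicit global family only on `Ω`. -/
theorem isTameRestriction_iff (hm : 0 < m) {u : 𝓢'(ST d, ℂ)} {a b : 𝓢'(Sp d, ℂ)}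
    (hu : ∀ F, u F = a (shellCLM hm 1 F) + b (shellCLM hm (-1) F)) (v : TameDist d) :
    IsTameRestriction (distComp u (kappa d).symm) v ↔ ∀ f : SqueezedSpace d,
      lcFourier v f = a (compMu hm one_sq' f) + b (compMu hm neg_one_sq' f) := by
  let θ : ℝ → Sp d → ℝ := fun σ p => (σ * omega m p - p (Fin.last d)) / √2
  have hθ : ∀ σ, (θ σ).HasTemperateGrowth := by
    intro σ
    have h2 : (fun p : Sp d => p (Fin.last d)).HasTemperateGrowth :=
      (EuclideanSpace.proj (𝕜 := ℝ) (Fin.last d) : Sp d →L[ℝ] ℝ).hasTemperateGrowth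
    exact ((hasTemperateGrowth_energy hm σ).sub h2).mul (.const (√2)⁻¹)
  let W : ℝ → TameDist d := fun t =>
    PointwiseConvergenceCLM.precomp ℂ
      (smulLeftCLM ℂ (phase (θ 1) t) ∘L compMu hm one_sq' ∘L lcInverse d) a +
    PointwiseConvergenceCLM.precomp ℂ
      (smulLeftCLM ℂ (phase (θ (-1)) t) ∘L compMu hm neg_one_sq' ∘L lcInverse d) b
  have hW : ∀ t g, W t g =
      a (smulLeftCLM ℂ (phase (θ 1) t) (compMu hm one_sq' (lcInverse d g))) +
      b (smulLeftCLM ℂ (phase (θ (-1)) t) (compMu hm neg_one_sq' (lcInverse d g))) :=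
    fun t g => rfl
  have hWsmooth : ∀ g, ContDiff ℝ ∞ fun t => W t g := fun g =>
    (contDiff_phase (hθ 1) a _).add (contDiff_phase (hθ (-1)) b _)
  have hWint : ∀ (f : 𝓢(ℝ, ℂ)) (g : tameSpace d),
      relax (distComp u (kappa d).symm) (tameTensor f g) = ∫ t, W t g * f t := by
    intro f g
    have h1 := integrable_phase (hθ 1) a (compMu hm one_sq' (lcInverse d g)) f
    have h2 := integrable_phase (hθ (-1)) b (compMu hm neg_one_sq' (lcInverse d g)) f
    simp only [hW, add_mul]
    refine Eq.trans ?_ (integral_add h1 h2).symm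
    rw [integral_phase (hθ 1) a _ f _ (shellCLM_tensor_kappa hm one_sq' f g),
      integral_phase (hθ (-1)) b _ f _ (shellCLM_tensor_kappa hm neg_one_sq' f g)]
    change distComp u (kappa d).symm (tensor f (g : 𝓢(Sp d, ℂ))) = _
    rw [distComp_kappa_symm_apply, hu]
    rfl
  have hW0 : ∀ g, W 0 g = a (compMu hm one_sq' (lcInverse d g)) +
      b (compMu hm neg_one_sq' (lcInverse d g)) := by
    intro g
    have h1 : ∀ h : 𝓢(Sp d, ℂ), smulLeftCLM ℂ (fun _ : Sp d => (1 : ℂ)) h = h := by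
      intro h; ext p; rw [smulLeftCLM_apply_apply (.const 1), one_smul]
    rw [hW, phase_zero, phase_zero, h1, h1]
  constructor
  · rintro ⟨Ω, U, hΩ, h0, ⟨hs, hi⟩, rfl⟩ f
    have h := eqOn_of_integral_eq hΩ (hs (lcTranspose d f)).continuousOn
      (hWsmooth (lcTranspose d f)).continuous.continuousOn (fun φ hc hsub => by
        rw [← hi φ _ hc hsub, hWint, setIntegral_eq_integral_of_forall_compl_eq_zero]
        intro t ht
        rw [image_eq_zero_of_notMem_tsupport fun h0 => ht (hsub h0), mul_zero]) h0
    rw [lcFourier_apply]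
    refine h.trans ?_
    change W 0 (lcTranspose d f) = _
    rw [hW0, lcInverse_lcTranspose]
  · intro h
    refine ⟨Set.univ, W, isOpen_univ, Set.mem_univ _,
      ⟨fun g => (hWsmooth g).contDiffOn, fun f g _ _ => ?_⟩, ?_⟩
    · rw [setIntegral_univ, hWint]
    · ext g
      rw [hW0, ← h, lcFourier_apply, lcTranspose_lcInverse]

end Restrictions

/-! ### Equivalence of the two Cauchy problems -/

section Equivalence

variable {d : ℕ} {m : ℝ}

theorem kappa_e_zero : kappa d (e 0) = (√2)⁻¹ • (e 0 + e (Fin.last (d + 1)) : ST d) := by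
  have hl : Fin.last (d + 1) ≠ 0 := Fin.last_pos.ne'
  ext i
  by_cases h0 : i = 0
  · subst h0; simp [kappaFun, e, hl, hl.symm]
  · by_cases h1 : i = Fin.last (d + 1)
    · subst h1; simp [kappaFun, e, hl]
    · simp [kappaFun, e, h0, h1]

theorem kappa_e_last : kappa d (e (Fin.last (d + 1))) =
    (√2)⁻¹ • (e 0 - e (Fin.last (d + 1)) : ST d) := by
  have hl : Fin.last (d + 1) ≠ 0 := Fin.last_pos.ne'
  ext i
  by_cases h0 : i = 0
  · subst h0; simp [kappaFun, e, hl.symm]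
  · by_cases h1 : i = Fin.last (d + 1)
    · subst h1; simp [kappaFun, e, hl, hl.symm, neg_div]
    · simp [kappaFun, e, h0, h1]

theorem kappa_e_middle (i : Fin d) : kappa d (e i.castSucc.succ) = (e i.castSucc.succ : ST d) := by
  have hl : Fin.last (d + 1) ≠ 0 := Fin.last_pos.ne'
  have h1 : i.castSucc.succ ≠ 0 := Fin.succ_ne_zero _
  have h2 : i.castSucc.succ ≠ Fin.last (d + 1) := by
    rw [Fin.succ_castSucc]; exact (Fin.castSucc_lt_last _).ne
  ext j
  by_cases h3 : j = 0
  · subst h3; simp [kappaFun, e, h1.symm, h2.symm]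
  · by_cases h4 : j = Fin.last (d + 1)
    · subst h4; simp [kappaFun, e, hl, h1.symm, h2.symm]
    · simp [kappaFun, h3, h4]

theorem kappa_kappa (x : ST d) : kappa d (kappa d x) = x := kappaFun_involutive x

/-- The light-cone Klein–Gordon operator on test functions. -/
def testLcKleinGordon (m : ℝ) (F : 𝓢(ST d, ℂ)) : 𝓢(ST d, ℂ) :=
  (2 : ℂ) • (∂_{(e (Fin.last (d + 1)) : ST d)} (∂_{(e 0 : ST d)} F : 𝓢(ST d, ℂ)) : 𝓢(ST d, ℂ))
    - ∑ i : Fin d, (∂_{(e i.castSucc.succ : ST d)}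
      (∂_{(e i.castSucc.succ : ST d)} F : 𝓢(ST d, ℂ)) : 𝓢(ST d, ℂ))
    + ((m ^ 2 : ℝ) : ℂ) • F

theorem lcKleinGordon_apply (u : 𝓢'(ST d, ℂ)) (F : 𝓢(ST d, ℂ)) :
    lcKleinGordon m u F = u (testLcKleinGordon m F) := by
  rw [lcKleinGordon, testLcKleinGordon, add_apply, sub_apply, sum_apply, map_add, map_sub, map_sum,
    map_smul, map_smul, smul_apply, smul_apply, lineDeriv_lineDeriv_apply]
  simp only [lineDeriv_lineDeriv_apply]

theorem comp_kappa_lineDeriv (v : ST d) (F : 𝓢(ST d, ℂ)) :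
    compCLMOfContinuousLinearEquiv ℂ (kappa d) (∂_{v} F : 𝓢(ST d, ℂ)) =
      (∂_{kappa d v} (compCLMOfContinuousLinearEquiv ℂ (kappa d) F) : 𝓢(ST d, ℂ)) := by
  rw [lineDerivOp_compCLMOfContinuousLinearEquiv, kappa_kappa]

/-- The factors `1/√2` give `2∂₊∂₋ = (∂₀ + ∂ₙ)(∂₀ - ∂ₙ)`, and the mixed terms cancel by
`lineDeriv_comm`. -/
theorem comp_kappa_testLcKleinGordon (F : 𝓢(ST d, ℂ)) :
    compCLMOfContinuousLinearEquiv ℂ (kappa d) (testLcKleinGordon m F) =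
      testKleinGordon m (compCLMOfContinuousLinearEquiv ℂ (kappa d) F) := by
  rw [testLcKleinGordon, testKleinGordon, map_add, map_sub, map_sum, map_smul, map_smul,
    Fin.sum_univ_castSucc, Fin.succ_last]
  simp only [comp_kappa_lineDeriv, kappa_e_middle, kappa_e_zero, kappa_e_last]
  set G := compCLMOfContinuousLinearEquiv ℂ (kappa d) F
  rw [← sub_sub, sub_right_comm]
  congr 2
  have h2 : (√(2 : ℝ))⁻¹ * (√2)⁻¹ = 2⁻¹ := by
    rw [← mul_inv, Real.mul_self_sqrt (by norm_num)]
  have hc := lineDeriv_comm (e 0 : ST d) (e (Fin.last (d + 1))) G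
  simp only [lineDerivOp_left_smul, lineDerivOp_smul, smul_smul, h2]
  rw [sub_eq_add_neg, lineDerivOp_left_add, lineDerivOp_left_add, lineDerivOp_add, lineDerivOp_add,
    ← neg_one_smul ℝ, lineDerivOp_left_smul, lineDerivOp_left_smul, hc]
  ext x
  simp only [smul_apply, add_apply, sub_apply, smul_eq_mul, Complex.real_smul]
  push_cast
  ring

theorem lcKleinGordon_distComp_apply (u : 𝓢'(ST d, ℂ)) (F : 𝓢(ST d, ℂ)) :
    lcKleinGordon m (distComp u (kappa d).symm) F =
      kleinGordon m u (compCLMOfContinuousLinearEquiv ℂ (kappa d) F) := by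
  rw [lcKleinGordon_apply, distComp_kappa_symm_apply, comp_kappa_testLcKleinGordon,
    kleinGordon_apply]

theorem comp_kappa_comp_kappa_symm (F : 𝓢(ST d, ℂ)) :
    compCLMOfContinuousLinearEquiv ℂ (kappa d)
      (compCLMOfContinuousLinearEquiv ℂ (kappa d).symm F) = F := by
  ext x
  change F ((kappa d).symm (kappa d x)) = F x
  rw [ContinuousLinearEquiv.symm_apply_apply]

theorem comp_kappa_symm_comp_kappa (F : 𝓢(ST d, ℂ)) :
    compCLMOfContinuousLinearEquiv ℂ (kappa d).symm
      (compCLMOfContinuousLinearEquiv ℂ (kappa d) F) = F := by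
  ext x
  change F (kappa d ((kappa d).symm x)) = F x
  rw [ContinuousLinearEquiv.apply_symm_apply]

theorem lcKleinGordon_distComp_eq_zero_iff (u : 𝓢'(ST d, ℂ)) :
    lcKleinGordon m (distComp u (kappa d).symm) = 0 ↔ kleinGordon m u = 0 := by
  constructor
  · intro h
    ext F
    rw [← comp_kappa_comp_kappa_symm F, ← lcKleinGordon_distComp_apply, h]
    rfl
  · intro h
    ext F
    rw [lcKleinGordon_distComp_apply, h]
    rfl

theorem exists_distComp_eq (w : 𝓢'(ST d, ℂ)) :
    ∃ u : 𝓢'(ST d, ℂ), distComp u (kappa d).symm = w := by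
  refine ⟨PointwiseConvergenceCLM.precomp ℂ
    (compCLMOfContinuousLinearEquiv ℂ (kappa d).symm) w, ?_⟩
  ext F
  rw [distComp_kappa_symm_apply]
  change w (compCLMOfContinuousLinearEquiv ℂ (kappa d).symm
    (compCLMOfContinuousLinearEquiv ℂ (kappa d) F)) = w F
  rw [comp_kappa_symm_comp_kappa]

/-- The time derivative of `u` has the same shell representation with amplitudes `-iωa` and `iωb`,
so the criterion for `u` itself applies again. -/
theorem isRestriction_deriv_iff (hm : 0 < m) {u : 𝓢'(ST d, ℂ)} {a b : 𝓢'(Sp d, ℂ)}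
    (hu : ∀ F, u F = a (shellCLM hm 1 F) + b (shellCLM hm (-1) F)) (v : 𝓢'(Sp d, ℂ)) :
    IsRestriction (∂_{(e 0 : ST d)} u) v ↔ ∀ g, fourierT v g =
      -Complex.I * (a (smulLeftCLM ℂ (fun p => (omega m p : ℂ)) g) -
        b (smulLeftCLM ℂ (fun p => (omega m p : ℂ)) g)) := by
  have h : ∀ F, (∂_{(e 0 : ST d)} u : 𝓢'(ST d, ℂ)) F =
      ((-Complex.I) • tMul (fun p => (omega m p : ℂ)) a) (shellCLM hm 1 F) +
        (Complex.I • tMul (fun p => (omega m p : ℂ)) b) (shellCLM hm (-1) F) := by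
    intro F
    rw [TemperedDistribution.lineDerivOp_apply_apply, map_neg, hu, shellCLM_lineDeriv_time,
      shellCLM_lineDeriv_time, map_smul, map_smul, smul_apply, smul_apply, tMul_apply, tMul_apply]
    simp only [smul_eq_mul]
    push_cast
    ring
  rw [isRestriction_iff hm h]
  refine forall_congr' fun g => ?_
  rw [smul_apply, smul_apply, tMul_apply, tMul_apply, smul_eq_mul, smul_eq_mul]
  constructor <;> intro h' <;> rw [h'] <;> ring

/-- The system `û₀ = a + b`, `û₁ = -iω(a - b)` is invertible because multiplication by `ω` is
invertible on Schwartz functions. -/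
theorem initial_iff_amplitude (hm : 0 < m) {u : 𝓢'(ST d, ℂ)} {a b : 𝓢'(Sp d, ℂ)}
    (hu : ∀ F, u F = a (shellCLM hm 1 F) + b (shellCLM hm (-1) F)) (u₀ u₁ : 𝓢'(Sp d, ℂ)) :
    IsRestriction u u₀ ∧ IsRestriction (∂_{(e 0 : ST d)} u) u₁ ↔
      (∀ g, a g = amplitude m 1 u₀ u₁ g) ∧ ∀ g, b g = amplitude m (-1) u₀ u₁ g := by
  rw [isRestriction_iff hm hu, isRestriction_deriv_iff hm hu]
  have hI := Complex.I_mul_I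
  constructor
  · rintro ⟨h0, h1⟩
    refine ⟨fun g => ?_, fun g => ?_⟩
    · rw [amplitude_apply, h0, h1, smulLeft_omega_inv hm]
      push_cast
      linear_combination ((a g - b g) / 2) * hI
    · rw [amplitude_apply, h0, h1, smulLeft_omega_inv hm]
      push_cast
      linear_combination (-(a g - b g) / 2) * hI
  · rintro ⟨ha, hb⟩
    refine ⟨fun g => ?_, fun g => ?_⟩
    · rw [ha, hb, amplitude_apply, amplitude_apply]
      push_cast
      ring
    · rw [ha, hb, amplitude_apply, amplitude_apply, smulLeft_inv_omega hm]
      push_cast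
      linear_combination (fourierT u₁ g) * hI

/-- The sign of `p⁺` separates the two shells, so one squeezed generalized function determines both
amplitudes. This is why a single datum suffices in the characteristic problem. -/
theorem amplitude_eq_of_tame (hm : 0 < m) {b : SqueezedDist d} {a₁ a₂ : 𝓢'(Sp d, ℂ)}
    (h : ∀ f, b f = a₁ (compMu hm one_sq' f) + a₂ (compMu hm neg_one_sq' f)) (g : 𝓢(Sp d, ℂ)) :
    a₁ g = b (compNu hm 1 g) ∧ a₂ g = b (compNu hm (-1) g) := by
  constructor
  · have h2 := compMu_compNu_neg hm neg_one_sq' g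
    rw [neg_neg] at h2
    rw [h, compMu_compNu, h2, map_zero, add_zero]
  · rw [h, compMu_compNu, compMu_compNu_neg hm one_sq' g, map_zero, zero_add]

/-- Under the law, each set of initial conditions is equivalent to `a` and `b` being the two
instances of `amplitude` formed from `u₀` and `u₁`. -/
theorem solvesCauchy_iff (hm : 0 < m) {u₀ u₁ : 𝓢'(Sp d, ℂ)} {v₀ : TameDist d}
    (hlaw : LawToTame m u₀ u₁ v₀) (u : 𝓢'(ST d, ℂ)) :
    SolvesCauchy m u₀ u₁ u ↔ SolvesCharCauchy m v₀ (distComp u (kappa d).symm) := by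
  rw [lawToTame_iff hm] at hlaw
  constructor
  · rintro ⟨he, h0, h1⟩
    obtain ⟨a, b, hu⟩ := exists_amplitudes hm he
    obtain ⟨ha, hb⟩ := (initial_iff_amplitude hm hu u₀ u₁).1 ⟨h0, h1⟩
    refine ⟨(lcKleinGordon_distComp_eq_zero_iff u).2 he,
      (isTameRestriction_iff hm hu v₀).2 fun f => ?_⟩
    rw [ha, hb, hlaw]
  · rintro ⟨he, h0⟩
    have he' := (lcKleinGordon_distComp_eq_zero_iff u).1 he
    obtain ⟨a, b, hu⟩ := exists_amplitudes hm he'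
    have h1 := (isTameRestriction_iff hm hu v₀).1 h0
    obtain ⟨h2, h3⟩ := (initial_iff_amplitude hm hu u₀ u₁).2
      ⟨fun g => (amplitude_eq_of_tame hm h1 g).1.trans (amplitude_eq_of_tame hm hlaw g).1.symm,
        fun g => (amplitude_eq_of_tame hm h1 g).2.trans (amplitude_eq_of_tame hm hlaw g).2.symm⟩
    exact ⟨he', h2, h3⟩

theorem solvesCauchy_unique (hm : 0 < m) {u₀ u₁ : 𝓢'(Sp d, ℂ)} {u u' : 𝓢'(ST d, ℂ)}
    (h : SolvesCauchy m u₀ u₁ u) (h' : SolvesCauchy m u₀ u₁ u') : u = u' := by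
  obtain ⟨a, b, hu⟩ := exists_amplitudes hm h.equation
  obtain ⟨a', b', hu'⟩ := exists_amplitudes hm h'.equation
  obtain ⟨ha, hb⟩ := (initial_iff_amplitude hm hu u₀ u₁).1 ⟨h.initial, h.initial_deriv⟩
  obtain ⟨ha', hb'⟩ := (initial_iff_amplitude hm hu' u₀ u₁).1 ⟨h'.initial, h'.initial_deriv⟩
  ext F
  rw [hu, hu', ha, hb, ha', hb']

theorem solvesCharCauchy_unique (hm : 0 < m) {v₀ : TameDist d} {w w' : 𝓢'(ST d, ℂ)}
    (h : SolvesCharCauchy m v₀ w) (h' : SolvesCharCauchy m v₀ w') : w = w' := by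
  obtain ⟨u, rfl⟩ := exists_distComp_eq w
  obtain ⟨u', rfl⟩ := exists_distComp_eq w'
  obtain ⟨a, b, hu⟩ :=
    exists_amplitudes hm ((lcKleinGordon_distComp_eq_zero_iff u).1 h.equation)
  obtain ⟨a', b', hu'⟩ :=
    exists_amplitudes hm ((lcKleinGordon_distComp_eq_zero_iff u').1 h'.equation)
  have h1 := amplitude_eq_of_tame hm ((isTameRestriction_iff hm hu v₀).1 h.initial)
  have h2 := amplitude_eq_of_tame hm ((isTameRestriction_iff hm hu' v₀).1 h'.initial)
  congr 1
  ext F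
  rw [hu, hu', (h1 _).1, (h1 _).2, (h2 _).1, (h2 _).2]

end Equivalence

end CharCauchy

end

theorem mainTheorem8 (d : ℕ) (m : ℝ) (hm : 0 < m)
    (u₀ u₁ : 𝓢'(CharCauchy.Sp d, ℂ)) (v₀ : CharCauchy.TameDist d) :
    (CharCauchy.LawToTame m u₀ u₁ v₀ ↔
      CharCauchy.LawFromTame₀ m u₀ v₀ ∧ CharCauchy.LawFromTame₁ m u₁ v₀) ∧
    (CharCauchy.LawToTame m u₀ u₁ v₀ →
      ∀ u : 𝓢'(CharCauchy.ST d, ℂ),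
        CharCauchy.SolvesCauchy m u₀ u₁ u ↔
          CharCauchy.SolvesCharCauchy m v₀
            (CharCauchy.distComp u (CharCauchy.kappa d).symm)) ∧
    (∀ u u' : 𝓢'(CharCauchy.ST d, ℂ),
      CharCauchy.SolvesCauchy m u₀ u₁ u → CharCauchy.SolvesCauchy m u₀ u₁ u' → u = u') ∧
    (∀ w w' : 𝓢'(CharCauchy.ST d, ℂ),
      CharCauchy.SolvesCharCauchy m v₀ w → CharCauchy.SolvesCharCauchy m v₀ w' → w = w') :=
  ⟨CharCauchy.law_iff hm u₀ u₁ v₀,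
    fun hlaw u => CharCauchy.solvesCauchy_iff hm hlaw u,
    fun _ _ h h' => CharCauchy.solvesCauchy_unique hm h h',
    fun _ _ h h' => CharCauchy.solvesCharCauchy_unique hm h h'⟩
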